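/- Let $d\ge 1$ be an integer, $m\ge -d$ and $\nu>0$ real numbers, and let $L=-\Delta+|x|^2+m$ on $\mathbb R^d$. Let $h_v(x,y)=e^{-vm}\,[2\pi\sinh 2v]^{-d/2}\,\exp\!\big(-\tfrac{|x-y|^2}{2\tanh 2v}-(\tanh v)\,x\cdot y\big)$, $v>0$, be the heat kernel of $L$, and put $e^{-vL}f(x)=\int_{\mathbb R^d}h_v(x,y)f(y)\,dy$ and $$P_tf(x)=\frac{t^{2\nu}}{4^\nu\Gamma(\nu)}\int_0^\infty e^{-\frac{t^2}{4v}}\,\big[e^{-vL}f\big](x)\,\frac{dv}{v^{1+\nu}},\qquad t>0,\ x\in\mathbb R^d.$$ Let $$\phi(y)=\frac{e^{-|y|^2/2}}{(1+|y|)^{\frac{d+m}2}\,[\ln(e+|y|)]^{1+\nu}}\ \text{ if } m>-d,\qquad \phi(y)=\frac{e^{-|y|^2/2}}{[\ln(e+|y|)]^{\nu}}\ \text{ if } m=-d,$$ and let $L^1(\phi)$ be the space of measurable functions $f$ on $\mathbb R^d$ with $\int_{\mathbb R^d}|f|\,\phi\,dy<\infty$. For every $f:\mathbb R^d\to\mathbb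 C$ in $L^1(\phi)$, the integrals defining $e^{-vL}f(x)$ and $u(t,x)=P_tf(x)$ converge absolutely (the latter also as a double integral in $(v,y)$) for all $v,t>0$ and $x\in\mathbb R^d$, and (i) $u\in C^\infty((0,\infty)\times\mathbb R^d)$; (ii) $u_{tt}+\frac{1-2\nu}{t}\,u_t=Lu$ in $(0,\infty)\times\mathbb R^d$; (iii) $\lim_{t\to0^+}u(t,x)=f(x)$ for almost every $x\in\mathbb R^d$. Conversely, if $f:\mathbb R^d\to[0,\infty)$ is measurable and the integral defining $P_tf(x)$ is finite for some $(t,x)\in(0,\infty)\times\mathbb R^d$, then $f\in L^1(\phi)$. -/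

import Mathlib

open scoped ContDiff ENNReal Topology

noncomputable section

namespace PoissonHermite

/-- The weight `φ` on `ℝ^d`: a Gaussian times a power and a logarithmic factor, with a separate
formula in the critical case `m = -d` (in all uses, `m ≥ -d`). -/
def weight {d : ℕ} (m ν : ℝ) (y : EuclideanSpace ℝ (Fin d)) : ℝ :=
  if -(d : ℝ) < m then
    Real.exp (-‖y‖ ^ 2 / 2) /
      ((1 + ‖y‖) ^ (((d : ℝ) + m) / 2) * Real.log (Real.exp 1 + ‖y‖) ^ (1 + ν))
  else
    Real.exp (-‖y‖ ^ 2 / 2) / Real.log (Real.exp 1 + ‖y‖) ^ ν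

/-- `f ∈ L¹(φ)`: `f` is measurable and `∫ |f| φ < ∞`. As `φ` is continuous and positive,
measurability of `φ f` is the same as measurability of `f`. -/
def MemL1Weight {d : ℕ} (m ν : ℝ) {F : Type*} [NormedAddCommGroup F] [NormedSpace ℝ F]
    (f : EuclideanSpace ℝ (Fin d) → F) : Prop :=
  MeasureTheory.Integrable (fun y => weight m ν y • f y)

/-- The Hermite operator `L = -Δ + |x|² + m`. -/
def hermiteOp {d : ℕ} (m : ℝ) (g : EuclideanSpace ℝ (Fin d) → ℂ)
    (x : EuclideanSpace ℝ (Fin d)) : ℂ :=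
  -(Laplacian.laplacian g x) + ((‖x‖ ^ 2 + m : ℝ) : ℂ) * g x

/-- The (Mehler) heat kernel `h_v(x, y)` of the semigroup `e^{-vL}`, `v > 0`. -/
def mehlerKernel {d : ℕ} (m v : ℝ) (x y : EuclideanSpace ℝ (Fin d)) : ℝ :=
  Real.exp (-(v * m)) * (2 * Real.pi * Real.sinh (2 * v)) ^ (-(d : ℝ) / 2) *
    Real.exp (-(‖x - y‖ ^ 2 / (2 * Real.tanh (2 * v))) - Real.tanh v * inner ℝ x y)

/-- `[e^{-vL} f](x) = ∫ h_v(x, y) f(y) dy`. -/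
def heatIntegral {d : ℕ} (m v : ℝ) (f : EuclideanSpace ℝ (Fin d) → ℂ)
    (x : EuclideanSpace ℝ (Fin d)) : ℂ :=
  ∫ y, (mehlerKernel m v x y : ℂ) * f y

/-- The subordination density
`t^{2ν} / (4^ν Γ(ν)) · e^{-t²/(4v)} / v^{1+ν}`. -/
def subordinator (ν t v : ℝ) : ℝ :=
  t ^ (2 * ν) / (4 ^ ν * Real.Gamma ν) * (Real.exp (-(t ^ 2 / (4 * v))) / v ^ (1 + ν))

/-- The Poisson-like integral `P_t f(x)`. -/
def poissonIntegral {d : ℕ} (m ν t : ℝ) (f : EuclideanSpace ℝ (Fin d) → ℂ)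
    (x : EuclideanSpace ℝ (Fin d)) : ℂ :=
  ∫ v in Set.Ioi (0 : ℝ), (subordinator ν t v : ℂ) * heatIntegral m v f x

/-- The Poisson-like integral `P_t g(x) ∈ [0, ∞]` of a nonnegative function `g`; it always makes
sense, and may be infinite. -/
def poissonLIntegral {d : ℕ} (m ν t : ℝ) (g : EuclideanSpace ℝ (Fin d) → ℝ≥0∞)
    (x : EuclideanSpace ℝ (Fin d)) : ℝ≥0∞ :=
  ∫⁻ v in Set.Ioi (0 : ℝ), ENNReal.ofReal (subordinator ν t v) *
    ∫⁻ y, ENNReal.ofReal (mehlerKernel m v x y) * g y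

end PoissonHermite

end

noncomputable section

namespace PoissonHermite

open MeasureTheory

/-! Since `coth 2v - tanh v = 1 / sinh 2v`, the subordinated kernel is `t^{2ν}` times a constant
times `exp (ℓ(w)) a(v,y)`. Here `w = (t², |x|², x)`, the functional `ℓ = phase (v,y)` is linear in
`w`, and `a = amplitude` does not depend on `(t,x)`. So `u` is, up to `t^{2ν}`, an exponential
(Laplace) integral against `a f`, evaluated along a smooth surface in parameter space.

The weight is the size of this kernel after integration in `v`. For large `v` the kernel is about
`e^{-|y|²/2} e^{-(d+m)v} v^{-1-ν}`, with a further cutoff of the type `exp(-|y|² e^{-4v}/2)` that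
suppresses `v` below `V = log(e+|y|)/2`. If `d+m > 0` the integral is comparable to the value at
`V`. If `d+m = 0` the tail `∫_V^∞ v^{-1-ν} dv` decides, and one logarithm is lost. Bounded times
carry additional Gaussian decay and never matter. The two-sided estimate
(`exists_lintegral_kernel_le`, `exists_le_lintegral_kernel`) gives, by Tonelli, both absolute
convergence and the converse.

The upper bound holds on an open set of parameters, and inside such a set an exponential integral is
smooth: factors of `ℓ` produced by differentiation are absorbed by moving `w` slightly
(`exists_norm_mul_exp_le`). Differentiating in `t` and `x` inserts polynomials in `ℓ`. Assembled as
in the equation they equal the logarithmic `v`-derivative of the kernel (`hasDerivAt_kernel`, the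
heat equation in disguise), and this integrates to zero because the kernel vanishes at both ends of
`(0, ∞)`.

For the boundary limit, `e^{-vL} f → f` at every Lebesgue point of `f`, by a Gaussian bound relative
to the weight. The subordination densities are an approximate identity at `v = 0`, which transfers
the limit to `P_t f`. -/

/-- In finite dimension the operator norm of a functional is controlled by its values on a fixed
finite set. -/
theorem exists_finset_opNorm_le (E : Type*) [NormedAddCommGroup E] [NormedSpace ℝ E]
    [FiniteDimensional ℝ E] :
    ∃ T : Finset E, ∀ l : E →L[ℝ] ℝ, ∃ u ∈ T, ‖l‖ ≤ l u := by
  classical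
  let b := Module.finBasis ℝ E
  obtain ⟨A, hA, hb⟩ := b.exists_opNorm_le (F := ℝ)
  -- The signs accommodate `|l (b i)|`; the vector `0` serves the zero-dimensional space, which has
  -- no basis vector to choose.
  refine ⟨insert 0 (Finset.univ.image (fun i => A • b i) ∪ Finset.univ.image (fun i => -(A • b i))),
    fun l => ?_⟩
  by_cases hn : Nonempty (Fin (Module.finrank ℝ E))
  · obtain ⟨i, -, hi⟩ := Finset.exists_max_image (Finset.univ : Finset (Fin (Module.finrank ℝ E)))
      (fun i => |l (b i)|) Finset.univ_nonempty
    have h1 : ‖l‖ ≤ A * |l (b i)| :=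
      hb (abs_nonneg _) (fun j => hi j (Finset.mem_univ j))
    rcases abs_choice (l (b i)) with h | h
    · exact ⟨A • b i, by simp, by rw [map_smul, smul_eq_mul, ← h]; exact h1⟩
    · exact ⟨-(A • b i), by simp, by
        rw [map_neg, map_smul, smul_eq_mul, ← mul_neg, ← h]; exact h1⟩
  · refine ⟨0, by simp, ?_⟩
    have h1 : ‖l‖ ≤ A * 0 := hb le_rfl (fun j => (hn ⟨j⟩).elim)
    simpa using h1

/-- Uniform control of `‖l‖ exp (l w')` near a point of an open set by finitely many values of
`exp ∘ l` in that set. -/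
theorem exists_norm_mul_exp_le {E : Type*} [NormedAddCommGroup E] [NormedSpace ℝ E]
    [FiniteDimensional ℝ E] {U : Set E} (hU : IsOpen U) {w : E} (hw : w ∈ U) :
    ∃ δ > 0, ∃ T : Finset E, Metric.ball w δ ⊆ U ∧ (∀ u ∈ T, u ∈ U) ∧
      ∀ l : E →L[ℝ] ℝ, ∀ w' ∈ Metric.ball w δ,
        ‖l‖ * Real.exp (l w') ≤ δ⁻¹ * ∑ u ∈ T, Real.exp (l u) := by
  classical
  obtain ⟨T, hT⟩ := exists_finset_opNorm_le E
  -- Displacing `w` by less than `δ` costs `δ‖l‖` in the exponent, and the prefactor `‖l‖` costs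
  -- another `δ‖l‖` through `x ≤ exp x`. The shift by `2δu` with `‖l‖ ≤ l u` pays for both.
  have h1 : ∀ᶠ δ in 𝓝[>] (0 : ℝ), ∀ u ∈ T, w + (2 * δ) • u ∈ U := by
    rw [Filter.eventually_all_finset]
    intro u _
    have hc : Filter.Tendsto (fun δ : ℝ => w + (2 * δ) • u) (𝓝[>] 0) (𝓝 (w + (2 * (0 : ℝ)) • u)) :=
      (Continuous.tendsto (by fun_prop) 0).mono_left nhdsWithin_le_nhds
    refine hc.eventually (hU.mem_nhds ?_)
    simpa using hw
  have h2 : ∀ᶠ δ in 𝓝[>] (0 : ℝ), Metric.ball w δ ⊆ U := by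
    obtain ⟨ε, hε, hs⟩ := Metric.isOpen_iff.1 hU w hw
    filter_upwards [Ioo_mem_nhdsGT hε] with δ hδ
    exact (Metric.ball_subset_ball hδ.2.le).trans hs
  obtain ⟨δ, ⟨hδT, hδU⟩, hδ⟩ := ((h1.and h2).and self_mem_nhdsWithin).exists
  refine ⟨δ, hδ, T.image (fun u => w + (2 * δ) • u), hδU, ?_, ?_⟩
  · intro u hu
    obtain ⟨u', hu', rfl⟩ := Finset.mem_image.1 hu
    exact hδT u' hu'
  · intro l w' hw'
    obtain ⟨u, hu, hlu⟩ := hT l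
    have h3 : l w' ≤ l w + δ * ‖l‖ := by
      have : l (w' - w) ≤ ‖l‖ * ‖w' - w‖ := (le_abs_self _).trans (l.le_opNorm _)
      rw [map_sub] at this
      have h4 : ‖w' - w‖ ≤ δ := by rw [← dist_eq_norm]; exact (Metric.mem_ball.1 hw').le
      nlinarith [norm_nonneg l]
    have h5 : δ * ‖l‖ ≤ Real.exp (δ * ‖l‖) := by linarith [Real.add_one_le_exp (δ * ‖l‖)]
    have h6 : δ * (‖l‖ * Real.exp (l w')) ≤ Real.exp (l (w + (2 * δ) • u)) := by
      calc δ * (‖l‖ * Real.exp (l w')) = (δ * ‖l‖) * Real.exp (l w') := by ring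
        _ ≤ Real.exp (δ * ‖l‖) * Real.exp (l w + δ * ‖l‖) := by gcongr
        _ = Real.exp (l w + 2 * δ * ‖l‖) := by rw [← Real.exp_add]; ring_nf
        _ ≤ _ := by
          apply Real.exp_le_exp.2
          rw [map_add, map_smul, smul_eq_mul]
          gcongr
    have h7 : Real.exp (l (w + (2 * δ) • u)) ≤
        ∑ u ∈ T.image (fun u => w + (2 * δ) • u), Real.exp (l u) :=
      Finset.single_le_sum (f := fun u => Real.exp (l u)) (fun _ _ => (Real.exp_pos _).le)
        (Finset.mem_image_of_mem _ hu)
    rw [inv_mul_eq_div, le_div_iff₀ hδ]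
    linarith

/-! ### Smoothness of integrals of exponential families. -/

section ExpIntegral

variable {Ω E : Type*} [MeasurableSpace Ω] {μ : Measure Ω} [NormedAddCommGroup E]
  [NormedSpace ℝ E] {F : Type*} [NormedAddCommGroup F] [NormedSpace ℝ F]

/-- Integrability of `exp (ℓ w) • g` for all parameters `w` in `U`. -/
def ExpIntegrableOn (μ : Measure Ω) (l : Ω → E →L[ℝ] ℝ) (g : Ω → F) (U : Set E) : Prop :=
  ∀ w ∈ U, Integrable (fun a => Real.exp (l a w) • g a) μ

variable [FiniteDimensional ℝ E] {l : Ω → E →L[ℝ] ℝ} {g : Ω → F} {U : Set E}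

/-- The majorant is independent of the parameter and already includes the factor `‖l a‖` created by
one differentiation, as dominated convergence requires. -/
theorem ExpIntegrableOn.exists_bound (h : ExpIntegrableOn μ l g U) (hU : IsOpen U) {w : E}
    (hw : w ∈ U) : ∃ δ > 0, Metric.ball w δ ⊆ U ∧ ∃ B : Ω → ℝ, Integrable B μ ∧
      ∀ a, ∀ w' ∈ Metric.ball w δ, ‖l a‖ * Real.exp (l a w') * ‖g a‖ ≤ B a := by
  obtain ⟨δ, hδ, T, hδU, hTU, hb⟩ := exists_norm_mul_exp_le hU hw
  refine ⟨δ, hδ, hδU, fun a => δ⁻¹ * ∑ u ∈ T, Real.exp (l a u) * ‖g a‖, ?_, ?_⟩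
  · refine (integrable_finsetSum _ fun u hu => ?_).const_mul _
    have := (h u (hTU u hu)).norm
    simpa [norm_smul] using this
  · intro a w' hw'
    have := mul_le_mul_of_nonneg_right (hb (l a) w' hw') (norm_nonneg (g a))
    rwa [mul_assoc δ⁻¹, Finset.sum_mul] at this

/-- A factor of size `‖l‖` does not shrink the parameter set `U`, so the argument can be iterated.
-/
theorem ExpIntegrableOn.norm_mul {F' : Type*} [NormedAddCommGroup F'] [NormedSpace ℝ F']
    (h : ExpIntegrableOn μ l g U) (hU : IsOpen U) (hl : AEStronglyMeasurable l μ)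
    {g' : Ω → F'} (hg' : AEStronglyMeasurable g' μ) {C : ℝ}
    (hgg : ∀ a, ‖g' a‖ ≤ C * (‖l a‖ * ‖g a‖)) : ExpIntegrableOn μ l g' U := by
  intro w hw
  obtain ⟨δ, hδ, -, B, hB, hb⟩ := h.exists_bound hU hw
  refine Integrable.mono' (hB.const_mul |C|) ?_ (Filter.Eventually.of_forall fun a => ?_)
  · exact (Real.continuous_exp.comp_aestronglyMeasurable (hl.apply_continuousLinearMap w)).smul hg'
  · rw [norm_smul, Real.norm_of_nonneg (Real.exp_pos _).le]
    have h1 := hb a w (Metric.mem_ball_self hδ)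
    have h2 : ‖g' a‖ ≤ |C| * (‖l a‖ * ‖g a‖) :=
      (hgg a).trans (mul_le_mul_of_nonneg_right (le_abs_self C) (by positivity))
    calc Real.exp (l a w) * ‖g' a‖ ≤ Real.exp (l a w) * (|C| * (‖l a‖ * ‖g a‖)) := by gcongr
      _ = |C| * (‖l a‖ * Real.exp (l a w) * ‖g a‖) := by ring
      _ ≤ _ := by gcongr

theorem ExpIntegrableOn.smulRight (h : ExpIntegrableOn μ l g U) (hU : IsOpen U)
    (hl : AEStronglyMeasurable l μ) (hg : AEStronglyMeasurable g μ) :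
    ExpIntegrableOn μ l (fun a => (l a).smulRight (g a)) U := by
  refine h.norm_mul hU hl ?_ (C := 1) (fun a => ?_)
  · exact (ContinuousLinearMap.smulRightL ℝ E F).aestronglyMeasurable_comp₂ hl hg
  · simp [ContinuousLinearMap.norm_smulRight_apply]

theorem ExpIntegrableOn.hasFDerivAt (h : ExpIntegrableOn μ l g U) (hU : IsOpen U)
    (hl : AEStronglyMeasurable l μ) (hg : AEStronglyMeasurable g μ) {w : E} (hw : w ∈ U) :
    HasFDerivAt (fun w => ∫ a, Real.exp (l a w) • g a ∂μ)
      (∫ a, Real.exp (l a w) • (l a).smulRight (g a) ∂μ) w := by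
  obtain ⟨δ, hδ, hδU, B, hB, hb⟩ := h.exists_bound hU hw
  refine hasFDerivAt_integral_of_dominated_of_fderiv_le (bound := B)
    (F' := fun w a => Real.exp (l a w) • (l a).smulRight (g a)) (Metric.ball_mem_nhds w hδ)
    ?_ (h w hw) ((h.smulRight hU hl hg) w hw).aestronglyMeasurable ?_ hB ?_
  · filter_upwards [hU.mem_nhds hw] with w' hw'
    exact (h w' hw').aestronglyMeasurable
  · refine Filter.Eventually.of_forall fun a w' hw' => ?_
    rw [norm_smul, Real.norm_of_nonneg (Real.exp_pos _).le,
      ContinuousLinearMap.norm_smulRight_apply]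
    linarith [hb a w' hw']
  · refine Filter.Eventually.of_forall fun a w' _ => ?_
    have h1 : HasFDerivAt (fun w => Real.exp (l a w)) (Real.exp (l a w') • l a) w' :=
      ((l a).hasFDerivAt).exp
    convert h1.smul_const (g a) using 1
    ext x
    simp [smul_smul]

end ExpIntegral

/-- The derivative is again an exponential integral, now with density `l.smulRight g` valued in `E
→L[ℝ] F`. The induction therefore has to range over all target spaces `F`. -/
theorem ExpIntegrableOn.contDiffOn_nat {Ω E : Type} [MeasurableSpace Ω] {μ : Measure Ω}
    [NormedAddCommGroup E] [NormedSpace ℝ E] [FiniteDimensional ℝ E] {l : Ω → E →L[ℝ] ℝ}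
    {U : Set E} (hU : IsOpen U) (hl : AEStronglyMeasurable l μ) (n : ℕ) {F : Type}
    [NormedAddCommGroup F] [NormedSpace ℝ F] {g : Ω → F} (hg : AEStronglyMeasurable g μ)
    (h : ExpIntegrableOn μ l g U) :
    ContDiffOn ℝ n (fun w => ∫ a, Real.exp (l a w) • g a ∂μ) U := by
  induction n generalizing F with
  | zero =>
    exact contDiffOn_zero.2 fun w hw => (h.hasFDerivAt hU hl hg hw).continuousAt.continuousWithinAt
  | succ n ih =>
    rw [Nat.cast_succ, contDiffOn_succ_iff_fderiv_of_isOpen hU]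
    refine ⟨fun w hw => (h.hasFDerivAt hU hl hg hw).differentiableAt.differentiableWithinAt,
      by simp, ?_⟩
    refine (ih ((ContinuousLinearMap.smulRightL ℝ E F).aestronglyMeasurable_comp₂ hl hg)
      (h.smulRight hU hl hg)).congr fun w hw => ?_
    exact (h.hasFDerivAt hU hl hg hw).fderiv

theorem ExpIntegrableOn.contDiffOn {Ω E : Type} [MeasurableSpace Ω] {μ : Measure Ω}
    [NormedAddCommGroup E] [NormedSpace ℝ E] [FiniteDimensional ℝ E] {l : Ω → E →L[ℝ] ℝ}
    {U : Set E} (hU : IsOpen U) (hl : AEStronglyMeasurable l μ) {F : Type}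
    [NormedAddCommGroup F] [NormedSpace ℝ F] {g : Ω → F} (hg : AEStronglyMeasurable g μ)
    (h : ExpIntegrableOn μ l g U) :
    ContDiffOn ℝ ∞ (fun w => ∫ a, Real.exp (l a w) • g a ∂μ) U :=
  contDiffOn_infty.2 fun n => h.contDiffOn_nat hU hl n hg

/-- The derivative of an exponential integral along a curve. -/
theorem ExpIntegrableOn.hasDerivAt_comp {Ω E : Type*} [MeasurableSpace Ω] {μ : Measure Ω}
    [NormedAddCommGroup E] [NormedSpace ℝ E] [FiniteDimensional ℝ E] {l : Ω → E →L[ℝ] ℝ}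
    {U : Set E} {g : Ω → ℂ} (h : ExpIntegrableOn μ l g U) (hU : IsOpen U)
    (hl : AEStronglyMeasurable l μ) (hg : AEStronglyMeasurable g μ) {γ : ℝ → E} {γ' : E} {r : ℝ}
    (hr : γ r ∈ U) (hγ : HasDerivAt γ γ' r) :
    HasDerivAt (fun r => ∫ a, Real.exp (l a (γ r)) • g a ∂μ)
      (∫ a, Real.exp (l a (γ r)) • ((l a γ' : ℂ) * g a) ∂μ) r := by
  have h1 := (h.hasFDerivAt hU hl hg hr).comp_hasDerivAt r hγ
  rw [ContinuousLinearMap.integral_apply ((h.smulRight hU hl hg) _ hr)] at h1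
  simpa [Function.comp_def] using h1

/-! ### Elementary estimates -/

theorem cosh_eq_sinh_add_exp_neg (x : ℝ) : Real.cosh x = Real.sinh x + Real.exp (-x) := by
  rw [Real.cosh_eq, Real.sinh_eq]; ring

theorem sinh_le_half_exp (x : ℝ) : Real.sinh x ≤ Real.exp x / 2 := by
  rw [Real.sinh_eq]; linarith [Real.exp_pos (-x)]

theorem sinh_le_two_mul {x : ℝ} (h0 : 0 ≤ x) (h1 : x ≤ 1) : Real.sinh x ≤ 2 * x := by
  have h2 := Real.abs_exp_sub_one_le (x := x) (by rwa [abs_of_nonneg h0])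
  rw [abs_of_nonneg h0] at h2
  have h3 := (le_abs_self _).trans h2
  rw [Real.sinh_eq]
  linarith [Real.add_one_le_exp (-x)]

/-- Write `sinh 2v = e^{2v} (1 - e^{-4v}) / 2` and use monotonicity. Away from `v = 0` this is the
converse of `sinh_le_half_exp`. -/
theorem exp_le_mul_sinh {v₀ v : ℝ} (h : v₀ ≤ v) :
    (1 - Real.exp (-(4 * v₀))) / 2 * Real.exp (2 * v) ≤ Real.sinh (2 * v) := by
  have h1 : Real.exp (-(2 * v)) = Real.exp (-(4 * v)) * Real.exp (2 * v) := by
    rw [← Real.exp_add]; ring_nf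
  have h2 : Real.exp (-(4 * v)) ≤ Real.exp (-(4 * v₀)) := Real.exp_le_exp.2 (by linarith)
  rw [Real.sinh_eq, h1]
  nlinarith [Real.exp_pos (2 * v)]

theorem one_sub_exp_pos {v₀ : ℝ} (h0 : 0 < v₀) : 0 < 1 - Real.exp (-(4 * v₀)) := by
  have : Real.exp (-(4 * v₀)) < 1 := Real.exp_lt_one_iff.2 (by linarith)
  linarith

theorem two_mul_le_sinh {v : ℝ} (h0 : 0 ≤ v) : 2 * v ≤ Real.sinh (2 * v) :=
  Real.self_le_sinh_iff.2 (by linarith)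

/-- Raise `u ≤ (p/h) e^{hu/p}` to the power `p`. It is used with `u = 1/v` to absorb negative powers
of small times. -/
theorem rpow_mul_exp_neg_le {u p h : ℝ} (hu : 0 < u) (hp : 0 < p) (hh : 0 < h) :
    u ^ p * Real.exp (-(h * u)) ≤ (p / h) ^ p := by
  have h1 : u ≤ p / h * Real.exp (h * u / p) := by
    have h2 := Real.add_one_le_exp (h * u / p)
    have h3 : p / h * (h * u / p) = u := by field_simp
    calc u = p / h * (h * u / p) := h3.symm
      _ ≤ _ := by gcongr; linarith
  have h2 : u ^ p ≤ (p / h) ^ p * Real.exp (h * u) := by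
    calc u ^ p ≤ (p / h * Real.exp (h * u / p)) ^ p := Real.rpow_le_rpow hu.le h1 hp.le
      _ = (p / h) ^ p * Real.exp (h * u) := by
        rw [Real.mul_rpow (by positivity) (Real.exp_pos _).le, ← Real.exp_mul]
        congr 2; field_simp
  calc u ^ p * Real.exp (-(h * u)) ≤ (p / h) ^ p * Real.exp (h * u) * Real.exp (-(h * u)) := by
        gcongr
    _ = (p / h) ^ p := by rw [mul_assoc, ← Real.exp_add]; simp

/-- The factor `e^{-vm} (2π sinh 2v)^{-d/2}` of the heat kernel. -/
def heatFactor (d : ℕ) (m v : ℝ) : ℝ :=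
  Real.exp (-(v * m)) * (2 * Real.pi * Real.sinh (2 * v)) ^ (-(d : ℝ) / 2)

theorem heatFactor_nonneg (d : ℕ) (m : ℝ) {v : ℝ} (hv : 0 ≤ v) : 0 ≤ heatFactor d m v := by
  have := two_mul_le_sinh hv
  have : 0 ≤ Real.sinh (2 * v) := by linarith
  unfold heatFactor; positivity

theorem heatFactor_le_rpow (d : ℕ) (m : ℝ) {v : ℝ} (hv : 0 < v) :
    heatFactor d m v ≤ Real.exp (|m| * v) * v ^ (-(d : ℝ) / 2) := by
  unfold heatFactor
  have h1 := two_mul_le_sinh hv.le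
  have h2 : v ≤ 2 * Real.pi * Real.sinh (2 * v) := by nlinarith [Real.pi_gt_three]
  have h3 : (2 * Real.pi * Real.sinh (2 * v)) ^ (-(d : ℝ) / 2) ≤ v ^ (-(d : ℝ) / 2) :=
    Real.rpow_le_rpow_of_nonpos hv h2 (by
      have : (0 : ℝ) ≤ d := Nat.cast_nonneg d
      linarith)
  have h4 : -(v * m) ≤ |m| * v := by nlinarith [neg_abs_le m]
  gcongr

theorem rpow_exp_two_mul (d : ℕ) {c v : ℝ} (hc : 0 < c) :
    (c * Real.exp (2 * v)) ^ (-(d : ℝ) / 2) = c ^ (-(d : ℝ) / 2) * Real.exp (-(d * v)) := by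
  rw [Real.mul_rpow hc.le (Real.exp_pos _).le, ← Real.exp_mul]
  congr 2; ring

/-- Away from `v = 0`, `(sinh 2v)^{-d/2}` behaves like `e^{-dv}`. This produces the exponent `d +
m`, the bottom of the spectrum of `L`. -/
theorem heatFactor_le_exp (d : ℕ) (m : ℝ) {v₀ : ℝ} (h0 : 0 < v₀) :
    ∃ C > 0, ∀ v ≥ v₀, heatFactor d m v ≤ C * Real.exp (-((d + m) * v)) := by
  have hc : 0 < Real.pi * (1 - Real.exp (-(4 * v₀))) := mul_pos Real.pi_pos (one_sub_exp_pos h0)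
  refine ⟨(Real.pi * (1 - Real.exp (-(4 * v₀)))) ^ (-(d : ℝ) / 2), by positivity,
    fun v hv => ?_⟩
  have h1 := exp_le_mul_sinh hv
  have h3 : (2 * Real.pi * Real.sinh (2 * v)) ^ (-(d : ℝ) / 2) ≤
      (Real.pi * (1 - Real.exp (-(4 * v₀))) * Real.exp (2 * v)) ^ (-(d : ℝ) / 2) :=
    Real.rpow_le_rpow_of_nonpos (by positivity) (by nlinarith [Real.pi_pos]) (by
      have : (0 : ℝ) ≤ d := Nat.cast_nonneg d
      linarith)
  rw [rpow_exp_two_mul d hc] at h3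
  unfold heatFactor
  calc _ ≤ Real.exp (-(v * m)) * ((Real.pi * (1 - Real.exp (-(4 * v₀)))) ^ (-(d : ℝ) / 2) *
        Real.exp (-(d * v))) := by gcongr
    _ = (Real.pi * (1 - Real.exp (-(4 * v₀)))) ^ (-(d : ℝ) / 2) *
        (Real.exp (-(v * m)) * Real.exp (-(d * v))) := by ring
    _ = _ := by rw [← Real.exp_add]; ring_nf

theorem le_heatFactor (d : ℕ) (m : ℝ) {v : ℝ} (hv : 0 < v) :
    Real.pi ^ (-(d : ℝ) / 2) * Real.exp (-((d + m) * v)) ≤ heatFactor d m v := by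
  have h1 := sinh_le_half_exp (2 * v)
  have h2 := two_mul_le_sinh hv.le
  have h3 : (Real.pi * Real.exp (2 * v)) ^ (-(d : ℝ) / 2) ≤
      (2 * Real.pi * Real.sinh (2 * v)) ^ (-(d : ℝ) / 2) :=
    Real.rpow_le_rpow_of_nonpos (by have := Real.pi_pos; nlinarith)
      (by nlinarith [Real.pi_pos]) (by
      have : (0 : ℝ) ≤ d := Nat.cast_nonneg d
      linarith)
  rw [rpow_exp_two_mul d Real.pi_pos] at h3
  unfold heatFactor
  calc _ = Real.exp (-(v * m)) * (Real.pi ^ (-(d : ℝ) / 2) * Real.exp (-(d * v))) := by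
        rw [mul_left_comm, ← Real.exp_add]; ring_nf
    _ ≤ _ := by gcongr

/-! ### The radial profile of the weight -/

/-- The weight without its Gaussian factor, as a function of `κ = d + m` and `r = |y|`. -/
def profile (κ ν r : ℝ) : ℝ :=
  if 0 < κ then 1 / ((1 + r) ^ (κ / 2) * Real.log (Real.exp 1 + r) ^ (1 + ν))
  else 1 / Real.log (Real.exp 1 + r) ^ ν

theorem weight_eq {d : ℕ} (m ν : ℝ) (y : EuclideanSpace ℝ (Fin d)) :
    weight m ν y = Real.exp (-‖y‖ ^ 2 / 2) * profile (d + m) ν ‖y‖ := by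
  unfold weight profile
  have : (-(d : ℝ) < m) ↔ (0 < (d : ℝ) + m) := by constructor <;> intro h <;> linarith
  simp only [this]
  split_ifs <;> rw [mul_one_div]

theorem one_le_log_exp_add {r : ℝ} (hr : 0 ≤ r) : 1 ≤ Real.log (Real.exp 1 + r) := by
  rw [Real.le_log_iff_exp_le (by positivity)]; linarith

theorem profile_pos {κ ν r : ℝ} (hr : 0 ≤ r) : 0 < profile κ ν r := by
  have := one_le_log_exp_add hr
  unfold profile
  split_ifs <;> positivity

theorem profile_le_one {κ ν r : ℝ} (hν : 0 < ν) (hr : 0 ≤ r) : profile κ ν r ≤ 1 := by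
  have h := one_le_log_exp_add hr
  unfold profile
  split_ifs with hκ
  · rw [div_le_one (by positivity)]
    exact one_le_mul_of_one_le_of_one_le (Real.one_le_rpow (by linarith) (by linarith))
      (Real.one_le_rpow h (by linarith))
  · rw [div_le_one (by positivity)]
    exact Real.one_le_rpow h hν.le

/-- Both `1 + r` and `log (e + r)` are at most `e^{1+r}`, so the denominator of the profile is at
most `e^{K(1+r)}` in either case. Then `K r ≤ ε r² + K²/(4ε)`. -/
theorem exists_le_profile {κ ν ε : ℝ} (hν : 0 < ν) (hε : 0 < ε) :
    ∃ c > 0, ∀ r ≥ 0, c * Real.exp (-(ε * r ^ 2)) ≤ profile κ ν r := by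
  set K := |κ| / 2 + 1 + ν
  have hK : 0 < K := by positivity
  refine ⟨Real.exp (-(K + K ^ 2 / (4 * ε))), Real.exp_pos _, fun r hr => ?_⟩
  have h := one_le_log_exp_add hr
  have he : Real.exp 1 + r ≤ Real.exp (1 + r) := by
    rw [Real.exp_add]
    nlinarith [Real.add_one_le_exp r, Real.add_one_le_exp (1 : ℝ)]
  have hlog : Real.log (Real.exp 1 + r) ≤ Real.exp (1 + r) :=
    (Real.log_le_self (by positivity)).trans he
  have h1r : 1 + r ≤ Real.exp (1 + r) := by linarith [Real.add_one_le_exp (1 + r)]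
  have hb : Real.exp (K * (1 + r)) ≤ Real.exp (K + K ^ 2 / (4 * ε) + ε * r ^ 2) := by
    apply Real.exp_le_exp.2
    have : 0 ≤ (2 * ε * r - K) ^ 2 / (4 * ε) := by positivity
    have h2 : (2 * ε * r - K) ^ 2 / (4 * ε) = ε * r ^ 2 - K * r + K ^ 2 / (4 * ε) := by
      field_simp; ring
    linarith
  have key : ∀ D : ℝ, 0 < D → D ≤ Real.exp (K * (1 + r)) →
      Real.exp (-(K + K ^ 2 / (4 * ε))) * Real.exp (-(ε * r ^ 2)) ≤ 1 / D := by
    intro D hD hDK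
    rw [← Real.exp_add, le_div_iff₀ hD]
    calc _ ≤ Real.exp (-(K + K ^ 2 / (4 * ε)) + -(ε * r ^ 2)) *
          Real.exp (K + K ^ 2 / (4 * ε) + ε * r ^ 2) := by gcongr; exact hDK.trans hb
      _ = 1 := by rw [← Real.exp_add, Real.exp_eq_one_iff]; ring
  unfold profile
  split_ifs with hκ
  · refine key _ (by positivity) ?_
    have e1 : (1 + r) ^ (κ / 2) ≤ Real.exp (1 + r) ^ (κ / 2) :=
      Real.rpow_le_rpow (by linarith) h1r (by linarith)
    have e2 : Real.log (Real.exp 1 + r) ^ (1 + ν) ≤ Real.exp (1 + r) ^ (1 + ν) :=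
      Real.rpow_le_rpow (by linarith) hlog (by linarith)
    calc _ ≤ Real.exp (1 + r) ^ (κ / 2) * Real.exp (1 + r) ^ (1 + ν) := by gcongr
      _ = _ := by
        rw [← Real.rpow_add (Real.exp_pos _), ← Real.exp_mul]
        congr 1; simp only [K, abs_of_pos hκ]; ring
  · refine key _ (by positivity) ?_
    calc _ ≤ Real.exp (1 + r) ^ ν := Real.rpow_le_rpow (by linarith) hlog hν.le
      _ = Real.exp (ν * (1 + r)) := by rw [← Real.exp_mul, mul_comm]
      _ ≤ _ := by
        apply Real.exp_le_exp.2
        have : 0 ≤ |κ| / 2 + 1 := by positivity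
        have h3 : ν ≤ K := by simp only [K]; linarith
        gcongr

theorem weight_pos {d : ℕ} (m ν : ℝ) (y : EuclideanSpace ℝ (Fin d)) : 0 < weight m ν y := by
  rw [weight_eq]
  exact mul_pos (Real.exp_pos _) (profile_pos (norm_nonneg _))

theorem weight_le_exp {d : ℕ} (m : ℝ) {ν : ℝ} (hν : 0 < ν) (y : EuclideanSpace ℝ (Fin d)) :
    weight m ν y ≤ Real.exp (-‖y‖ ^ 2 / 2) := by
  rw [weight_eq]
  exact mul_le_of_le_one_right (Real.exp_pos _).le (profile_le_one hν (norm_nonneg _))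

theorem weight_le_one {d : ℕ} (m : ℝ) {ν : ℝ} (hν : 0 < ν) (y : EuclideanSpace ℝ (Fin d)) :
    weight m ν y ≤ 1 :=
  (weight_le_exp m hν y).trans (Real.exp_le_one_iff.2 (by nlinarith [norm_nonneg y]))

/-- Any Gaussian gain over `e^{-|y|²/2}` is enough for domination by the weight. Only large times,
where the gain degenerates, can therefore determine its form. -/
theorem exists_exp_le_weight (d : ℕ) (m : ℝ) {ν ε : ℝ} (hν : 0 < ν) (hε : 0 < ε) :
    ∃ c > 0, ∀ y : EuclideanSpace ℝ (Fin d),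
      c * Real.exp (-(‖y‖ ^ 2 / 2) - ε * ‖y‖ ^ 2) ≤ weight m ν y := by
  obtain ⟨c, hc, h⟩ := exists_le_profile (κ := d + m) hν hε
  refine ⟨c, hc, fun y => ?_⟩
  rw [weight_eq]
  calc _ = Real.exp (-‖y‖ ^ 2 / 2) * (c * Real.exp (-(ε * ‖y‖ ^ 2))) := by
        rw [mul_left_comm, ← Real.exp_add]; ring_nf
    _ ≤ _ := by gcongr; exact h _ (norm_nonneg _)

theorem continuous_weight {d : ℕ} (m ν : ℝ) :
    Continuous (weight m ν : EuclideanSpace ℝ (Fin d) → ℝ) := by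
  have h1 : Continuous fun y : EuclideanSpace ℝ (Fin d) => Real.log (Real.exp 1 + ‖y‖) :=
    (by fun_prop : Continuous fun y : EuclideanSpace ℝ (Fin d) => Real.exp 1 + ‖y‖).log
      (fun y => by positivity)
  have hp : ∀ y : EuclideanSpace ℝ (Fin d), 0 < Real.log (Real.exp 1 + ‖y‖) := fun y =>
    lt_of_lt_of_le one_pos (one_le_log_exp_add (norm_nonneg _))
  have h2 : ∀ y : EuclideanSpace ℝ (Fin d), 0 < 1 + ‖y‖ := fun y => by positivity
  unfold weight
  split_ifs
  · refine Continuous.div (by fun_prop) (Continuous.mul ?_ ?_) (fun y => ?_)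
    · exact (by fun_prop : Continuous fun y : EuclideanSpace ℝ (Fin d) => 1 + ‖y‖).rpow_const
        (fun y => Or.inl (h2 y).ne')
    · exact h1.rpow_const (fun y => Or.inl (hp y).ne')
    · have := hp y; have := h2 y; positivity
  · refine Continuous.div (by fun_prop) (h1.rpow_const (fun y => Or.inl (hp y).ne')) (fun y => ?_)
    have := hp y; positivity

/-! ### Integrals in time for large times -/

/-- With `V = log(e+r)/2` and `u = V - v` one has `(e+r)² e^{-4v} = e^{4u}`, so the cutoff is doubly
exponential in the distance below `V` and beats every rate `β`. The passage from `r²` to `(e+r)²`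
uses `(e+r)² + (r-e)² = 2r² + 2e²`. -/
theorem exp_neg_exp_le (β : ℝ) :
    ∃ C ≥ 1, ∀ r ≥ 0, ∀ v ≥ 0, v ≤ Real.log (Real.exp 1 + r) / 2 →
      Real.exp (-(r ^ 2 * Real.exp (-(4 * v)) / 2)) ≤
        C * Real.exp (-(β * (Real.log (Real.exp 1 + r) / 2 - v))) := by
  refine ⟨Real.exp (Real.exp 1 ^ 2 / 2 + β ^ 2 / 8), Real.one_le_exp (by positivity),
    fun r hr v hv hvV => ?_⟩
  set u := Real.log (Real.exp 1 + r) / 2 - v with hu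
  have hu0 : 0 ≤ u := by linarith
  rw [← Real.exp_add]
  apply Real.exp_le_exp.2
  have h1 : (Real.exp 1 + r) ^ 2 * Real.exp (-(4 * v)) = Real.exp (4 * u) := by
    have : Real.exp 1 + r = Real.exp (2 * (u + v)) := by
      rw [hu, show 2 * (Real.log (Real.exp 1 + r) / 2 - v + v) = Real.log (Real.exp 1 + r) by ring,
        Real.exp_log (by positivity)]
    rw [this, ← Real.exp_nat_mul, ← Real.exp_add]
    push_cast; ring_nf
  have h2 : Real.exp (-(4 * v)) ≤ 1 := Real.exp_le_one_iff.2 (by linarith)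
  have h3 := Real.quadratic_le_exp_of_nonneg (x := 4 * u) (by linarith)
  have h4 : 0 ≤ (r - Real.exp 1) ^ 2 * Real.exp (-(4 * v)) := by positivity
  have h5 : Real.exp 1 ^ 2 * Real.exp (-(4 * v)) ≤ Real.exp 1 ^ 2 :=
    mul_le_of_le_one_right (by positivity) h2
  nlinarith [sq_nonneg (4 * u - β)]

/-- Since `V/v = 1 + (V-v)/v ≤ e^{(V-v)/v₀}`, freezing the power at `V` costs only an exponential in
`V - v`, which the doubly exponential cutoff can pay. -/
theorem rpow_neg_le_of_le {p v₀ v V : ℝ} (hp : 0 ≤ p) (h0 : 0 < v₀) (h1 : v₀ ≤ v) (h2 : v ≤ V) :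
    v ^ (-p) ≤ V ^ (-p) * Real.exp (p / v₀ * (V - v)) := by
  have hv : 0 < v := by linarith
  have hV : 0 < V := by linarith
  have h3 : V ≤ v * Real.exp ((V - v) / v₀) := by
    have e1 := Real.add_one_le_exp ((V - v) / v₀)
    have e2 : (V - v) / v ≤ (V - v) / v₀ := by
      apply div_le_div_of_nonneg_left _ h0 h1; linarith
    have e3 : v * ((V - v) / v + 1) = V := by field_simp; ring
    nlinarith
  have h4 : V ^ p ≤ v ^ p * Real.exp (p / v₀ * (V - v)) := by
    calc V ^ p ≤ (v * Real.exp ((V - v) / v₀)) ^ p := Real.rpow_le_rpow hV.le h3 hp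
      _ = _ := by
        rw [Real.mul_rpow hv.le (Real.exp_pos _).le, ← Real.exp_mul]
        congr 2; ring
  rw [Real.rpow_neg hv.le, Real.rpow_neg hV.le, inv_mul_eq_div, le_div_iff₀ (by positivity),
    inv_mul_le_iff₀ (by positivity)]
  exact h4

theorem lintegral_exp_neg_mul_abs_lt_top {κ : ℝ} (hκ : 0 < κ) :
    ∫⁻ v : ℝ, ENNReal.ofReal (Real.exp (-(κ * |v|))) < ⊤ := by
  have h : Integrable (fun v : ℝ => Real.exp (-(κ * |v|))) := by
    have h1 : IntegrableOn (fun v : ℝ => Real.exp (-(κ * |v|))) (Set.Ioi 0) := by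
      refine (exp_neg_integrableOn_Ioi 0 hκ).congr_fun (fun v hv => ?_) measurableSet_Ioi
      rw [Set.mem_Ioi] at hv
      simp [abs_of_pos hv]
    have h2 : IntegrableOn (fun v : ℝ => Real.exp (-(κ * |v|))) (Set.Iic 0) := by
      refine (integrableOn_exp_mul_Iic hκ 0).congr_fun (fun v hv => ?_) measurableSet_Iic
      simp [abs_of_nonpos (Set.mem_Iic.1 hv)]
    rw [← integrableOn_univ, ← Set.Iic_union_Ioi (a := (0 : ℝ))]
    exact h2.union h1
  exact h.lintegral_lt_top

/-- The main estimate of the large-time part of the kernel. -/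
theorem exists_lintegral_large_le {κ ν v₀ : ℝ} (hκ : 0 ≤ κ) (hν : 0 < ν) (h0 : 0 < v₀) :
    ∃ C > 0, ∀ r ≥ 0, ∫⁻ v in Set.Ici v₀, ENNReal.ofReal
        (Real.exp (-(r ^ 2 * Real.exp (-(4 * v)) / 2)) * Real.exp (-(κ * v)) * v ^ (-(1 + ν))) ≤
      ENNReal.ofReal (C * profile κ ν r) := by
  -- For `κ = 0` the factor `e^{-κv}` gives no decay; the rate `1` is then needed only to the left
  -- of `V`, where the cutoff supplies it.
  set κ' : ℝ := if 0 < κ then κ else 1 with hκ'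
  have hκ'0 : 0 < κ' := by rw [hκ']; split_ifs with h <;> [exact h; exact one_pos]
  -- Of the rate, `(1+ν)/v₀` pays for freezing the power at `V`, one `κ'` for replacing `e^{-κv}` by
  -- `e^{-κV}`, and the other `κ'` remains as integrable decay in `|v - V|`.
  obtain ⟨C, hC1, hC⟩ := exp_neg_exp_le ((1 + ν) / v₀ + 2 * κ')
  set I := (∫⁻ v : ℝ, ENNReal.ofReal (Real.exp (-(κ' * |v|)))).toReal with hI
  have hI0 : 0 ≤ I := ENNReal.toReal_nonneg
  have hIeq : ∫⁻ v : ℝ, ENNReal.ofReal (Real.exp (-(κ' * |v|))) = ENNReal.ofReal I :=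
    (ENNReal.ofReal_toReal (lintegral_exp_neg_mul_abs_lt_top hκ'0).ne).symm
  have hleft : ∀ r ≥ 0, ∀ v ∈ Set.Ici v₀, v ≤ Real.log (Real.exp 1 + r) / 2 →
      Real.exp (-(r ^ 2 * Real.exp (-(4 * v)) / 2)) * Real.exp (-(κ * v)) * v ^ (-(1 + ν)) ≤
      C * ((Real.log (Real.exp 1 + r) / 2) ^ (-(1 + ν)) *
        Real.exp (-(κ * (Real.log (Real.exp 1 + r) / 2)))) *
        Real.exp (-(κ' * |v - Real.log (Real.exp 1 + r) / 2|)) := by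
    intro r hr v hv hvV
    rw [Set.mem_Ici] at hv
    have e1 := hC r hr v (by linarith) hvV
    have e2 := rpow_neg_le_of_le (p := 1 + ν) (by linarith) h0 hv hvV
    set V := Real.log (Real.exp 1 + r) / 2
    have hV : 0 < V := by linarith
    rw [abs_of_nonpos (by linarith : v - V ≤ 0)]
    have hκκ : κ ≤ κ' := by
      rw [hκ']; split_ifs with h <;> linarith
    calc _ ≤ C * Real.exp (-(((1 + ν) / v₀ + 2 * κ') * (V - v))) * Real.exp (-(κ * v)) *
          (V ^ (-(1 + ν)) * Real.exp ((1 + ν) / v₀ * (V - v))) := by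
          have : 0 < v := by linarith
          gcongr
      _ = C * V ^ (-(1 + ν)) * Real.exp (-(((1 + ν) / v₀ + 2 * κ') * (V - v)) + -(κ * v) +
          (1 + ν) / v₀ * (V - v)) := by rw [Real.exp_add, Real.exp_add]; ring
      _ ≤ C * V ^ (-(1 + ν)) * Real.exp (-(κ * V) + -(κ' * -(v - V))) := by
          refine mul_le_mul_of_nonneg_left (Real.exp_le_exp.2 ?_) (by positivity)
          nlinarith
      _ = _ := by rw [Real.exp_add]; ring
  have hV12 : ∀ r ≥ 0, 1 / 2 ≤ Real.log (Real.exp 1 + r) / 2 := fun r hr => by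
    linarith [one_le_log_exp_add hr]
  have hrpow : ∀ r ≥ 0, ∀ p : ℝ, (Real.log (Real.exp 1 + r) / 2) ^ (-p) =
      2 ^ p * (1 / Real.log (Real.exp 1 + r) ^ p) := fun r hr p => by
    have := one_le_log_exp_add hr
    rw [Real.rpow_neg (by positivity), Real.div_rpow (by positivity) (by positivity)]
    field_simp
  have hint : ∀ V A : ℝ, 0 ≤ A → ∫⁻ v : ℝ, ENNReal.ofReal (A * Real.exp (-(κ' * |v - V|))) =
      ENNReal.ofReal (A * I) := fun V A hA => by
    simp_rw [ENNReal.ofReal_mul hA]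
    rw [lintegral_const_mul' _ _ ENNReal.ofReal_ne_top, ← hIeq]
    congr 1
    exact lintegral_sub_right_eq_self (fun v : ℝ => ENNReal.ofReal (Real.exp (-(κ' * |v|)))) V
  -- For `κ > 0` there is exponential decay on both sides of `V`, so the value at `V` gives the
  -- size. For `κ = 0` only the power remains on the right of `V`; its tail integral `V^{-ν}/ν`
  -- dominates the left part, of order `V^{-(1+ν)}`.
  rcases hκ.lt_or_eq with hpos | hzero
  · have hkk : κ' = κ := by rw [hκ', if_pos hpos]
    refine ⟨C * 2 ^ (1 + ν) * I + 1, by positivity, fun r hr => ?_⟩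
    set V := Real.log (Real.exp 1 + r) / 2 with hVdef
    have hV := hV12 r hr
    calc _ ≤ ∫⁻ v in Set.Ici v₀, ENNReal.ofReal (C * (V ^ (-(1 + ν)) * Real.exp (-(κ * V))) *
          Real.exp (-(κ' * |v - V|))) := by
          refine setLIntegral_mono (by fun_prop) fun v hv => ENNReal.ofReal_le_ofReal ?_
          rcases le_total v V with h | h
          · exact hleft r hr v hv h
          · rw [abs_of_nonneg (by linarith : 0 ≤ v - V), hkk]
            have e1 : v ^ (-(1 + ν)) ≤ V ^ (-(1 + ν)) :=
              Real.rpow_le_rpow_of_nonpos (by linarith) h (by linarith)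
            have e2 : Real.exp (-(r ^ 2 * Real.exp (-(4 * v)) / 2)) ≤ 1 :=
              Real.exp_le_one_iff.2 (by
                have : 0 ≤ r ^ 2 * Real.exp (-(4 * v)) / 2 := by positivity
                linarith)
            have e3 : Real.exp (-(κ * v)) = Real.exp (-(κ * V)) * Real.exp (-(κ * (v - V))) := by
              rw [← Real.exp_add]; ring_nf
            rw [e3]
            have : 0 < v := by linarith
            calc _ ≤ C * (Real.exp (-(κ * V)) * Real.exp (-(κ * (v - V)))) *
                  V ^ (-(1 + ν)) := by gcongr; linarith
              _ = _ := by ring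
      _ ≤ ∫⁻ v, ENNReal.ofReal (C * (V ^ (-(1 + ν)) * Real.exp (-(κ * V))) *
          Real.exp (-(κ' * |v - V|))) := setLIntegral_le_lintegral _ _
      _ = ENNReal.ofReal (C * (V ^ (-(1 + ν)) * Real.exp (-(κ * V))) * I) :=
          hint V _ (by positivity)
      _ ≤ _ := by
        apply ENNReal.ofReal_le_ofReal
        have e4 : Real.exp (-(κ * V)) ≤ 1 / (1 + r) ^ (κ / 2) := by
          have : Real.exp (-(κ * V)) = (Real.exp 1 + r) ^ (-(κ / 2)) := by
            rw [Real.rpow_def_of_pos (by positivity), hVdef]; ring_nf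
          rw [this, one_div, ← Real.rpow_neg (by positivity)]
          exact Real.rpow_le_rpow_of_nonpos (by positivity)
            (by linarith [Real.add_one_le_exp (1 : ℝ)]) (by linarith)
        have hlog := one_le_log_exp_add hr
        have hp := profile_pos (κ := κ) (ν := ν) hr
        have hpe : profile κ ν r = 1 / (1 + r) ^ (κ / 2) *
            (1 / Real.log (Real.exp 1 + r) ^ (1 + ν)) := by
          rw [profile, if_pos hpos, one_div_mul_one_div]
        calc _ ≤ C * (V ^ (-(1 + ν)) * (1 / (1 + r) ^ (κ / 2))) * I := by gcongr
          _ = C * 2 ^ (1 + ν) * I * profile κ ν r := by rw [hrpow r hr, hpe]; ring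
          _ ≤ _ := by nlinarith
  · have hnk : ¬ 0 < κ := by rw [← hzero]; exact lt_irrefl _
    have hkk : κ' = 1 := by rw [hκ', if_neg hnk]
    refine ⟨C * 2 ^ (1 + ν) * I + 2 ^ ν / ν, by positivity, fun r hr => ?_⟩
    set V := Real.log (Real.exp 1 + r) / 2 with hVdef
    have hV := hV12 r hr
    have hlog := one_le_log_exp_add hr
    have hpe : profile κ ν r = 1 / Real.log (Real.exp 1 + r) ^ ν := by
      rw [profile, if_neg hnk]
    have htail : ∫⁻ v in Set.Ioi V, ENNReal.ofReal (v ^ (-(1 + ν))) =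
        ENNReal.ofReal (V ^ (-ν) / ν) := by
      rw [← ofReal_integral_eq_lintegral_ofReal
        (integrableOn_Ioi_rpow_of_lt (by linarith) (by linarith)), integral_Ioi_rpow_of_lt
        (by linarith) (by linarith)]
      · congr 1
        rw [show -(1 + ν) + 1 = -ν by ring]; field_simp
      · filter_upwards [ae_restrict_mem measurableSet_Ioi] with v hv
        have : 0 < v := by rw [Set.mem_Ioi] at hv; linarith
        positivity
    calc _ ≤ ∫⁻ v in Set.Ici v₀, (ENNReal.ofReal (C * V ^ (-(1 + ν)) * Real.exp (-(κ' * |v - V|)))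
          + (Set.Ioi V).indicator (fun v => ENNReal.ofReal (v ^ (-(1 + ν)))) v) := by
          have hm : Measurable fun v : ℝ => ENNReal.ofReal (v ^ (-(1 + ν))) := by fun_prop
          refine setLIntegral_mono (Measurable.add (f := fun v : ℝ => ENNReal.ofReal
            (C * V ^ (-(1 + ν)) * Real.exp (-(κ' * |v - V|)))) (by fun_prop)
            (hm.indicator measurableSet_Ioi)) fun v hv => ?_
          rcases le_or_gt v V with h | h
          · refine le_trans (ENNReal.ofReal_le_ofReal ?_) le_self_add
            have := hleft r hr v hv h
            rw [← hzero] at this ⊢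
            simpa using this
          · refine le_trans ?_ le_add_self
            rw [Set.indicator_of_mem (Set.mem_Ioi.2 h)]
            refine ENNReal.ofReal_le_ofReal ?_
            have : 0 < v := by linarith
            have e2 : Real.exp (-(r ^ 2 * Real.exp (-(4 * v)) / 2)) ≤ 1 :=
              Real.exp_le_one_iff.2 (by
                have : 0 ≤ r ^ 2 * Real.exp (-(4 * v)) / 2 := by positivity
                linarith)
            rw [← hzero]
            simp only [zero_mul, neg_zero, Real.exp_zero, mul_one]
            exact mul_le_of_le_one_left (by positivity) e2
      _ ≤ ∫⁻ v, (ENNReal.ofReal (C * V ^ (-(1 + ν)) * Real.exp (-(κ' * |v - V|)))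
          + (Set.Ioi V).indicator (fun v => ENNReal.ofReal (v ^ (-(1 + ν)))) v) :=
          setLIntegral_le_lintegral _ _
      _ = ENNReal.ofReal (C * V ^ (-(1 + ν)) * I) + ENNReal.ofReal (V ^ (-ν) / ν) := by
          rw [lintegral_add_left (by fun_prop), hint V _ (by positivity),
            lintegral_indicator measurableSet_Ioi, htail]
      _ ≤ _ := by
        rw [← ENNReal.ofReal_add (by positivity) (by positivity)]
        apply ENNReal.ofReal_le_ofReal
        have e5 : 1 / Real.log (Real.exp 1 + r) ^ (1 + ν) ≤ 1 / Real.log (Real.exp 1 + r) ^ ν :=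
          one_div_le_one_div_of_le (by positivity)
            (Real.rpow_le_rpow_of_exponent_le hlog (by linarith))
        rw [hrpow r hr, hrpow r hr, hpe]
        calc _ ≤ C * (2 ^ (1 + ν) * (1 / Real.log (Real.exp 1 + r) ^ ν)) * I +
              2 ^ ν * (1 / Real.log (Real.exp 1 + r) ^ ν) / ν := by gcongr
          _ = _ := by ring

/-- The lower bound for the large-time part of the kernel. -/
theorem exists_le_lintegral_large {κ ν : ℝ} (hκ : 0 ≤ κ) (hν : 0 < ν) :
    ∃ c > 0, ∀ r ≥ 0, ENNReal.ofReal (c * profile κ ν r) ≤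
      ∫⁻ v in Set.Ioi (Real.log (Real.exp 1 + r) / 2),
        ENNReal.ofReal (Real.exp (-(κ * v)) * v ^ (-(1 + ν))) := by
  have hrpow : ∀ r ≥ 0, ∀ a p : ℝ, 0 < a → (a * Real.log (Real.exp 1 + r)) ^ (-p) =
      a ^ (-p) * (1 / Real.log (Real.exp 1 + r) ^ p) := fun r hr a p ha => by
    have := one_le_log_exp_add hr
    rw [Real.mul_rpow ha.le (by positivity), Real.rpow_neg (by positivity : 0 ≤ Real.log _),
      one_div]
  rcases hκ.lt_or_eq with hpos | hzero
  -- The unit interval after `V` already carries the full size. The constants come from `V + 1 ≤ 2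
  -- log(e+r)` and `e + r ≤ e(1+r)`, which give `e^{-κ(V+1)} ≥ e^{-3κ/2} (1+r)^{-κ/2}`; the rate
  -- `3κ/2` is rounded up to `2κ`.
  · refine ⟨Real.exp (-(2 * κ)) * 2 ^ (-(1 + ν)), by positivity, fun r hr => ?_⟩
    set V := Real.log (Real.exp 1 + r) / 2 with hVdef
    have hlog := one_le_log_exp_add hr
    calc _ ≤ ENNReal.ofReal (Real.exp (-(κ * (V + 1))) * (V + 1) ^ (-(1 + ν))) := by
          apply ENNReal.ofReal_le_ofReal
          have hpe : profile κ ν r = 1 / (1 + r) ^ (κ / 2) *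
              (1 / Real.log (Real.exp 1 + r) ^ (1 + ν)) := by
            rw [profile, if_pos hpos, one_div_mul_one_div]
          have e1 : (2 * Real.log (Real.exp 1 + r)) ^ (-(1 + ν)) ≤ (V + 1) ^ (-(1 + ν)) :=
            Real.rpow_le_rpow_of_nonpos (by linarith) (by linarith) (by linarith)
          have e2 : Real.exp (-(2 * κ)) * (1 / (1 + r) ^ (κ / 2)) ≤ Real.exp (-(κ * (V + 1))) := by
            have e3 : Real.exp (-(κ * (V + 1))) = Real.exp (-κ) *
                (Real.exp 1 + r) ^ (-(κ / 2)) := by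
              rw [Real.rpow_def_of_pos (by positivity), hVdef, ← Real.exp_add]; ring_nf
            have e4 : (Real.exp 1 * (1 + r)) ^ (-(κ / 2)) ≤ (Real.exp 1 + r) ^ (-(κ / 2)) :=
              Real.rpow_le_rpow_of_nonpos (by positivity)
                (by nlinarith [Real.add_one_le_exp (1 : ℝ)]) (by linarith)
            rw [Real.mul_rpow (Real.exp_pos _).le (by linarith), ← Real.exp_mul] at e4
            rw [e3, one_div, ← Real.rpow_neg (by linarith)]
            calc _ ≤ Real.exp (-κ + 1 * -(κ / 2)) * (1 + r) ^ (-(κ / 2)) := by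
                  gcongr; linarith
              _ = Real.exp (-κ) * (Real.exp (1 * -(κ / 2)) * (1 + r) ^ (-(κ / 2))) := by
                  rw [Real.exp_add]; ring
              _ ≤ _ := by gcongr
          rw [hrpow r hr 2 _ two_pos] at e1
          calc _ = (Real.exp (-(2 * κ)) * (1 / (1 + r) ^ (κ / 2))) *
                (2 ^ (-(1 + ν)) * (1 / Real.log (Real.exp 1 + r) ^ (1 + ν))) := by
                rw [hpe]; ring
            _ ≤ _ := by gcongr
      _ = ∫⁻ v in Set.Ioc V (V + 1),
          ENNReal.ofReal (Real.exp (-(κ * (V + 1))) * (V + 1) ^ (-(1 + ν))) := by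
          simp
      _ ≤ ∫⁻ v in Set.Ioc V (V + 1), ENNReal.ofReal (Real.exp (-(κ * v)) * v ^ (-(1 + ν))) := by
          refine setLIntegral_mono (by fun_prop) fun v hv => ENNReal.ofReal_le_ofReal ?_
          have hv0 : 0 < v := by linarith [hv.1]
          have e1 : (V + 1) ^ (-(1 + ν)) ≤ v ^ (-(1 + ν)) :=
            Real.rpow_le_rpow_of_nonpos hv0 hv.2 (by linarith)
          have := hv.2
          gcongr
      _ ≤ _ := lintegral_mono_set Set.Ioc_subset_Ioi_self
  · have hnk : ¬ 0 < κ := by rw [← hzero]; exact lt_irrefl _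
    refine ⟨(1 / 2) ^ (-ν) / ν, by positivity, fun r hr => ?_⟩
    have hlog := one_le_log_exp_add hr
    rw [← hzero]
    simp only [zero_mul, neg_zero, Real.exp_zero, one_mul]
    rw [← ofReal_integral_eq_lintegral_ofReal
      (integrableOn_Ioi_rpow_of_lt (by linarith) (by linarith)), integral_Ioi_rpow_of_lt
      (by linarith) (by linarith)]
    · apply le_of_eq
      congr 1
      rw [profile, if_neg (lt_irrefl _), show -(1 + ν) + 1 = -ν by ring,
        show Real.log (Real.exp 1 + r) / 2 = 1 / 2 * Real.log (Real.exp 1 + r) by ring,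
        hrpow r hr _ _ (by norm_num)]
      ring
    · filter_upwards [ae_restrict_mem measurableSet_Ioi] with v hv
      have : 0 < v := by rw [Set.mem_Ioi] at hv; linarith
      positivity

/-! ### The kernel as an exponential family -/

/-- The hyperbolic cotangent. -/
def coth (x : ℝ) : ℝ := Real.cosh x / Real.sinh x

theorem sinh_two_mul_pos {v : ℝ} (hv : 0 < v) : 0 < Real.sinh (2 * v) :=
  Real.sinh_pos_iff.2 (by linarith)

theorem coth_eq {v : ℝ} (hv : 0 < v) :
    coth (2 * v) = 1 + Real.exp (-(2 * v)) / Real.sinh (2 * v) := by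
  have := (sinh_two_mul_pos hv).ne'
  rw [coth, cosh_eq_sinh_add_exp_neg]
  field_simp

theorem one_le_coth {v : ℝ} (hv : 0 < v) : 1 ≤ coth (2 * v) := by
  rw [coth_eq hv]
  have := sinh_two_mul_pos hv
  have : 0 ≤ Real.exp (-(2 * v)) / Real.sinh (2 * v) := by positivity
  linarith

/-- Expanding `|x-y|²` leaves the coefficient `coth 2v - tanh v` on the inner product, and this is
`1 / sinh 2v`. The exponent is thus affine in the pair `(|x|², x)`. -/
theorem mehlerKernel_eq {d : ℕ} (m : ℝ) {v : ℝ} (hv : 0 < v) (x y : EuclideanSpace ℝ (Fin d)) :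
    mehlerKernel m v x y = heatFactor d m v * Real.exp
      (-(coth (2 * v) / 2 * (‖x‖ ^ 2 + ‖y‖ ^ 2)) + inner ℝ x y / Real.sinh (2 * v)) := by
  unfold mehlerKernel heatFactor
  congr 2
  have h1 : Real.sinh v ≠ 0 := (Real.sinh_pos_iff.2 hv).ne'
  have h2 : Real.cosh v ≠ 0 := (Real.cosh_pos v).ne'
  have h3 : Real.cosh (2 * v) ≠ 0 := (Real.cosh_pos _).ne'
  rw [norm_sub_sq_real, coth, Real.tanh_eq_sinh_div_cosh, Real.tanh_eq_sinh_div_cosh]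
  have h4 : Real.cosh (2 * v) = 1 + 2 * Real.sinh v ^ 2 := by
    rw [Real.cosh_two_mul, Real.cosh_sq]; ring
  have h5 : Real.cosh v ^ 2 = Real.sinh v ^ 2 + 1 := Real.cosh_sq v
  have h6 : Real.tanh v = Real.sinh v / Real.cosh v := Real.tanh_eq_sinh_div_cosh v
  have key : Real.cosh (2 * v) / Real.sinh (2 * v) - Real.sinh v / Real.cosh v =
      1 / Real.sinh (2 * v) := by
    rw [Real.sinh_two_mul]
    field_simp
    rw [h4]; ring
  have : -((‖x‖ ^ 2 - 2 * inner ℝ x y + ‖y‖ ^ 2) /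
      (2 * (Real.sinh (2 * v) / Real.cosh (2 * v)))) - Real.sinh v / Real.cosh v * inner ℝ x y =
      -(Real.cosh (2 * v) / Real.sinh (2 * v) / 2 * (‖x‖ ^ 2 + ‖y‖ ^ 2)) +
      (Real.cosh (2 * v) / Real.sinh (2 * v) - Real.sinh v / Real.cosh v) * inner ℝ x y := by
    have := (sinh_two_mul_pos hv).ne'
    field_simp
    ring
  rw [this, key, one_div_mul_eq_div]

/-- The linear functional in the exponent: at `(s, q, z)` it is
`-s/(4v) - (coth 2v / 2) q + ⟨y, z⟩ / sinh 2v`. -/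
def phase {d : ℕ} (p : ℝ × EuclideanSpace ℝ (Fin d)) :
    (ℝ × ℝ × EuclideanSpace ℝ (Fin d)) →L[ℝ] ℝ :=
  (-(1 / (4 * p.1))) • ContinuousLinearMap.fst ℝ ℝ (ℝ × EuclideanSpace ℝ (Fin d)) +
  (-(coth (2 * p.1) / 2)) • (ContinuousLinearMap.fst ℝ ℝ (EuclideanSpace ℝ (Fin d))).comp
    (ContinuousLinearMap.snd ℝ ℝ (ℝ × EuclideanSpace ℝ (Fin d))) +
  (1 / Real.sinh (2 * p.1)) • (innerSL ℝ p.2).comp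
    ((ContinuousLinearMap.snd ℝ ℝ (EuclideanSpace ℝ (Fin d))).comp
    (ContinuousLinearMap.snd ℝ ℝ (ℝ × EuclideanSpace ℝ (Fin d))))

theorem phase_apply {d : ℕ} (p : ℝ × EuclideanSpace ℝ (Fin d))
    (w : ℝ × ℝ × EuclideanSpace ℝ (Fin d)) :
    phase p w = -(w.1 / (4 * p.1)) - coth (2 * p.1) / 2 * w.2.1 +
      inner ℝ p.2 w.2.2 / Real.sinh (2 * p.1) := by
  simp only [phase, add_apply, smul_apply,
    ContinuousLinearMap.comp_apply, ContinuousLinearMap.coe_fst', ContinuousLinearMap.coe_snd',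
    innerSL_apply_apply, smul_eq_mul]
  ring

/-- The density of the exponential family. -/
def amplitude {d : ℕ} (m ν : ℝ) (p : ℝ × EuclideanSpace ℝ (Fin d)) : ℝ :=
  heatFactor d m p.1 * p.1 ^ (-(1 + ν)) * Real.exp (-(coth (2 * p.1) / 2 * ‖p.2‖ ^ 2))

theorem amplitude_nonneg {d : ℕ} (m ν : ℝ) {v : ℝ} (hv : 0 < v) (y : EuclideanSpace ℝ (Fin d)) :
    0 ≤ amplitude m ν (v, y) := by
  have := heatFactor_nonneg d m hv.le
  unfold amplitude
  positivity

theorem measurable_coth : Measurable coth := by unfold coth; fun_prop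

theorem measurable_heatFactor (d : ℕ) (m : ℝ) : Measurable (heatFactor d m) := by
  unfold heatFactor; fun_prop

theorem measurable_amplitude {d : ℕ} (m ν : ℝ) :
    Measurable (amplitude m ν : ℝ × EuclideanSpace ℝ (Fin d) → ℝ) := by
  have := measurable_coth
  have := measurable_heatFactor d m
  unfold amplitude; fun_prop

theorem stronglyMeasurable_phase {d : ℕ} :
    StronglyMeasurable (phase : ℝ × EuclideanSpace ℝ (Fin d) → _) := by
  have h1 := measurable_coth
  have h2 : Measurable fun p : ℝ × EuclideanSpace ℝ (Fin d) => -(1 / (4 * p.1)) := by fun_prop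
  have h3 : Measurable fun p : ℝ × EuclideanSpace ℝ (Fin d) => -(coth (2 * p.1) / 2) := by fun_prop
  have h4 : Measurable fun p : ℝ × EuclideanSpace ℝ (Fin d) => 1 / Real.sinh (2 * p.1) := by
    fun_prop
  have h5 : Continuous fun p : ℝ × EuclideanSpace ℝ (Fin d) => (innerSL ℝ p.2).comp
      ((ContinuousLinearMap.snd ℝ ℝ (EuclideanSpace ℝ (Fin d))).comp
      (ContinuousLinearMap.snd ℝ ℝ (ℝ × EuclideanSpace ℝ (Fin d)))) := by fun_prop
  unfold phase
  exact ((h2.stronglyMeasurable.smul stronglyMeasurable_const).add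
    (h3.stronglyMeasurable.smul stronglyMeasurable_const)).add
    (h4.stronglyMeasurable.smul h5.stronglyMeasurable)

/-- Regarding `t²`, `|x|²` and `x` as independent coordinates makes the exponent linear. Only the
power `t^{2ν}` remains outside. -/
theorem subordinator_mul_mehlerKernel {d : ℕ} (m ν t : ℝ) {v : ℝ} (hv : 0 < v)
    (x y : EuclideanSpace ℝ (Fin d)) :
    subordinator ν t v * mehlerKernel m v x y = t ^ (2 * ν) / (4 ^ ν * Real.Gamma ν) *
      (Real.exp (phase (v, y) (t ^ 2, ‖x‖ ^ 2, x)) * amplitude m ν (v, y)) := by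
  rw [mehlerKernel_eq m hv, phase_apply, amplitude, subordinator, Real.rpow_neg hv.le,
    real_inner_comm x y]
  have : Real.exp (-(t ^ 2 / (4 * v)) - coth (2 * v) / 2 * ‖x‖ ^ 2 +
      inner ℝ x y / Real.sinh (2 * v)) * Real.exp (-(coth (2 * v) / 2 * ‖y‖ ^ 2)) =
      Real.exp (-(t ^ 2 / (4 * v))) * Real.exp (-(coth (2 * v) / 2 * (‖x‖ ^ 2 + ‖y‖ ^ 2)) +
      inner ℝ x y / Real.sinh (2 * v)) := by
    rw [← Real.exp_add, ← Real.exp_add]; ring_nf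
  calc _ = t ^ (2 * ν) / (4 ^ ν * Real.Gamma ν) * (heatFactor d m v * (v ^ (1 + ν))⁻¹ *
        (Real.exp (-(t ^ 2 / (4 * v))) * Real.exp (-(coth (2 * v) / 2 * (‖x‖ ^ 2 + ‖y‖ ^ 2)) +
      inner ℝ x y / Real.sinh (2 * v)))) := by ring
    _ = _ := by rw [← this]; ring

/-- The parameters at which the exponential family is integrable. -/
def parDomain (d : ℕ) : Set (ℝ × ℝ × EuclideanSpace ℝ (Fin d)) :=
  {w | 0 < w.1 ∧ ‖w.2.2‖ ^ 2 < w.1 + w.2.1}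

theorem isOpen_parDomain (d : ℕ) : IsOpen (parDomain d) :=
  (isOpen_lt (f := fun _ => (0 : ℝ)) (g := fun w : ℝ × ℝ × EuclideanSpace ℝ (Fin d) => w.1)
    (by fun_prop) (by fun_prop)).inter
    (isOpen_lt (f := fun w : ℝ × ℝ × EuclideanSpace ℝ (Fin d) => ‖w.2.2‖ ^ 2)
      (g := fun w => w.1 + w.2.1) (by fun_prop) (by fun_prop))

/-- As `v → 0` the exponent is about `-(s + q - |z|² + |y-z|²)/(4v)`, which explains the condition
`|z|² < s + q`. On the surface `q = |z|²` the margin is `t²`. -/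
theorem mem_parDomain {d : ℕ} {t : ℝ} (ht : 0 < t) (x : EuclideanSpace ℝ (Fin d)) :
    ((t ^ 2, ‖x‖ ^ 2, x) : ℝ × ℝ × EuclideanSpace ℝ (Fin d)) ∈ parDomain d :=
  ⟨by positivity, by simp only; nlinarith [sq_pos_of_pos ht]⟩

/-! ### Kernel bounds -/

/-- Splitting `2rZ ≤ θr² + Z²/θ` with `θ < 1` leaves two reserves: `s + q - Z²/θ`, which suppresses
`v → 0`, and a multiple of `(1-θ)r²`, which is extra Gaussian decay. The restriction on `v` keeps
`e^{-2v} ≥ (1+θ)/2`. -/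
theorem exponent_le_small {s q Z r θ v p : ℝ} (hs : 0 ≤ s) (hθ0 : 0 < θ)
    (hη : 0 ≤ s + q - Z ^ 2 / θ) (hv : 0 < v) (hvθ : v ≤ (1 - θ) / 4)
    (hp : p ≤ r * Z) :
    -(s / (4 * v)) - coth (2 * v) / 2 * q + p / Real.sinh (2 * v) - coth (2 * v) / 2 * r ^ 2 ≤
      -((s + q - Z ^ 2 / θ) / (8 * v)) + |q| / 2 - r ^ 2 / 2 - (1 - θ) / 8 * r ^ 2 := by
  set S := Real.sinh (2 * v) with hS
  have hS0 : 0 < S := sinh_two_mul_pos hv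
  have hS1 : 2 * v ≤ S := two_mul_le_sinh hv.le
  have hS2 : S ≤ 2 * (2 * v) := sinh_le_two_mul (by linarith) (by linarith)
  have hc : coth (2 * v) = 1 + Real.exp (-(2 * v)) / S := coth_eq hv
  set e := Real.exp (-(2 * v)) with he
  have he1 : e ≤ 1 := Real.exp_le_one_iff.2 (by linarith)
  have he2 : (1 + θ) / 2 ≤ e := by linarith [Real.add_one_le_exp (-(2 * v))]
  have he3 : 1 - e ≤ S := by linarith [Real.add_one_le_exp (-(2 * v))]
  have h1 : s / (2 * S) ≤ s / (4 * v) :=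
    div_le_div_of_nonneg_left hs (by linarith) (by linarith)
  have h2 : (s + q - Z ^ 2 / θ) / (8 * v) ≤ (s + q - Z ^ 2 / θ) / (2 * S) :=
    div_le_div_of_nonneg_left hη (by linarith) (by linarith)
  have hpZ : 2 * p ≤ θ * r ^ 2 + Z ^ 2 / θ := by
    have : 0 ≤ (θ * r - Z) ^ 2 / θ := by positivity
    have h4 : (θ * r - Z) ^ 2 / θ = θ * r ^ 2 - 2 * (r * Z) + Z ^ 2 / θ := by
      field_simp
      ring
    linarith
  have h3 : p / S ≤ (θ * r ^ 2 + Z ^ 2 / θ) / (2 * S) := by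
    rw [div_le_div_iff₀ hS0 (by linarith)]; nlinarith
  -- The sign of `q` is free, so only the singular part `q/(2S)` is kept exactly; the remaining
  -- coefficient of `q/2` lies in `[0, 1]`.
  have h5 : -(coth (2 * v) / 2 * q) ≤ |q| / 2 - q / (2 * S) := by
    have : coth (2 * v) / 2 * q = (S + e - 1) / S / 2 * q + q / (2 * S) := by
      rw [hc]; field_simp; ring
    rw [this]
    have h6 : 0 ≤ (S + e - 1) / S := div_nonneg (by linarith) hS0.le
    have h7 : (S + e - 1) / S ≤ 1 := (div_le_one hS0).2 (by linarith)
    nlinarith [neg_abs_le q, abs_nonneg q]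
  have h8 : -(coth (2 * v) / 2 * r ^ 2) + θ * r ^ 2 / (2 * S) ≤
      - r ^ 2 / 2 - (1 - θ) / 8 * r ^ 2 := by
    have h9 : -(coth (2 * v) / 2 * r ^ 2) + θ * r ^ 2 / (2 * S) =
      - r ^ 2 / 2 - (e - θ) / S / 2 * r ^ 2 := by
      rw [hc]; field_simp; ring
    have h10 : (1 - θ) / 4 ≤ (e - θ) / S := by
      rw [le_div_iff₀ hS0]; nlinarith
    rw [h9]; nlinarith [sq_nonneg r]
  have h11 : (θ * r ^ 2 + Z ^ 2 / θ) / (2 * S) = θ * r ^ 2 / (2 * S) + Z ^ 2 / θ / (2 * S) :=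
    add_div _ _ _
  have h12 : (s + q - Z ^ 2 / θ) / (2 * S) = s / (2 * S) + q / (2 * S) - Z ^ 2 / θ / (2 * S) := by
    rw [sub_div, add_div]
  linarith

/-- Since `coth 2v - 1 = e^{-2v}/sinh 2v ≥ 2e^{-4v}`, the quadratic term provides `r² e^{-4v}`
beyond `r²/2`. Half of it absorbs the cross term, which is of order `r Z e^{-2v}`. -/
theorem exists_exponent_le_large (s q Z : ℝ) {v₀ : ℝ} (hs : 0 ≤ s) (h0 : 0 < v₀) :
    ∃ M, ∀ v ≥ v₀, ∀ r p : ℝ, p ≤ r * Z →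
      -(s / (4 * v)) - coth (2 * v) / 2 * q + p / Real.sinh (2 * v) - coth (2 * v) / 2 * r ^ 2 ≤
      M - r ^ 2 / 2 - r ^ 2 * Real.exp (-(4 * v)) / 2 := by
  set c := (1 - Real.exp (-(4 * v₀))) / 2
  have hc : 0 < c := half_pos (one_sub_exp_pos h0)
  refine ⟨(1 + 1 / (2 * v₀)) / 2 * |q| + (Z / c) ^ 2 / 2, fun v hv r p hp => ?_⟩
  have hv0 : 0 < v := by linarith
  set S := Real.sinh (2 * v) with hS
  have hS0 : 0 < S := sinh_two_mul_pos hv0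
  have hS1 : 2 * v ≤ S := two_mul_le_sinh hv0.le
  have hS2 : S ≤ Real.exp (2 * v) / 2 := sinh_le_half_exp _
  have hS3 : c * Real.exp (2 * v) ≤ S := exp_le_mul_sinh hv
  have hco : coth (2 * v) = 1 + Real.exp (-(2 * v)) / S := coth_eq hv0
  set e := Real.exp (-(2 * v)) with he
  have hee : e * Real.exp (2 * v) = 1 := by rw [he, ← Real.exp_add]; simp
  have he0 : 0 < e := Real.exp_pos _
  have he1 : e ≤ 1 := Real.exp_le_one_iff.2 (by linarith)
  have he4 : Real.exp (-(4 * v)) = e ^ 2 := by rw [he, ← Real.exp_nat_mul]; push_cast; ring_nf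
  have hSi : 1 / S ≤ e / c := by
    rw [div_le_div_iff₀ hS0 hc]; nlinarith
  have hSi2 : 2 * e ≤ 1 / S := by
    rw [le_div_iff₀ hS0]; nlinarith
  have hq : -(coth (2 * v) / 2 * q) ≤ (1 + 1 / (2 * v₀)) / 2 * |q| := by
    have h1 : coth (2 * v) ≤ 1 + 1 / (2 * v₀) := by
      rw [hco]
      have : e / S ≤ 1 / (2 * v₀) := by
        rw [div_le_div_iff₀ hS0 (by linarith)]; nlinarith
      linarith
    have h2 := one_le_coth hv0
    nlinarith [neg_abs_le q, abs_nonneg q]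
  have hp1 : p / S ≤ r ^ 2 * e ^ 2 / 2 + (Z / c) ^ 2 / 2 := by
    have h1 : p / S ≤ |r * Z| * (1 / S) := by
      rw [mul_one_div]; gcongr; exact hp.trans (le_abs_self _)
    have h2 : |r * Z| * (1 / S) ≤ |r * Z| * (e / c) := by gcongr
    have h3 : |r * Z| * (e / c) = |r * e| * |Z / c| := by
      rw [abs_mul, abs_mul, abs_div, abs_of_pos he0, abs_of_pos hc]; ring
    nlinarith [sq_nonneg (|r * e| - |Z / c|), sq_abs (r * e), sq_abs (Z / c)]
  have hr1 : -(coth (2 * v) / 2 * r ^ 2) ≤ - r ^ 2 / 2 - r ^ 2 * e ^ 2 := by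
    have h1 : 2 * e ^ 2 ≤ e / S := by
      rw [le_div_iff₀ hS0]
      rw [le_div_iff₀ hS0] at hSi2
      nlinarith
    rw [hco]; nlinarith [sq_nonneg r]
  have hs1 : 0 ≤ s / (4 * v) := by positivity
  rw [he4]
  linarith

/-- Upper bound of the Poisson-type kernel by the weight. -/
theorem exists_lintegral_kernel_le {d : ℕ} {m ν : ℝ} (hm : -(d : ℝ) ≤ m) (hν : 0 < ν)
    {w : ℝ × ℝ × EuclideanSpace ℝ (Fin d)} (hw : w ∈ parDomain d) :
    ∃ C > 0, ∀ y : EuclideanSpace ℝ (Fin d), ∫⁻ v in Set.Ioi (0 : ℝ),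
      ENNReal.ofReal (Real.exp (phase (v, y) w) * amplitude m ν (v, y)) ≤
      ENNReal.ofReal (C * weight m ν y) := by
  obtain ⟨s, q, z⟩ := w
  obtain ⟨hs, hN⟩ := hw
  simp only at hs hN
  set Z := ‖z‖ with hZ
  set N := s + q with hNdef
  have hN0 : 0 < N := lt_of_le_of_lt (sq_nonneg Z) hN
  -- The midpoint between `Z²/N` and `1`: above the former so that `η > 0`, below the latter so that
  -- some Gaussian decay is left.
  set θ := (1 + Z ^ 2 / N) / 2 with hθ
  have hZN : Z ^ 2 / N < 1 := (div_lt_one hN0).2 hN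
  have hZN0 : 0 ≤ Z ^ 2 / N := by positivity
  have hθ0 : 0 < θ := by linarith
  have hθ1 : θ < 1 := by linarith
  have hη : 0 < N - Z ^ 2 / θ := by
    have h1 : Z ^ 2 / N < θ := by linarith
    rw [div_lt_iff₀ hN0] at h1
    have h2 : Z ^ 2 / θ < N := by rw [div_lt_iff₀ hθ0]; linarith
    linarith
  set η := N - Z ^ 2 / θ with hηdef
  set v₀ := (1 - θ) / 4 with hv₀
  have hv₀0 : 0 < v₀ := by linarith
  obtain ⟨c, hc, hcw⟩ := exists_exp_le_weight d m hν (ε := (1 - θ) / 8) (by linarith)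
  obtain ⟨M, hM⟩ := exists_exponent_le_large s q Z hs.le hv₀0
  obtain ⟨C₁, hC₁, hF⟩ := heatFactor_le_exp d m hv₀0
  obtain ⟨C₂, hC₂, hL⟩ := exists_lintegral_large_le (κ := d + m) (by linarith) hν hv₀0
  -- The total power of `1/v` at small times, `d/2` from the heat factor and `1 + ν` from the
  -- subordinator; `e^{-η/(8v)}` absorbs it.
  set P : ℝ := d / 2 + (1 + ν) with hP
  have hP0 : 0 < P := by positivity
  set A := Real.exp (|m| * v₀) * (P / (η / 8)) ^ P * Real.exp (|q| / 2) / c with hA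
  have hA0 : 0 < A := by positivity
  have hinner : ∀ y : EuclideanSpace ℝ (Fin d), inner ℝ y z ≤ ‖y‖ * Z := fun y =>
    real_inner_le_norm y z
  have hexp : ∀ v : ℝ, ∀ y : EuclideanSpace ℝ (Fin d),
      Real.exp (phase (v, y) (s, q, z)) * amplitude m ν (v, y) =
      heatFactor d m v * v ^ (-(1 + ν)) * Real.exp (-(s / (4 * v)) - coth (2 * v) / 2 * q +
        inner ℝ y z / Real.sinh (2 * v) - coth (2 * v) / 2 * ‖y‖ ^ 2) := fun v y => by
    rw [phase_apply, amplitude, sub_eq_add_neg (_ + _ : ℝ), Real.exp_add _ (-(_ * ‖y‖ ^ 2))]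
    ring
  have hsmall : ∀ y : EuclideanSpace ℝ (Fin d), ∀ v ∈ Set.Ioc 0 v₀,
      Real.exp (phase (v, y) (s, q, z)) * amplitude m ν (v, y) ≤ A * weight m ν y := by
    intro y v hv
    have hv0 : 0 < v := hv.1
    have e1 := exponent_le_small (r := ‖y‖) hs.le hθ0 hη.le hv.1
      hv.2 (hinner y)
    rw [hexp]
    have e2 := heatFactor_le_rpow d m hv0
    have e3 := rpow_mul_exp_neg_le (u := v⁻¹) (by positivity) hP0 (h := η / 8) (by positivity)
    have e4 : v ^ (-(d : ℝ) / 2) * v ^ (-(1 + ν)) = v⁻¹ ^ P := by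
      rw [← Real.rpow_add hv0, Real.inv_rpow hv0.le, ← Real.rpow_neg hv0.le, hP]
      congr 1; ring
    have e5 : Real.exp (|m| * v) ≤ Real.exp (|m| * v₀) := by
      have := hv.2
      gcongr
    calc _ ≤ (Real.exp (|m| * v₀) * v ^ (-(d : ℝ) / 2)) * v ^ (-(1 + ν)) *
          Real.exp (-(η / (8 * v)) + |q| / 2 - ‖y‖ ^ 2 / 2 - (1 - θ) / 8 * ‖y‖ ^ 2) := by
          gcongr
          exact e2.trans (by gcongr)
      _ = Real.exp (|m| * v₀) * (v⁻¹ ^ P * Real.exp (-(η / 8 * v⁻¹))) * Real.exp (|q| / 2) *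
          Real.exp (-(‖y‖ ^ 2 / 2) - (1 - θ) / 8 * ‖y‖ ^ 2) := by
          rw [← e4, show -(η / (8 * v)) + |q| / 2 - ‖y‖ ^ 2 / 2 - (1 - θ) / 8 * ‖y‖ ^ 2 =
            -(η / 8 * v⁻¹) + |q| / 2 + (-(‖y‖ ^ 2 / 2) - (1 - θ) / 8 * ‖y‖ ^ 2) by
              field_simp; ring, Real.exp_add, Real.exp_add]
          ring
      _ ≤ Real.exp (|m| * v₀) * (P / (η / 8)) ^ P * Real.exp (|q| / 2) *
          (weight m ν y / c) := by
          gcongr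
          rw [le_div_iff₀ hc, mul_comm]
          exact hcw y
      _ = A * weight m ν y := by rw [hA]; ring
  have hlarge : ∀ y : EuclideanSpace ℝ (Fin d), ∀ v ∈ Set.Ici v₀,
      Real.exp (phase (v, y) (s, q, z)) * amplitude m ν (v, y) ≤
      C₁ * Real.exp M * Real.exp (-‖y‖ ^ 2 / 2) *
        (Real.exp (-(‖y‖ ^ 2 * Real.exp (-(4 * v)) / 2)) * Real.exp (-((d + m) * v)) *
          v ^ (-(1 + ν))) := by
    intro y v hv
    rw [Set.mem_Ici] at hv
    have hv0 : 0 < v := by linarith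
    have e1 := hM v hv ‖y‖ _ (hinner y)
    rw [hexp]
    calc _ ≤ C₁ * Real.exp (-((d + m) * v)) * v ^ (-(1 + ν)) *
          Real.exp (M - ‖y‖ ^ 2 / 2 - ‖y‖ ^ 2 * Real.exp (-(4 * v)) / 2) := by
          gcongr
          exact hF v hv
      _ = _ := by
        rw [show M - ‖y‖ ^ 2 / 2 - ‖y‖ ^ 2 * Real.exp (-(4 * v)) / 2 =
          M + -‖y‖ ^ 2 / 2 + -(‖y‖ ^ 2 * Real.exp (-(4 * v)) / 2) by ring, Real.exp_add,
          Real.exp_add]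
        ring
  refine ⟨A * v₀ + C₁ * Real.exp M * C₂, by positivity, fun y => ?_⟩
  have hw0 := weight_pos m ν y
  calc _ ≤ ∫⁻ v in Set.Ioc 0 v₀ ∪ Set.Ici v₀,
        ENNReal.ofReal (Real.exp (phase (v, y) (s, q, z)) * amplitude m ν (v, y)) := by
        refine lintegral_mono_set fun v hv => ?_
        rcases le_total v v₀ with h | h
        · exact Or.inl ⟨hv, h⟩
        · exact Or.inr h
    _ ≤ _ := lintegral_union_le _ _ _
    _ ≤ (∫⁻ v in Set.Ioc 0 v₀, ENNReal.ofReal (A * weight m ν y)) +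
        ∫⁻ v in Set.Ici v₀, ENNReal.ofReal (C₁ * Real.exp M * Real.exp (-‖y‖ ^ 2 / 2) *
        (Real.exp (-(‖y‖ ^ 2 * Real.exp (-(4 * v)) / 2)) * Real.exp (-((d + m) * v)) *
          v ^ (-(1 + ν)))) := by
        refine add_le_add ?_ ?_
        · exact setLIntegral_mono (by fun_prop) fun v hv => ENNReal.ofReal_le_ofReal (hsmall y v hv)
        · exact setLIntegral_mono (by fun_prop) fun v hv => ENNReal.ofReal_le_ofReal (hlarge y v hv)
    _ ≤ ENNReal.ofReal (A * weight m ν y * v₀) + ENNReal.ofReal (C₁ * Real.exp M *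
        Real.exp (-‖y‖ ^ 2 / 2)) * ENNReal.ofReal (C₂ * profile (d + m) ν ‖y‖) := by
        refine add_le_add ?_ ?_
        · rw [setLIntegral_const, Real.volume_Ioc, sub_zero, ← ENNReal.ofReal_mul (by positivity)]
        · simp_rw [ENNReal.ofReal_mul (show 0 ≤ C₁ * Real.exp M * Real.exp (-‖y‖ ^ 2 / 2) by
            positivity)]
          rw [lintegral_const_mul' _ _ ENNReal.ofReal_ne_top]
          gcongr
          exact hL _ (norm_nonneg y)
    _ = _ := by
        have := profile_pos (κ := d + m) (ν := ν) (norm_nonneg y)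
        rw [← ENNReal.ofReal_mul (by positivity), ← ENNReal.ofReal_add (by positivity)
          (by positivity)]
        congr 1
        rw [weight_eq]; ring

/-- Lower bound of the Poisson-type kernel by the weight. -/
theorem exists_le_lintegral_kernel {d : ℕ} {m ν : ℝ} (hm : -(d : ℝ) ≤ m) (hν : 0 < ν)
    (w : ℝ × ℝ × EuclideanSpace ℝ (Fin d)) :
    ∃ c > 0, ∀ y : EuclideanSpace ℝ (Fin d), ENNReal.ofReal (c * weight m ν y) ≤
      ∫⁻ v in Set.Ioi (0 : ℝ),
        ENNReal.ofReal (Real.exp (phase (v, y) w) * amplitude m ν (v, y)) := by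
  obtain ⟨s, q, z⟩ := w
  obtain ⟨c, hc, hL⟩ := exists_le_lintegral_large (κ := d + m) (by linarith) hν
  set b := (1 - Real.exp (-(4 * (1 / 2 : ℝ)))) / 2
  have hb : 0 < b := half_pos (one_sub_exp_pos (by norm_num))
  set M := |s| / 2 + |q| + ‖z‖ / b + 1 / (2 * b) with hM
  set D := Real.exp (-M) * Real.pi ^ (-(d : ℝ) / 2) with hD
  have hD0 : 0 < D := by have := Real.pi_pos; positivity
  refine ⟨D * c, by positivity, fun y => ?_⟩
  set r := ‖y‖ with hr
  have hr0 : 0 ≤ r := norm_nonneg y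
  set V := Real.log (Real.exp 1 + r) / 2 with hV
  have hlog := one_le_log_exp_add hr0
  -- Beyond `V` one has `e^{2v} ≥ e + r`, so `r e^{-2v}` and `r / sinh 2v` are bounded. Every term
  -- of the exponent except `-r²/2` is then bounded by `M`. As `V ≥ 1/2`, the hyperbolic bounds are
  -- available with `v₀ = 1/2`.
  have hpt : ∀ v ∈ Set.Ioi V, D * Real.exp (-r ^ 2 / 2) *
      (Real.exp (-((d + m) * v)) * v ^ (-(1 + ν))) ≤
      Real.exp (phase (v, y) (s, q, z)) * amplitude m ν (v, y) := by
    intro v hv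
    rw [Set.mem_Ioi] at hv
    have hv12 : 1 / 2 ≤ v := by linarith
    have hv0 : 0 < v := by linarith
    set S := Real.sinh (2 * v) with hS
    have hS0 : 0 < S := sinh_two_mul_pos hv0
    have hS1 : 2 * v ≤ S := two_mul_le_sinh hv0.le
    have hS3 : b * Real.exp (2 * v) ≤ S := exp_le_mul_sinh hv12
    have hco : coth (2 * v) = 1 + Real.exp (-(2 * v)) / S := coth_eq hv0
    set e := Real.exp (-(2 * v)) with he
    have he0 : 0 < e := Real.exp_pos _
    have he1 : e ≤ 1 := Real.exp_le_one_iff.2 (by linarith)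
    have hee : e * Real.exp (2 * v) = 1 := by rw [he, ← Real.exp_add]; simp
    have hrv : r ≤ Real.exp (2 * v) := by
      have : Real.exp 1 + r = Real.exp (2 * V) := by
        rw [hV, show 2 * (Real.log (Real.exp 1 + r) / 2) = Real.log (Real.exp 1 + r) by ring,
          Real.exp_log (by positivity)]
      have h2 : Real.exp (2 * V) ≤ Real.exp (2 * v) := Real.exp_le_exp.2 (by linarith)
      linarith [Real.exp_pos 1]
    have hrS : r / S ≤ 1 / b := by
      rw [div_le_div_iff₀ hS0 hb]; nlinarith
    have hre : r * e ≤ 1 := by nlinarith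
    have h1 : -(|s| / 2) ≤ -(s / (4 * v)) := by
      have : s / (4 * v) ≤ |s| / 2 := by
        rw [div_le_div_iff₀ (by linarith) two_pos]; nlinarith [le_abs_self s, abs_nonneg s]
      linarith
    have h2 : -|q| ≤ -(coth (2 * v) / 2 * q) := by
      have h3 : coth (2 * v) ≤ 2 := by
        rw [hco]
        have : e / S ≤ 1 := (div_le_one hS0).2 (by linarith)
        linarith
      have h4 := one_le_coth hv0
      nlinarith [le_abs_self q, abs_nonneg q]
    have h5 : -(‖z‖ / b) ≤ inner ℝ y z / S := by
      have h6 : -(r * ‖z‖) ≤ inner ℝ y z := by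
        have := neg_abs_le (inner ℝ y z : ℝ)
        have h7 := abs_real_inner_le_norm y z
        linarith
      calc -(‖z‖ / b) = -(1 / b * ‖z‖) := by ring
        _ ≤ -(r / S * ‖z‖) := by gcongr
        _ = -(r * ‖z‖) / S := by ring
        _ ≤ _ := by gcongr
    have h8 : -(r ^ 2 / 2) - 1 / (2 * b) ≤ -(coth (2 * v) / 2 * r ^ 2) := by
      have h9 : coth (2 * v) / 2 * r ^ 2 = r ^ 2 / 2 + (r * e) * (r / S) / 2 := by
        rw [hco]; field_simp
      have h10 : (r * e) * (r / S) ≤ 1 * (1 / b) := by gcongr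
      have h11 : 1 / (2 * b) = 1 * (1 / b) / 2 := by field_simp
      rw [h9, h11]; linarith
    have h12 := le_heatFactor d m hv0
    rw [phase_apply, amplitude]
    simp only
    calc _ = Real.exp (-M - r ^ 2 / 2) * (Real.pi ^ (-(d : ℝ) / 2) * Real.exp (-((d + m) * v)) *
          v ^ (-(1 + ν))) := by
          rw [hD, show -M - r ^ 2 / 2 = -M + -r ^ 2 / 2 by ring, Real.exp_add]; ring
      _ ≤ Real.exp (-(s / (4 * v)) - coth (2 * v) / 2 * q + inner ℝ y z / Real.sinh (2 * v) +
          -(coth (2 * v) / 2 * r ^ 2)) * (heatFactor d m v * v ^ (-(1 + ν))) := by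
          have := Real.pi_pos
          gcongr
          linarith
      _ = _ := by rw [Real.exp_add]; ring
  have hw0 := weight_pos m ν y
  calc _ = ENNReal.ofReal (D * Real.exp (-r ^ 2 / 2)) *
        ENNReal.ofReal (c * profile (d + m) ν r) := by
        rw [weight_eq, ← ENNReal.ofReal_mul (by positivity)]
        congr 1; ring
    _ ≤ ENNReal.ofReal (D * Real.exp (-r ^ 2 / 2)) * ∫⁻ v in Set.Ioi V,
        ENNReal.ofReal (Real.exp (-((d + m) * v)) * v ^ (-(1 + ν))) := by
        gcongr; exact hL r hr0
    _ = ∫⁻ v in Set.Ioi V, ENNReal.ofReal (D * Real.exp (-r ^ 2 / 2) *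
        (Real.exp (-((d + m) * v)) * v ^ (-(1 + ν)))) := by
        rw [← lintegral_const_mul' _ _ ENNReal.ofReal_ne_top]
        simp_rw [← ENNReal.ofReal_mul (show 0 ≤ D * Real.exp (-r ^ 2 / 2) by positivity)]
    _ ≤ ∫⁻ v in Set.Ioi V, ENNReal.ofReal
        (Real.exp (phase (v, y) (s, q, z)) * amplitude m ν (v, y)) :=
        setLIntegral_mono' measurableSet_Ioi fun v hv => ENNReal.ofReal_le_ofReal (hpt v hv)
    _ ≤ _ := lintegral_mono_set (Set.Ioi_subset_Ioi (by linarith))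

theorem mehlerKernel_nonneg {d : ℕ} (m : ℝ) {v : ℝ} (hv : 0 < v)
    (x y : EuclideanSpace ℝ (Fin d)) : 0 ≤ mehlerKernel m v x y := by
  rw [mehlerKernel_eq m hv]
  exact mul_nonneg (heatFactor_nonneg d m hv.le) (Real.exp_pos _).le

/-- For fixed time and point, the heat kernel is bounded by the weight. -/
theorem exists_mehlerKernel_le_weight {d : ℕ} (m : ℝ) {ν v : ℝ} (hν : 0 < ν) (hv : 0 < v)
    (x : EuclideanSpace ℝ (Fin d)) :
    ∃ C, ∀ y, mehlerKernel m v x y ≤ C * weight m ν y := by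
  set S := Real.sinh (2 * v) with hS
  have hS0 : 0 < S := sinh_two_mul_pos hv
  -- The Gaussian gain at the fixed time is `δ/2 · |y|²`; half of it pays for the cross term and
  -- `δ/4 · |y|²` is left for the weight.
  set δ := Real.exp (-(2 * v)) / S with hδ
  have hδ0 : 0 < δ := div_pos (Real.exp_pos _) hS0
  have hco : coth (2 * v) = 1 + δ := coth_eq hv
  obtain ⟨c, hc, hcw⟩ := exists_exp_le_weight d m hν (ε := δ / 4) (by linarith)
  refine ⟨heatFactor d m v * Real.exp ((‖x‖ / S) ^ 2 / δ) / c, fun y => ?_⟩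
  have hF := heatFactor_nonneg d m hv.le
  rw [mehlerKernel_eq m hv]
  have h1 : -(coth (2 * v) / 2 * (‖x‖ ^ 2 + ‖y‖ ^ 2)) + inner ℝ x y / Real.sinh (2 * v) ≤
      (‖x‖ / S) ^ 2 / δ + (-(‖y‖ ^ 2 / 2) - δ / 4 * ‖y‖ ^ 2) := by
    have h2 : inner ℝ x y / S ≤ ‖x‖ / S * ‖y‖ := by
      rw [div_mul_eq_mul_div]; gcongr; exact real_inner_le_norm x y
    have h3 : 0 ≤ (‖x‖ / S - δ / 2 * ‖y‖) ^ 2 / δ := by positivity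
    have h4 : (‖x‖ / S - δ / 2 * ‖y‖) ^ 2 / δ =
        (‖x‖ / S) ^ 2 / δ - ‖x‖ / S * ‖y‖ + δ / 4 * ‖y‖ ^ 2 := by
      generalize ‖x‖ / S = a
      field_simp
      ring
    rw [hco, ← hS]
    nlinarith [sq_nonneg ‖x‖]
  calc _ ≤ heatFactor d m v * (Real.exp ((‖x‖ / S) ^ 2 / δ) *
        Real.exp (-(‖y‖ ^ 2 / 2) - δ / 4 * ‖y‖ ^ 2)) := by
        rw [← Real.exp_add]; gcongr
    _ ≤ heatFactor d m v * (Real.exp ((‖x‖ / S) ^ 2 / δ) * (weight m ν y / c)) := by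
        gcongr
        rw [le_div_iff₀ hc, mul_comm]
        exact hcw y
    _ = _ := by ring

/-! ### Integrability -/

theorem MemL1Weight.aestronglyMeasurable {d : ℕ} {m ν : ℝ} {F : Type*} [NormedAddCommGroup F]
    [NormedSpace ℝ F] {f : EuclideanSpace ℝ (Fin d) → F} (hf : MemL1Weight m ν f) :
    AEStronglyMeasurable f := by
  have h1 : Continuous fun y : EuclideanSpace ℝ (Fin d) => (weight m ν y)⁻¹ :=
    (continuous_weight m ν).inv₀ fun y => (weight_pos m ν y).ne'
  have h2 := h1.aestronglyMeasurable.smul (Integrable.aestronglyMeasurable hf)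
  refine h2.congr (Filter.Eventually.of_forall fun y => ?_)
  simp [smul_smul, (weight_pos m ν y).ne']

theorem MemL1Weight.integrable_mehlerKernel_mul {d : ℕ} {m ν : ℝ} (hν : 0 < ν)
    {f : EuclideanSpace ℝ (Fin d) → ℂ} (hf : MemL1Weight m ν f) {v : ℝ} (hv : 0 < v)
    (x : EuclideanSpace ℝ (Fin d)) :
    Integrable fun y => (mehlerKernel m v x y : ℂ) * f y := by
  obtain ⟨C, hC⟩ := exists_mehlerKernel_le_weight m hν hv x
  refine Integrable.mono' (Integrable.const_mul hf.norm C) ?_ (Filter.Eventually.of_forall fun y => ?_)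
  · have : Continuous fun y => (mehlerKernel m v x y : ℂ) := by unfold mehlerKernel; fun_prop
    exact this.aestronglyMeasurable.mul hf.aestronglyMeasurable
  · rw [norm_mul, Complex.norm_real, Real.norm_of_nonneg (mehlerKernel_nonneg m hv x y), norm_smul,
      Real.norm_of_nonneg (weight_pos m ν y).le, ← mul_assoc]
    gcongr
    exact hC y

/-- The space-time measure on `(0, ∞) × ℝ^d`. -/
abbrev timeSpace (d : ℕ) : Measure (ℝ × EuclideanSpace ℝ (Fin d)) :=
  (volume.restrict (Set.Ioi (0 : ℝ))).prod volume

theorem MemL1Weight.aestronglyMeasurable_amplitude_mul {d : ℕ} {m ν : ℝ}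
    {f : EuclideanSpace ℝ (Fin d) → ℂ} (hf : MemL1Weight m ν f) :
    AEStronglyMeasurable (fun p => (amplitude m ν p : ℂ) * f p.2) (timeSpace d) :=
  (Complex.measurable_ofReal.comp (measurable_amplitude m ν)).aestronglyMeasurable.mul
    hf.aestronglyMeasurable.comp_snd

/-- By Tonelli the `v`-integral is taken first, and the kernel bound turns the norm into a multiple
of `∫ φ|f|`. -/
theorem MemL1Weight.expIntegrableOn {d : ℕ} {m ν : ℝ} (hm : -(d : ℝ) ≤ m) (hν : 0 < ν)
    {f : EuclideanSpace ℝ (Fin d) → ℂ} (hf : MemL1Weight m ν f) :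
    ExpIntegrableOn (timeSpace d) phase (fun p => (amplitude m ν p : ℂ) * f p.2)
      (parDomain d) := by
  intro w hw
  obtain ⟨C, hC0, hC⟩ := exists_lintegral_kernel_le hm hν hw
  have hmeas : AEStronglyMeasurable
      (fun p => Real.exp (phase p w) • ((amplitude m ν p : ℂ) * f p.2)) (timeSpace d) :=
    (Real.continuous_exp.comp_aestronglyMeasurable
      (stronglyMeasurable_phase.aestronglyMeasurable.apply_continuousLinearMap w)).smul
      hf.aestronglyMeasurable_amplitude_mul
  refine ⟨hmeas, ?_⟩
  rw [HasFiniteIntegral, lintegral_prod_symm _ hmeas.enorm]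
  have h1 : ∀ y : EuclideanSpace ℝ (Fin d), ∫⁻ v in Set.Ioi (0 : ℝ),
      ‖Real.exp (phase (v, y) w) • ((amplitude m ν (v, y) : ℂ) * f y)‖ₑ ≤
      ENNReal.ofReal C * ‖weight m ν y • f y‖ₑ := by
    intro y
    calc _ = ∫⁻ v in Set.Ioi (0 : ℝ),
          ENNReal.ofReal (Real.exp (phase (v, y) w) * amplitude m ν (v, y)) * ‖f y‖ₑ := by
          refine setLIntegral_congr_fun measurableSet_Ioi fun v hv => ?_
          have h2 := amplitude_nonneg m ν (Set.mem_Ioi.1 hv) y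
          rw [enorm_smul, enorm_mul, ← mul_assoc, ENNReal.ofReal_mul (Real.exp_pos _).le,
            Real.enorm_of_nonneg (Real.exp_pos _).le, ← ofReal_norm (amplitude m ν (v, y) : ℂ),
            Complex.norm_real, Real.norm_of_nonneg h2]
      _ = (∫⁻ v in Set.Ioi (0 : ℝ),
          ENNReal.ofReal (Real.exp (phase (v, y) w) * amplitude m ν (v, y))) * ‖f y‖ₑ :=
          lintegral_mul_const' _ _ enorm_ne_top
      _ ≤ ENNReal.ofReal (C * weight m ν y) * ‖f y‖ₑ := by gcongr; exact hC y
      _ = _ := by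
          rw [enorm_smul, ENNReal.ofReal_mul hC0.le, Real.enorm_of_nonneg (weight_pos m ν y).le,
            mul_assoc]
  calc _ ≤ ∫⁻ y, ENNReal.ofReal C * ‖weight m ν y • f y‖ₑ := lintegral_mono h1
    _ = ENNReal.ofReal C * ∫⁻ y, ‖weight m ν y • f y‖ₑ :=
        lintegral_const_mul' _ _ ENNReal.ofReal_ne_top
    _ < ⊤ := ENNReal.mul_lt_top ENNReal.ofReal_lt_top hf.2

theorem MemL1Weight.integrable_subordinator_mul {d : ℕ} {m ν : ℝ} (hm : -(d : ℝ) ≤ m)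
    (hν : 0 < ν) {f : EuclideanSpace ℝ (Fin d) → ℂ} (hf : MemL1Weight m ν f) {t : ℝ}
    (ht : 0 < t) (x : EuclideanSpace ℝ (Fin d)) :
    Integrable (fun p : ℝ × EuclideanSpace ℝ (Fin d) => (subordinator ν t p.1 : ℂ) *
      ((mehlerKernel m p.1 x p.2 : ℂ) * f p.2)) (timeSpace d) ∧
    ∫ p, (subordinator ν t p.1 : ℂ) * ((mehlerKernel m p.1 x p.2 : ℂ) * f p.2) ∂(timeSpace d) =
      ((t ^ (2 * ν) / (4 ^ ν * Real.Gamma ν) : ℝ) : ℂ) *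
        ∫ p, Real.exp (phase p (t ^ 2, ‖x‖ ^ 2, x)) • ((amplitude m ν p : ℂ) * f p.2)
          ∂(timeSpace d) := by
  have h1 := (hf.expIntegrableOn hm hν _ (mem_parDomain ht x)).const_mul
    ((t ^ (2 * ν) / (4 ^ ν * Real.Gamma ν) : ℝ) : ℂ)
  have hpos : ∀ᵐ p ∂(timeSpace d), 0 < p.1 :=
    Measure.quasiMeasurePreserving_fst.ae (ae_restrict_mem measurableSet_Ioi)
  have h2 : ∀ᵐ p ∂(timeSpace d), ((t ^ (2 * ν) / (4 ^ ν * Real.Gamma ν) : ℝ) : ℂ) *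
      (Real.exp (phase p (t ^ 2, ‖x‖ ^ 2, x)) • ((amplitude m ν p : ℂ) * f p.2)) =
      (subordinator ν t p.1 : ℂ) * ((mehlerKernel m p.1 x p.2 : ℂ) * f p.2) := by
    filter_upwards [hpos] with p hp
    rw [← mul_assoc (subordinator ν t p.1 : ℂ), ← Complex.ofReal_mul,
      subordinator_mul_mehlerKernel m ν t hp, Complex.real_smul]
    push_cast
    ring
  refine ⟨h1.congr h2, ?_⟩
  rw [← integral_const_mul]
  exact (integral_congr_ae h2).symm

theorem MemL1Weight.integrableOn_subordinator_mul_heatIntegral {d : ℕ} {m ν : ℝ}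
    (hm : -(d : ℝ) ≤ m) (hν : 0 < ν) {f : EuclideanSpace ℝ (Fin d) → ℂ} (hf : MemL1Weight m ν f)
    {t : ℝ} (ht : 0 < t) (x : EuclideanSpace ℝ (Fin d)) :
    IntegrableOn (fun v : ℝ => (subordinator ν t v : ℂ) * heatIntegral m v f x) (Set.Ioi 0) := by
  have h := (hf.integrable_subordinator_mul hm hν ht x).1.integral_prod_left
  refine h.congr (Filter.Eventually.of_forall fun v => ?_)
  simp only [heatIntegral]
  rw [integral_const_mul]

theorem MemL1Weight.poissonIntegral_eq {d : ℕ} {m ν : ℝ} (hm : -(d : ℝ) ≤ m)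
    (hν : 0 < ν) {f : EuclideanSpace ℝ (Fin d) → ℂ} (hf : MemL1Weight m ν f) {t : ℝ}
    (ht : 0 < t) (x : EuclideanSpace ℝ (Fin d)) :
    poissonIntegral m ν t f x = ((t ^ (2 * ν) / (4 ^ ν * Real.Gamma ν) : ℝ) : ℂ) *
        ∫ p, Real.exp (phase p (t ^ 2, ‖x‖ ^ 2, x)) • ((amplitude m ν p : ℂ) * f p.2)
          ∂(timeSpace d) := by
  obtain ⟨h1, h2⟩ := hf.integrable_subordinator_mul hm hν ht x
  rw [← h2, integral_prod _ h1, poissonIntegral]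
  refine integral_congr_ae (Filter.Eventually.of_forall fun v => ?_)
  simp only [heatIntegral]
  rw [integral_const_mul]

/-- A smooth exponential integral is composed with the smooth map `(t,x) ↦ (t², |x|², x)`; the
factor `t^{2ν}` is smooth because `t ≠ 0`. -/
theorem MemL1Weight.contDiffOn_poissonIntegral {d : ℕ} {m ν : ℝ} (hm : -(d : ℝ) ≤ m)
    (hν : 0 < ν) {f : EuclideanSpace ℝ (Fin d) → ℂ} (hf : MemL1Weight m ν f) :
    ContDiffOn ℝ ∞ (fun p : ℝ × EuclideanSpace ℝ (Fin d) => poissonIntegral m ν p.1 f p.2)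
      (Set.Ioi 0 ×ˢ Set.univ) := by
  have h1 := (hf.expIntegrableOn hm hν).contDiffOn (isOpen_parDomain d)
    stronglyMeasurable_phase.aestronglyMeasurable hf.aestronglyMeasurable_amplitude_mul
  have h2 : ContDiff ℝ ∞ (fun p : ℝ × EuclideanSpace ℝ (Fin d) =>
      ((p.1 ^ 2, ‖p.2‖ ^ 2, p.2) : ℝ × ℝ × EuclideanSpace ℝ (Fin d))) :=
    (contDiff_fst.pow 2).prodMk ((contDiff_snd.norm_sq ℝ).prodMk contDiff_snd)
  have h3 : ContDiffOn ℝ ∞ (fun p : ℝ × EuclideanSpace ℝ (Fin d) =>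
      ((p.1 ^ (2 * ν) / (4 ^ ν * Real.Gamma ν) : ℝ) : ℂ)) (Set.Ioi 0 ×ˢ Set.univ) := by
    refine Complex.ofRealCLM.contDiff.comp_contDiffOn (ContDiffOn.div_const ?_ _)
    intro p hp
    exact (contDiffAt_fst.rpow_const_of_ne (ne_of_gt hp.1)).contDiffWithinAt
  refine (h3.mul (h1.comp h2.contDiffOn fun p hp => mem_parDomain hp.1 p.2)).congr fun p hp => ?_
  exact hf.poissonIntegral_eq hm hν hp.1 p.2

/-- The converse statement: finiteness of the Poisson integral at one point. -/
theorem memL1Weight_of_poissonLIntegral_lt_top {d : ℕ} {m ν : ℝ} (hm : -(d : ℝ) ≤ m) (hν : 0 < ν)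
    {f : EuclideanSpace ℝ (Fin d) → ℝ} (hf : AEMeasurable f) (hf0 : ∀ y, 0 ≤ f y) {t : ℝ}
    (ht : 0 < t) {x : EuclideanSpace ℝ (Fin d)}
    (h : poissonLIntegral m ν t (fun y => ENNReal.ofReal (f y)) x < ⊤) : MemL1Weight m ν f := by
  obtain ⟨c, hc, hk⟩ := exists_le_lintegral_kernel (d := d) hm hν (t ^ 2, ‖x‖ ^ 2, x)
  set B := t ^ (2 * ν) / (4 ^ ν * Real.Gamma ν) with hB
  have hB0 : 0 < B := by have := Real.Gamma_pos_of_pos hν; positivity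
  refine ⟨(continuous_weight m ν).aestronglyMeasurable.smul hf.aestronglyMeasurable, ?_⟩
  have hmeas : Measurable fun p : ℝ × EuclideanSpace ℝ (Fin d) =>
      Real.exp (phase p (t ^ 2, ‖x‖ ^ 2, x)) * amplitude m ν p :=
    (Real.continuous_exp.comp_stronglyMeasurable
      ((ContinuousLinearMap.apply ℝ ℝ _).continuous.comp_stronglyMeasurable
      stronglyMeasurable_phase)).measurable.mul
      (measurable_amplitude m ν)
  -- Tonelli moves the `v`-integral inside, where the lower kernel bound applies.
  have h1 : poissonLIntegral m ν t (fun y => ENNReal.ofReal (f y)) x = ENNReal.ofReal B *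
      ∫⁻ y, (∫⁻ v in Set.Ioi (0 : ℝ), ENNReal.ofReal
        (Real.exp (phase (v, y) (t ^ 2, ‖x‖ ^ 2, x)) * amplitude m ν (v, y))) *
        ENNReal.ofReal (f y) := by
    calc _ = ∫⁻ v in Set.Ioi (0 : ℝ), ENNReal.ofReal B * ∫⁻ y, ENNReal.ofReal
          (Real.exp (phase (v, y) (t ^ 2, ‖x‖ ^ 2, x)) * amplitude m ν (v, y)) *
          ENNReal.ofReal (f y) := by
          refine setLIntegral_congr_fun measurableSet_Ioi fun v hv => ?_
          simp only
          rw [← lintegral_const_mul' _ _ ENNReal.ofReal_ne_top,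
            ← lintegral_const_mul' _ _ ENNReal.ofReal_ne_top]
          refine lintegral_congr fun y => ?_
          have hv0 : 0 < v := hv
          have hsub : 0 ≤ subordinator ν t v := by
            have := Real.Gamma_pos_of_pos hν
            unfold subordinator; positivity
          rw [← mul_assoc, ← mul_assoc, ← ENNReal.ofReal_mul hsub, ← ENNReal.ofReal_mul hB0.le,
            subordinator_mul_mehlerKernel m ν t hv]
      _ = _ := by
          rw [lintegral_const_mul' _ _ ENNReal.ofReal_ne_top, lintegral_lintegral_swap]
          · congr 1
            refine lintegral_congr fun y => ?_
            rw [lintegral_mul_const' _ _ ENNReal.ofReal_ne_top]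
          · exact hmeas.ennreal_ofReal.aemeasurable.mul hf.ennreal_ofReal.comp_snd
  rw [h1] at h
  have h2 : ∫⁻ y, (∫⁻ v in Set.Ioi (0 : ℝ), ENNReal.ofReal
        (Real.exp (phase (v, y) (t ^ 2, ‖x‖ ^ 2, x)) * amplitude m ν (v, y))) *
        ENNReal.ofReal (f y) < ⊤ := by
    refine ENNReal.lt_top_of_mul_ne_top_right h.ne ?_
    simpa using hB0
  have h3 : ENNReal.ofReal c * ∫⁻ y, ‖weight m ν y • f y‖ₑ < ⊤ := by
    rw [← lintegral_const_mul' _ _ ENNReal.ofReal_ne_top]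
    refine lt_of_le_of_lt (lintegral_mono fun y => ?_) h2
    rw [enorm_smul, Real.enorm_of_nonneg (weight_pos m ν y).le, Real.enorm_of_nonneg (hf0 y),
      ← mul_assoc, ← ENNReal.ofReal_mul hc.le]
    gcongr
    exact hk y
  exact ENNReal.lt_top_of_mul_ne_top_right h3.ne (by simpa using hc)

/-! ### Derivatives of the exponential family -/

variable {d : ℕ}

/-- Densities for which the exponential family converges on `parDomain`. -/
def IsAdmissible (g : ℝ × EuclideanSpace ℝ (Fin d) → ℂ) : Prop :=
  AEStronglyMeasurable g (timeSpace d) ∧ ExpIntegrableOn (timeSpace d) phase g (parDomain d)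

/-- The exponential integral with density `g`. -/
def expIntegral (g : ℝ × EuclideanSpace ℝ (Fin d) → ℂ)
    (w : ℝ × ℝ × EuclideanSpace ℝ (Fin d)) : ℂ :=
  ∫ p, Real.exp (phase p w) • g p ∂(timeSpace d)

/-- Multiplication of a density by the linear statistic `phase · u`. -/
def phaseMul (u : ℝ × ℝ × EuclideanSpace ℝ (Fin d)) (g : ℝ × EuclideanSpace ℝ (Fin d) → ℂ) :
    ℝ × EuclideanSpace ℝ (Fin d) → ℂ :=
  fun p => (phase p u : ℂ) * g p

/-- Differentiation in the direction `u` multiplies the density by `phase · u`; stability under this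
operation permits repeated differentiation. -/
theorem IsAdmissible.mul_phase {g : ℝ × EuclideanSpace ℝ (Fin d) → ℂ} (hg : IsAdmissible g)
    (u : ℝ × ℝ × EuclideanSpace ℝ (Fin d)) : IsAdmissible (phaseMul u g) := by
  have h1 : AEStronglyMeasurable (phaseMul u g) (timeSpace d) :=
    (Complex.continuous_ofReal.comp_aestronglyMeasurable
      (stronglyMeasurable_phase.aestronglyMeasurable.apply_continuousLinearMap u)).mul hg.1
  refine ⟨h1, hg.2.norm_mul (isOpen_parDomain d) stronglyMeasurable_phase.aestronglyMeasurable h1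
    (C := ‖u‖) fun p => ?_⟩
  rw [phaseMul, norm_mul, Complex.norm_real]
  calc _ ≤ ‖phase p‖ * ‖u‖ * ‖g p‖ := by gcongr; exact (phase p).le_opNorm u
    _ = _ := by ring

theorem IsAdmissible.hasDerivAt_time {g : ℝ × EuclideanSpace ℝ (Fin d) → ℂ} (hg : IsAdmissible g)
    {t : ℝ} (ht : 0 < t) (x : EuclideanSpace ℝ (Fin d)) :
    HasDerivAt (fun r : ℝ => expIntegral g (r ^ 2, ‖x‖ ^ 2, x))
      (2 * t * expIntegral (phaseMul (1, 0, 0) g) (t ^ 2, ‖x‖ ^ 2, x)) t := by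
  have hγ : HasDerivAt (fun r : ℝ =>
      ((r ^ 2, ‖x‖ ^ 2, x) : ℝ × ℝ × EuclideanSpace ℝ (Fin d))) (2 * t, 0, 0) t := by
    refine HasDerivAt.prodMk ?_ ((hasDerivAt_const t (‖x‖ ^ 2)).prodMk (hasDerivAt_const t x))
    simpa using hasDerivAt_pow 2 t
  have h := hg.2.hasDerivAt_comp (isOpen_parDomain d)
    stronglyMeasurable_phase.aestronglyMeasurable hg.1 (mem_parDomain ht x) hγ
  refine HasDerivAt.congr_deriv (f := fun r : ℝ => expIntegral g (r ^ 2, ‖x‖ ^ 2, x)) h ?_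
  rw [expIntegral, ← integral_const_mul]
  refine integral_congr_ae (Filter.Eventually.of_forall fun p => ?_)
  have : phase p (2 * t, 0, 0) = 2 * t * phase p (1, 0, 0) := by
    rw [phase_apply, phase_apply]; simp; ring
  simp only [phaseMul, this, Complex.real_smul]
  push_cast; ring

theorem IsAdmissible.hasLineDerivAt_space {g : ℝ × EuclideanSpace ℝ (Fin d) → ℂ}
    (hg : IsAdmissible g) {t : ℝ} (ht : 0 < t) (x e : EuclideanSpace ℝ (Fin d)) :
    HasLineDerivAt ℝ (fun x => expIntegral g (t ^ 2, ‖x‖ ^ 2, x))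
      (2 * (inner ℝ x e : ℝ) *
        expIntegral (phaseMul (0, 1, 0) g) (t ^ 2, ‖x‖ ^ 2, x) +
        expIntegral (phaseMul (0, 0, e) g) (t ^ 2, ‖x‖ ^ 2, x)) x e := by
  have hx : HasDerivAt (fun r : ℝ => x + r • e) e 0 := by
    simpa using ((hasDerivAt_id (0 : ℝ)).smul_const e).const_add x
  have hγ : HasDerivAt (fun r : ℝ =>
      ((t ^ 2, ‖x + r • e‖ ^ 2, x + r • e) : ℝ × ℝ × EuclideanSpace ℝ (Fin d)))
      (0, 2 * inner ℝ x e, e) 0 := by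
    refine HasDerivAt.prodMk (hasDerivAt_const _ _) (HasDerivAt.prodMk ?_ hx)
    simpa using hx.norm_sq
  have h0 : ((t ^ 2, ‖x + (0 : ℝ) • e‖ ^ 2, x + (0 : ℝ) • e) :
      ℝ × ℝ × EuclideanSpace ℝ (Fin d)) = (t ^ 2, ‖x‖ ^ 2, x) := by simp
  have hmem := mem_parDomain ht x
  have h := hg.2.hasDerivAt_comp (isOpen_parDomain d)
    stronglyMeasurable_phase.aestronglyMeasurable hg.1 (by rw [h0]; exact hmem) hγ
  rw [h0] at h
  refine HasDerivAt.congr_deriv (f := fun r : ℝ =>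
    expIntegral g (t ^ 2, ‖x + r • e‖ ^ 2, x + r • e)) h ?_
  rw [expIntegral, ← integral_const_mul, expIntegral,
    ← integral_add (((hg.mul_phase (0, 1, 0)).2 _ hmem).const_mul _) ((hg.mul_phase (0, 0, e)).2 _ hmem)]
  refine integral_congr_ae (Filter.Eventually.of_forall fun p => ?_)
  have : phase p (0, 2 * inner ℝ x e, e) =
      2 * inner ℝ x e * phase p (0, 1, 0) + phase p (0, 0, e) := by
    rw [phase_apply, phase_apply, phase_apply]; simp; ring
  simp only [phaseMul, this, Complex.real_smul]
  push_cast; ring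

/-- For a `C²` function iterated line derivatives are the diagonal entries of the second Fréchet
derivative, so derivatives along lines are all that has to be computed. -/
theorem laplacian_eq_sum_of_hasLineDerivAt {h : EuclideanSpace ℝ (Fin d) → ℂ}
    (hh : ContDiff ℝ 2 h)
    {D DD : EuclideanSpace ℝ (Fin d) → EuclideanSpace ℝ (Fin d) → ℂ}
    (hD : ∀ e x, HasLineDerivAt ℝ h (D e x) x e)
    (hDD : ∀ e x, HasLineDerivAt ℝ (D e) (DD e x) x e) (x : EuclideanSpace ℝ (Fin d)) :
    Laplacian.laplacian h x = ∑ i, DD (EuclideanSpace.basisFun (Fin d) ℝ i) x := by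
  rw [InnerProductSpace.laplacian_eq_iteratedFDeriv_orthonormalBasis h
    (EuclideanSpace.basisFun (Fin d) ℝ)]
  refine Finset.sum_congr rfl fun i _ => ?_
  set e := EuclideanSpace.basisFun (Fin d) ℝ i
  rw [iteratedFDeriv_two_apply]
  have h1 : ∀ z, fderiv ℝ h z e = D e z := fun z => by
    rw [← (hh.differentiable (by norm_num) z).lineDeriv_eq_fderiv]
    exact (hD e z).lineDeriv
  have h2 : DifferentiableAt ℝ (fderiv ℝ h) x :=
    (hh.fderiv_right (m := 1) (by norm_num)).differentiable (by norm_num) x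
  have h3 : HasLineDerivAt ℝ (fun z => fderiv ℝ h z e) ((fderiv ℝ (fderiv ℝ h) x) e e) x e := by
    have := (h2.hasFDerivAt.clm_apply (hasFDerivAt_const e x)).hasLineDerivAt e
    simpa using this
  simp only [h1] at h3
  simpa using (h3.unique (hDD e x))

theorem isAdmissible_of_memL1Weight {m ν : ℝ} (hm : -(d : ℝ) ≤ m) (hν : 0 < ν)
    {f : EuclideanSpace ℝ (Fin d) → ℂ} (hf : MemL1Weight m ν f) :
    IsAdmissible (fun p => (amplitude m ν p : ℂ) * f p.2) :=
  ⟨hf.aestronglyMeasurable_amplitude_mul, hf.expIntegrableOn hm hν⟩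

theorem IsAdmissible.contDiff_space {g : ℝ × EuclideanSpace ℝ (Fin d) → ℂ}
    (hg : IsAdmissible g) {t : ℝ} (ht : 0 < t) :
    ContDiff ℝ ∞ (fun x => expIntegral g (t ^ 2, ‖x‖ ^ 2, x)) := by
  have h1 := hg.2.contDiffOn (isOpen_parDomain d)
    stronglyMeasurable_phase.aestronglyMeasurable hg.1
  have h2 : ContDiff ℝ ∞ (fun x : EuclideanSpace ℝ (Fin d) =>
      ((t ^ 2, ‖x‖ ^ 2, x) : ℝ × ℝ × EuclideanSpace ℝ (Fin d))) :=
    contDiff_const.prodMk ((contDiff_id.norm_sq ℝ).prodMk contDiff_id)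
  exact h1.comp_contDiff h2 fun x => mem_parDomain ht x

theorem integral_mul_add_mul_add_add {Ω : Type*} [MeasurableSpace Ω] {μ : Measure Ω}
    {F₁ F₂ F₃ F₄ F₅ : Ω → ℂ} (h₁ : Integrable F₁ μ) (h₂ : Integrable F₂ μ) (h₃ : Integrable F₃ μ)
    (h₄ : Integrable F₄ μ) (h₅ : Integrable F₅ μ) (a b c e : ℂ) :
    Integrable (fun p => a * F₁ p + b * (c * F₂ p + F₃ p) + (e * F₄ p + F₅ p)) μ ∧
    ∫ p, a * F₁ p + b * (c * F₂ p + F₃ p) + (e * F₄ p + F₅ p) ∂μ =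
      a * ∫ p, F₁ p ∂μ + b * (c * ∫ p, F₂ p ∂μ + ∫ p, F₃ p ∂μ) +
        (e * ∫ p, F₄ p ∂μ + ∫ p, F₅ p ∂μ) := by
  have k₁ := h₁.const_mul a
  have k₂ : Integrable (fun p => c * F₂ p + F₃ p) μ := (h₂.const_mul c).add h₃
  have k₃ : Integrable (fun p => a * F₁ p + b * (c * F₂ p + F₃ p)) μ := k₁.add (k₂.const_mul b)
  have k₄ : Integrable (fun p => e * F₄ p + F₅ p) μ := (h₄.const_mul e).add h₅
  refine ⟨k₃.add k₄, ?_⟩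
  rw [integral_add k₃ k₄, integral_add k₁ (k₂.const_mul b), integral_const_mul,
    integral_const_mul, integral_add (h₂.const_mul c) h₃, integral_const_mul,
    integral_add (h₄.const_mul e) h₅, integral_const_mul]

/-- The Laplacian of an exponential integral. -/
theorem IsAdmissible.laplacian_eq {g : ℝ × EuclideanSpace ℝ (Fin d) → ℂ}
    (hg : IsAdmissible g) {t : ℝ} (ht : 0 < t) (x : EuclideanSpace ℝ (Fin d)) :
    Laplacian.laplacian (fun x => expIntegral g (t ^ 2, ‖x‖ ^ 2, x)) x =
      ∫ p, Real.exp (phase p (t ^ 2, ‖x‖ ^ 2, x)) •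
        (((2 * d * phase p (0, 1, 0) + 4 * ‖x‖ ^ 2 * phase p (0, 1, 0) ^ 2 +
          4 * phase p (0, 1, 0) * phase p (0, 0, x) + ‖p.2‖ ^ 2 / Real.sinh (2 * p.1) ^ 2 : ℝ) : ℂ)
          * g p) ∂(timeSpace d) ∧
    Integrable (fun p => Real.exp (phase p (t ^ 2, ‖x‖ ^ 2, x)) •
        (((2 * d * phase p (0, 1, 0) + 4 * ‖x‖ ^ 2 * phase p (0, 1, 0) ^ 2 +
          4 * phase p (0, 1, 0) * phase p (0, 0, x) + ‖p.2‖ ^ 2 / Real.sinh (2 * p.1) ^ 2 : ℝ) : ℂ)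
          * g p)) (timeSpace d) := by
  have hB := hg.mul_phase (0, 1, 0)
  have hBB := hB.mul_phase (0, 1, 0)
  have hDeriv := laplacian_eq_sum_of_hasLineDerivAt
    (h := fun x => expIntegral g (t ^ 2, ‖x‖ ^ 2, x)) (by exact_mod_cast contDiff_infty.1 (hg.contDiff_space ht) 2)
    (fun e x => hg.hasLineDerivAt_space ht x e) (DD := fun e x =>
      (2 * (inner ℝ e e : ℝ) * expIntegral (phaseMul (0, 1, 0) g) (t ^ 2, ‖x‖ ^ 2, x) +
      2 * (inner ℝ x e : ℝ) * (2 * (inner ℝ x e : ℝ) * expIntegral (phaseMul (0, 1, 0)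
        (phaseMul (0, 1, 0) g)) (t ^ 2, ‖x‖ ^ 2, x) +
        expIntegral (phaseMul (0, 0, e) (phaseMul (0, 1, 0) g))
          (t ^ 2, ‖x‖ ^ 2, x))) +
      (2 * (inner ℝ x e : ℝ) * expIntegral (phaseMul (0, 1, 0)
        (phaseMul (0, 0, e) g)) (t ^ 2, ‖x‖ ^ 2, x) +
        expIntegral (phaseMul (0, 0, e) (phaseMul (0, 0, e) g))
          (t ^ 2, ‖x‖ ^ 2, x))) (fun e x => by
      refine HasDerivAt.add ?_ ((hg.mul_phase (0, 0, e)).hasLineDerivAt_space ht x e)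
      have h1 : HasDerivAt (fun r : ℝ => (2 * ((inner ℝ (x + r • e) e : ℝ) : ℂ)))
          (2 * (inner ℝ e e : ℝ)) 0 := by
        have h2 : HasDerivAt (fun r : ℝ => (inner ℝ (x + r • e) e : ℝ)) (inner ℝ e e) 0 := by
          have h3 : (fun r : ℝ => (inner ℝ (x + r • e) e : ℝ)) =
              fun r => inner ℝ x e + r * inner ℝ e e := by
            funext r; rw [inner_add_left, real_inner_smul_left]
          rw [h3]
          simpa using ((hasDerivAt_id (0 : ℝ)).mul_const (inner ℝ e e : ℝ)).const_add (inner ℝ x e : ℝ)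
        exact h2.ofReal_comp.const_mul 2
      have h4 := h1.mul (hB.hasLineDerivAt_space ht x e)
      simpa [Pi.mul_def] using h4) x
  set w : ℝ × ℝ × EuclideanSpace ℝ (Fin d) := (t ^ 2, ‖x‖ ^ 2, x) with hw
  have hmem : w ∈ parDomain d := mem_parDomain ht x
  let b := EuclideanSpace.basisFun (Fin d) ℝ
  -- With `b i` orthonormal and `B = phase p (0,1,0)`, the `i`-th second derivative inserts `2B +
  -- 4xᵢ²B² + 4xᵢB yᵢ/sinh 2v + yᵢ²/sinh² 2v`. Summation over `i` gives the stated polynomial.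
  have key : ∀ p, Real.exp (phase p w) •
        (((2 * d * phase p (0, 1, 0) + 4 * ‖x‖ ^ 2 * phase p (0, 1, 0) ^ 2 +
          4 * phase p (0, 1, 0) * phase p (0, 0, x) + ‖p.2‖ ^ 2 / Real.sinh (2 * p.1) ^ 2 : ℝ) : ℂ)
          * g p) = ∑ i, (2 * (inner ℝ (b i) (b i) : ℝ) *
          (Real.exp (phase p w) • phaseMul (0, 1, 0) g p) +
      2 * (inner ℝ x (b i) : ℝ) * (2 * (inner ℝ x (b i) : ℝ) * (Real.exp (phase p w) •
        phaseMul (0, 1, 0) (phaseMul (0, 1, 0) g) p) +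
        (Real.exp (phase p w) • phaseMul (0, 0, b i)
          (phaseMul (0, 1, 0) g) p)) +
      (2 * (inner ℝ x (b i) : ℝ) * (Real.exp (phase p w) • phaseMul (0, 1, 0)
        (phaseMul (0, 0, b i) g) p) +
        (Real.exp (phase p w) • phaseMul (0, 0, b i)
          (phaseMul (0, 0, b i) g) p))) := by
    intro p
    have e1 : ∀ i, (inner ℝ (b i) (b i) : ℝ) = 1 := fun i => by
      rw [real_inner_self_eq_norm_sq, b.norm_eq_one]; norm_num
    have e2 : ∑ i, (inner ℝ x (b i) : ℝ) ^ 2 = ‖x‖ ^ 2 := by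
      rw [EuclideanSpace.real_norm_sq_eq]
      refine Finset.sum_congr rfl fun i _ => ?_
      simp [b, EuclideanSpace.inner_single_right]
    have e3 : ∀ i, phase p (0, 0, b i) = p.2 i / Real.sinh (2 * p.1) := fun i => by
      rw [phase_apply]; simp [b, EuclideanSpace.inner_single_right]
    have e4 : ∑ i, (inner ℝ x (b i) : ℝ) * phase p (0, 0, b i) = phase p (0, 0, x) := by
      simp only [e3, phase_apply]
      simp only [zero_div, neg_zero, mul_zero, sub_zero, zero_add, PiLp.inner_apply, Finset.sum_div]
      refine Finset.sum_congr rfl fun i _ => ?_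
      simp [b]; ring
    have e5 : ∑ i, phase p (0, 0, b i) ^ 2 = ‖p.2‖ ^ 2 / Real.sinh (2 * p.1) ^ 2 := by
      simp only [e3, div_pow]
      rw [← Finset.sum_div, EuclideanSpace.real_norm_sq_eq]
    have e6 : ∑ i : Fin d, (1 : ℝ) = d := by simp
    simp only [phaseMul, Complex.real_smul]
    rw [← e2, ← e4, ← e5, ← e6]
    push_cast
    simp only [Finset.mul_sum, Finset.sum_mul, ← Finset.sum_add_distrib]
    refine Finset.sum_congr rfl fun i _ => ?_
    rw [e1]
    push_cast
    ring
  have hint := fun i => integral_mul_add_mul_add_add (hB.2 w hmem) (hBB.2 w hmem)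
    ((hB.mul_phase (0, 0, b i)).2 w hmem) (((hg.mul_phase (0, 0, b i)).mul_phase (0, 1, 0)).2 w hmem)
    (((hg.mul_phase (0, 0, b i)).mul_phase (0, 0, b i)).2 w hmem) (2 * (inner ℝ (b i) (b i) : ℝ))
    (2 * (inner ℝ x (b i) : ℝ)) (2 * (inner ℝ x (b i) : ℝ)) (2 * (inner ℝ x (b i) : ℝ))
  simp only [key]
  refine ⟨?_, integrable_finsetSum _ fun i _ => (hint i).1⟩
  rw [integral_finsetSum _ fun i _ => (hint i).1, hDeriv]
  exact Finset.sum_congr rfl fun i _ => (hint i).2.symm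

/-! ### The time derivative of the kernel and the differential equation -/

theorem hasDerivAt_sinh_two_mul (v : ℝ) :
    HasDerivAt (fun v => Real.sinh (2 * v)) (2 * Real.cosh (2 * v)) v := by
  have := ((hasDerivAt_id v).const_mul 2).sinh
  simpa [mul_comm] using this

theorem hasDerivAt_cosh_two_mul (v : ℝ) :
    HasDerivAt (fun v => Real.cosh (2 * v)) (2 * Real.sinh (2 * v)) v := by
  have := ((hasDerivAt_id v).const_mul 2).cosh
  simpa [mul_comm] using this

theorem hasDerivAt_coth_two_mul {v : ℝ} (hv : 0 < v) :
    HasDerivAt (fun v => coth (2 * v)) (-2 / Real.sinh (2 * v) ^ 2) v := by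
  have hS := (sinh_two_mul_pos hv).ne'
  refine ((hasDerivAt_cosh_two_mul v).div (hasDerivAt_sinh_two_mul v) hS).congr_deriv ?_
  have := Real.cosh_sq (2 * v)
  congr 1
  nlinarith

theorem hasDerivAt_heatFactor (d : ℕ) (m : ℝ) {v : ℝ} (hv : 0 < v) :
    HasDerivAt (heatFactor d m) (heatFactor d m v * (-m - d * coth (2 * v))) v := by
  have hS := sinh_two_mul_pos hv
  have hpos : 0 < 2 * Real.pi * Real.sinh (2 * v) := by positivity
  have h1 : HasDerivAt (fun v => Real.exp (-(v * m))) (Real.exp (-(v * m)) * (-m)) v := by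
    have := (((hasDerivAt_id v).mul_const m).neg).exp
    simpa using this
  have h2 : HasDerivAt (fun v => (2 * Real.pi * Real.sinh (2 * v)) ^ (-(d : ℝ) / 2))
      ((2 * Real.pi * Real.sinh (2 * v)) ^ (-(d : ℝ) / 2) * (-d * coth (2 * v))) v := by
    refine (((hasDerivAt_sinh_two_mul v).const_mul (2 * Real.pi)).rpow_const
      (p := -(d : ℝ) / 2) (Or.inl hpos.ne')).congr_deriv ?_
    rw [Real.rpow_sub_one hpos.ne', coth]
    field_simp
  refine (h1.mul h2).congr_deriv ?_
  rw [heatFactor]; ring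

/-- The logarithmic time derivative of the kernel. -/
def logDerivKernel (m ν : ℝ) (w : ℝ × ℝ × EuclideanSpace ℝ (Fin d))
    (p : ℝ × EuclideanSpace ℝ (Fin d)) : ℝ :=
  4 * w.1 * phase p (1, 0, 0) ^ 2 + 4 * (1 + ν) * phase p (1, 0, 0) +
    (2 * d * phase p (0, 1, 0) + 4 * w.2.1 * phase p (0, 1, 0) ^ 2 +
    4 * phase p (0, 1, 0) * phase p (0, 0, w.2.2) + ‖p.2‖ ^ 2 / Real.sinh (2 * p.1) ^ 2) -
    (w.2.1 + m)

/-- `logDerivKernel` is the polynomial in the phase that the differential operator in `t` and `x`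
inserts. It agrees with the `v`-derivative because `coth² = 1 + 1/sinh²`: the potential term `-|x|²`
cancels against part of the Laplacian. -/
theorem hasDerivAt_kernel (m ν : ℝ) (w : ℝ × ℝ × EuclideanSpace ℝ (Fin d))
    (y : EuclideanSpace ℝ (Fin d)) {v : ℝ} (hv : 0 < v) :
    HasDerivAt (fun v => Real.exp (phase (v, y) w) * amplitude m ν (v, y))
      (Real.exp (phase (v, y) w) * amplitude m ν (v, y) * logDerivKernel m ν w (v, y)) v := by
  have hS := (sinh_two_mul_pos hv).ne'
  have h0 : HasDerivAt (fun v => phase (v, y) w) (w.1 / (4 * v ^ 2) +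
      1 / Real.sinh (2 * v) ^ 2 * w.2.1 -
      2 * inner ℝ y w.2.2 * Real.cosh (2 * v) / Real.sinh (2 * v) ^ 2) v := by
    simp only [phase_apply]
    have h1 : HasDerivAt (fun v : ℝ => -(w.1 / (4 * v))) (w.1 / (4 * v ^ 2)) v := by
      have := ((hasDerivAt_const v w.1).div ((hasDerivAt_id v).const_mul 4) (by simp [hv.ne'])).neg
      refine this.congr_deriv ?_
      simp only [id_eq]
      field_simp; ring
    have h2 := ((hasDerivAt_coth_two_mul hv).div_const 2).mul_const w.2.1
    have h3 := (hasDerivAt_const v (inner ℝ y w.2.2 : ℝ)).div (hasDerivAt_sinh_two_mul v) hS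
    refine ((h1.sub h2).add h3).congr_deriv ?_
    field_simp; ring
  have h4 : HasDerivAt (fun v : ℝ => v ^ (-(1 + ν))) (v ^ (-(1 + ν)) * (-(1 + ν) / v)) v := by
    refine (Real.hasDerivAt_rpow_const (p := -(1 + ν)) (Or.inl hv.ne')).congr_deriv ?_
    rw [Real.rpow_sub_one hv.ne']; ring
  have h5 : HasDerivAt (fun v => Real.exp (-(coth (2 * v) / 2 * ‖y‖ ^ 2)))
      (Real.exp (-(coth (2 * v) / 2 * ‖y‖ ^ 2)) * (‖y‖ ^ 2 / Real.sinh (2 * v) ^ 2)) v := by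
    have h6 : HasDerivAt (fun v => -(coth (2 * v) / 2 * ‖y‖ ^ 2))
        (‖y‖ ^ 2 / Real.sinh (2 * v) ^ 2) v := by
      refine (((hasDerivAt_coth_two_mul hv).div_const 2).mul_const (‖y‖ ^ 2)).neg.congr_deriv ?_
      ring
    exact h6.exp
  have h6 : HasDerivAt (fun v => amplitude m ν (v, y)) (amplitude m ν (v, y) *
      (-m - d * coth (2 * v) - (1 + ν) / v + ‖y‖ ^ 2 / Real.sinh (2 * v) ^ 2)) v := by
    refine (((hasDerivAt_heatFactor d m hv).mul h4).mul h5).congr_deriv ?_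
    simp only [amplitude, Pi.mul_apply]; ring
  refine (h0.exp.mul h6).congr_deriv ?_
  have hb : coth (2 * v) ^ 2 = 1 + 1 / Real.sinh (2 * v) ^ 2 := by
    rw [coth, div_pow, Real.cosh_sq]; field_simp
  have hl : logDerivKernel m ν w (v, y) = w.1 / (4 * v ^ 2) +
      1 / Real.sinh (2 * v) ^ 2 * w.2.1 -
      2 * inner ℝ y w.2.2 * Real.cosh (2 * v) / Real.sinh (2 * v) ^ 2 +
      (-m - d * coth (2 * v) - (1 + ν) / v + ‖y‖ ^ 2 / Real.sinh (2 * v) ^ 2) := by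
    have e1 : phase (v, y) (1, 0, 0) = -(1 / (4 * v)) := by rw [phase_apply]; simp
    have e2 : phase (v, y) (0, 1, 0) = -(coth (2 * v) / 2) := by rw [phase_apply]; simp
    have e3 : phase (v, y) (0, 0, w.2.2) = inner ℝ y w.2.2 / Real.sinh (2 * v) := by
      rw [phase_apply]; simp
    rw [logDerivKernel, e1, e2, e3]
    have e4 : 4 * w.2.1 * (-(coth (2 * v) / 2)) ^ 2 = w.2.1 * coth (2 * v) ^ 2 := by ring
    rw [e4, hb, coth]
    field_simp; ring
  rw [hl]
  ring

theorem mehlerKernel_le_heatFactor (m : ℝ) {v : ℝ} (hv : 0 < v)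
    (x y : EuclideanSpace ℝ (Fin d)) :
    mehlerKernel m v x y ≤ heatFactor d m v * Real.exp |inner ℝ x y| := by
  have hF := heatFactor_nonneg d m hv.le
  unfold mehlerKernel
  rw [← heatFactor]
  have h1 : 0 ≤ Real.tanh (2 * v) := by
    rw [Real.tanh_eq_sinh_div_cosh]
    exact div_nonneg (sinh_two_mul_pos hv).le (Real.cosh_pos _).le
  have h2 : 0 ≤ Real.tanh v := by
    rw [Real.tanh_eq_sinh_div_cosh]
    exact div_nonneg (Real.sinh_pos_iff.2 hv).le (Real.cosh_pos _).le
  have h3 : Real.tanh v ≤ 1 := (Real.tanh_lt_one v).le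
  have h4 : 0 ≤ ‖x - y‖ ^ 2 / (2 * Real.tanh (2 * v)) := by positivity
  gcongr
  nlinarith [neg_abs_le (inner ℝ x y : ℝ), abs_nonneg (inner ℝ x y : ℝ)]

theorem kernel_eq (m ν t : ℝ) {v : ℝ} (hv : 0 < v) (x y : EuclideanSpace ℝ (Fin d)) :
    Real.exp (phase (v, y) (t ^ 2, ‖x‖ ^ 2, x)) * amplitude m ν (v, y) =
      Real.exp (-(t ^ 2 / (4 * v))) * v ^ (-(1 + ν)) * mehlerKernel m v x y := by
  rw [mehlerKernel_eq m hv, phase_apply, amplitude, real_inner_comm x y]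
  have : Real.exp (-(t ^ 2 / (4 * v)) - coth (2 * v) / 2 * ‖x‖ ^ 2 +
      inner ℝ x y / Real.sinh (2 * v)) * Real.exp (-(coth (2 * v) / 2 * ‖y‖ ^ 2)) =
      Real.exp (-(t ^ 2 / (4 * v))) * Real.exp (-(coth (2 * v) / 2 * (‖x‖ ^ 2 + ‖y‖ ^ 2)) +
      inner ℝ x y / Real.sinh (2 * v)) := by
    rw [← Real.exp_add, ← Real.exp_add]; ring_nf
  calc _ = heatFactor d m v * v ^ (-(1 + ν)) *
        (Real.exp (-(t ^ 2 / (4 * v)) - coth (2 * v) / 2 * ‖x‖ ^ 2 +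
      inner ℝ x y / Real.sinh (2 * v)) * Real.exp (-(coth (2 * v) / 2 * ‖y‖ ^ 2))) := by ring
    _ = _ := by rw [this]; ring

/-- For fixed `x, y`, the factor `e^{-t²/(4v)}` with `t > 0` beats all powers of `1/v`, so a crude
bound on the heat kernel suffices. -/
theorem tendsto_kernel_zero (m ν : ℝ) {t : ℝ} (ht : 0 < t) (x y : EuclideanSpace ℝ (Fin d)) :
    Filter.Tendsto (fun v => Real.exp (phase (v, y) (t ^ 2, ‖x‖ ^ 2, x)) * amplitude m ν (v, y))
      (𝓝[>] 0) (𝓝 0) := by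
  have h1 := (tendsto_rpow_mul_exp_neg_mul_atTop_nhds_zero (d / 2 + (1 + ν)) (t ^ 2 / 4)
    (by positivity)).comp (tendsto_inv_nhdsGT_zero (𝕜 := ℝ))
  have h2 := h1.const_mul (Real.exp |m| * Real.exp |inner ℝ x y|)
  rw [mul_zero] at h2
  refine tendsto_of_tendsto_of_tendsto_of_le_of_le' tendsto_const_nhds h2 ?_ ?_
  · filter_upwards [self_mem_nhdsWithin] with v hv
    exact mul_nonneg (Real.exp_pos _).le (amplitude_nonneg m ν hv y)
  · filter_upwards [Ioo_mem_nhdsGT one_pos] with v hv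
    have hv0 : 0 < v := hv.1
    rw [kernel_eq m ν t hv0, Function.comp_apply]
    have e1 := mehlerKernel_le_heatFactor m hv0 x y
    have e2 := heatFactor_le_rpow d m hv0
    have e3 : Real.exp (|m| * v) ≤ Real.exp |m| :=
      Real.exp_le_exp.2 (mul_le_of_le_one_right (abs_nonneg m) hv.2.le)
    have e4 : v ^ (-(d : ℝ) / 2) * v ^ (-(1 + ν)) = v⁻¹ ^ ((d : ℝ) / 2 + (1 + ν)) := by
      rw [← Real.rpow_add hv0, Real.inv_rpow hv0.le, ← Real.rpow_neg hv0.le]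
      congr 1; ring
    calc _ ≤ Real.exp (-(t ^ 2 / (4 * v))) * v ^ (-(1 + ν)) *
          (Real.exp |m| * v ^ (-(d : ℝ) / 2) * Real.exp |inner ℝ x y|) := by
          gcongr
          refine e1.trans ?_
          gcongr
          exact e2.trans (by gcongr)
      _ = Real.exp |m| * Real.exp |inner ℝ x y| * ((v ^ (-(d : ℝ) / 2) * v ^ (-(1 + ν))) *
          Real.exp (-(t ^ 2 / (4 * v)))) := by ring
      _ = _ := by
          rw [e4, show -(t ^ 2 / (4 * v)) = -(t ^ 2 / 4) * v⁻¹ by field_simp]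

/-- As `d + m ≥ 0` the heat factor stays bounded, and `v^{-(1+ν)}` tends to zero. -/
theorem tendsto_kernel_atTop {m ν : ℝ} (hm : -(d : ℝ) ≤ m) (hν : 0 < ν) (t : ℝ)
    (x y : EuclideanSpace ℝ (Fin d)) :
    Filter.Tendsto (fun v => Real.exp (phase (v, y) (t ^ 2, ‖x‖ ^ 2, x)) * amplitude m ν (v, y))
      Filter.atTop (𝓝 0) := by
  obtain ⟨C, hC, hF⟩ := heatFactor_le_exp d m one_pos
  have h2 := (tendsto_rpow_neg_atTop (y := 1 + ν) (by linarith)).const_mul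
    (C * Real.exp |inner ℝ x y|)
  rw [mul_zero] at h2
  refine tendsto_of_tendsto_of_tendsto_of_le_of_le' tendsto_const_nhds h2 ?_ ?_
  · filter_upwards [Filter.eventually_gt_atTop 0] with v hv
    exact mul_nonneg (Real.exp_pos _).le (amplitude_nonneg m ν hv y)
  · filter_upwards [Filter.eventually_ge_atTop 1] with v hv
    have hv0 : 0 < v := by linarith
    rw [kernel_eq m ν t hv0]
    have e1 := mehlerKernel_le_heatFactor m hv0 x y
    have e2 : heatFactor d m v ≤ C * 1 := by
      refine (hF v hv).trans ?_
      gcongr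
      exact Real.exp_le_one_iff.2 (by nlinarith)
    have e3 : Real.exp (-(t ^ 2 / (4 * v))) ≤ 1 := Real.exp_le_one_iff.2 (by
      have : 0 ≤ t ^ 2 / (4 * v) := by positivity
      linarith)
    have e4 := mehlerKernel_nonneg m hv0 x y
    calc _ ≤ 1 * v ^ (-(1 + ν)) * (C * 1 * Real.exp |inner ℝ x y|) := by
          gcongr
          exact e1.trans (by gcongr)
      _ = _ := by ring

/-- The time derivative of the kernel integrates to zero against `f`. -/
theorem integral_logDerivKernel_eq_zero {m ν : ℝ} (hm : -(d : ℝ) ≤ m) (hν : 0 < ν)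
    {f : EuclideanSpace ℝ (Fin d) → ℂ} {t : ℝ} (ht : 0 < t) (x : EuclideanSpace ℝ (Fin d))
    (hint : Integrable (fun p => Real.exp (phase p (t ^ 2, ‖x‖ ^ 2, x)) •
      ((logDerivKernel m ν (t ^ 2, ‖x‖ ^ 2, x) p : ℂ) * ((amplitude m ν p : ℂ) * f p.2)))
      (timeSpace d)) :
    ∫ p, Real.exp (phase p (t ^ 2, ‖x‖ ^ 2, x)) •
      ((logDerivKernel m ν (t ^ 2, ‖x‖ ^ 2, x) p : ℂ) * ((amplitude m ν p : ℂ) * f p.2))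
      ∂(timeSpace d) = 0 := by
  rw [integral_prod_symm _ hint]
  refine integral_eq_zero_of_ae ?_
  filter_upwards [hint.prod_left_ae] with y hy
  have hform : ∀ v : ℝ, Real.exp (phase (v, y) (t ^ 2, ‖x‖ ^ 2, x)) •
      ((logDerivKernel m ν (t ^ 2, ‖x‖ ^ 2, x) (v, y) : ℂ) * ((amplitude m ν (v, y) : ℂ) * f y)) =
      ((Real.exp (phase (v, y) (t ^ 2, ‖x‖ ^ 2, x)) * amplitude m ν (v, y) *
        logDerivKernel m ν (t ^ 2, ‖x‖ ^ 2, x) (v, y) : ℝ) : ℂ) * f y := fun v => by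
    rw [Complex.real_smul]; push_cast; ring
  simp only [hform] at hy ⊢
  have h0 := ((Complex.continuous_ofReal.tendsto 0).comp
    (tendsto_kernel_zero m ν ht x y)).mul_const (f y)
  have h1 := ((Complex.continuous_ofReal.tendsto 0).comp
    (tendsto_kernel_atTop hm hν t x y)).mul_const (f y)
  rw [Complex.ofReal_zero, zero_mul] at h0 h1
  -- Integration by parts against the constant `1` is the fundamental theorem of calculus on `(0,
  -- ∞)`, with both boundary values zero.
  have := integral_Ioi_deriv_mul_eq_sub (a := 0) (a' := (0 : ℂ)) (b' := (0 : ℂ))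
    (u := fun v => ((Real.exp (phase (v, y) (t ^ 2, ‖x‖ ^ 2, x)) * amplitude m ν (v, y) : ℝ) : ℂ)
      * f y) (v := fun _ => (1 : ℂ)) (v' := fun _ => 0)
    (fun v hv => ((hasDerivAt_kernel m ν (t ^ 2, ‖x‖ ^ 2, x) y hv).ofReal_comp).mul_const (f y))
    (fun v _ => hasDerivAt_const v (1 : ℂ)) (by simpa [Pi.mul_def, Pi.add_def, IntegrableOn] using hy)
    (by simpa [Pi.mul_def] using h0) (by simpa [Pi.mul_def] using h1)
  simpa using this

theorem integral_add_add_sub {Ω : Type*} [MeasurableSpace Ω] {μ : Measure Ω}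
    {F₁ F₂ F₃ F₄ : Ω → ℂ} (h₁ : Integrable F₁ μ) (h₂ : Integrable F₂ μ) (h₃ : Integrable F₃ μ)
    (h₄ : Integrable F₄ μ) :
    Integrable (fun p => F₁ p + F₂ p + F₃ p - F₄ p) μ ∧
    ∫ p, F₁ p + F₂ p + F₃ p - F₄ p ∂μ =
      ∫ p, F₁ p ∂μ + ∫ p, F₂ p ∂μ + ∫ p, F₃ p ∂μ - ∫ p, F₄ p ∂μ := by
  have k₁ : Integrable (fun p => F₁ p + F₂ p) μ := h₁.add h₂
  have k₂ : Integrable (fun p => F₁ p + F₂ p + F₃ p) μ := k₁.add h₃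
  exact ⟨k₂.sub h₄, by rw [integral_sub k₂ h₄, integral_add k₁ h₃, integral_add h₁ h₂]⟩

/-- The differential equation satisfied by the Poisson integral. -/
theorem MemL1Weight.poissonIntegral_pde {m ν : ℝ} (hm : -(d : ℝ) ≤ m) (hν : 0 < ν)
    {f : EuclideanSpace ℝ (Fin d) → ℂ} (hf : MemL1Weight m ν f) {t : ℝ} (ht : 0 < t)
    (x : EuclideanSpace ℝ (Fin d)) :
    iteratedDeriv 2 (fun s => poissonIntegral m ν s f x) t +
        (((1 - 2 * ν) / t : ℝ) : ℂ) * deriv (fun s => poissonIntegral m ν s f x) t =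
      hermiteOp m (poissonIntegral m ν t f) x := by
  set g : ℝ × EuclideanSpace ℝ (Fin d) → ℂ := fun p => (amplitude m ν p : ℂ) * f p.2 with hgdef
  have hg : IsAdmissible g := isAdmissible_of_memL1Weight hm hν hf
  have hA := hg.mul_phase (1, 0, 0)
  have hAA := hA.mul_phase (1, 0, 0)
  set N := fun s : ℝ => expIntegral g (s ^ 2, ‖x‖ ^ 2, x)
  set M := fun s : ℝ => expIntegral (phaseMul (1, 0, 0) g) (s ^ 2, ‖x‖ ^ 2, x)
  set Q := fun s : ℝ => expIntegral (phaseMul (1, 0, 0) (phaseMul (1, 0, 0) g)) (s ^ 2, ‖x‖ ^ 2, x)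
  set B : ℝ := 4 ^ ν * Real.Gamma ν
  have hN : ∀ s > 0, HasDerivAt N (2 * s * M s) s := fun s hs => hg.hasDerivAt_time hs x
  have hM : ∀ s > 0, HasDerivAt M (2 * s * Q s) s := fun s hs => hA.hasDerivAt_time hs x
  have hpow : ∀ s > 0, HasDerivAt (fun s : ℝ => ((s ^ (2 * ν) / B : ℝ) : ℂ))
      (((s ^ (2 * ν) / B : ℝ) : ℂ) * (2 * ν / s)) s := fun s hs => by
    have h1 := ((Real.hasDerivAt_rpow_const (x := s) (p := 2 * ν) (Or.inl hs.ne')).div_const B)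
    refine h1.ofReal_comp.congr_deriv ?_
    rw [Real.rpow_sub_one hs.ne']
    push_cast
    ring
  have hu : ∀ s > 0, poissonIntegral m ν s f x = ((s ^ (2 * ν) / B : ℝ) : ℂ) * N s :=
    fun s hs => hf.poissonIntegral_eq hm hν hs x
  have hu' : ∀ s > 0, HasDerivAt (fun s => poissonIntegral m ν s f x)
      (((s ^ (2 * ν) / B : ℝ) : ℂ) * (2 * ν / s * N s + 2 * s * M s)) s := fun s hs => by
    have h1 := ((hpow s hs).mul (hN s hs)).congr_of_eventuallyEq
      (f₁ := fun s => poissonIntegral m ν s f x) (by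
        filter_upwards [lt_mem_nhds hs] with r hr
        exact hu r hr)
    refine h1.congr_deriv ?_
    ring
  have hu'' : HasDerivAt (deriv fun s => poissonIntegral m ν s f x)
      (((t ^ (2 * ν) / B : ℝ) : ℂ) * (2 * ν / t) * (2 * ν / t * N t + 2 * t * M t) +
        ((t ^ (2 * ν) / B : ℝ) : ℂ) * (-(2 * ν / t ^ 2) * N t + 2 * ν / t * (2 * t * M t) +
          (2 * M t + 2 * t * (2 * t * Q t)))) t := by
    have ht' : (t : ℂ) ≠ 0 := by exact_mod_cast ht.ne'
    have h1 : HasDerivAt (fun s : ℝ => (2 * ν / s : ℂ)) (-(2 * ν / t ^ 2)) t := by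
      have h2 := (hasDerivAt_const t (2 * ν : ℂ)).div (hasDerivAt_id t).ofReal_comp ht'
      refine h2.congr_deriv ?_
      simp; ring
    have h3 : HasDerivAt (fun s : ℝ => (2 * s : ℂ)) 2 t := by
      simpa using (hasDerivAt_id t).ofReal_comp.const_mul (2 : ℂ)
    have h4 := (hpow t ht).mul ((h1.mul (hN t ht)).add (h3.mul (hM t ht)))
    refine (h4.congr_of_eventuallyEq ?_).congr_deriv ?_
    · filter_upwards [lt_mem_nhds ht] with r hr
      exact (hu' r hr).deriv
    · simp only [Pi.mul_apply, Pi.add_apply]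
  have hlap := hg.laplacian_eq ht x
  set w : ℝ × ℝ × EuclideanSpace ℝ (Fin d) := (t ^ 2, ‖x‖ ^ 2, x) with hw
  have hmem : w ∈ parDomain d := mem_parDomain ht x
  -- the Laplacian of the Poisson integral
  have hpl : Laplacian.laplacian (poissonIntegral m ν t f) x = ((t ^ (2 * ν) / B : ℝ) : ℂ) *
      Laplacian.laplacian (fun x => expIntegral g (t ^ 2, ‖x‖ ^ 2, x)) x := by
    have h1 : poissonIntegral m ν t f = ((t ^ (2 * ν) / B : ℝ) : ℂ) •
        (fun x => expIntegral g (t ^ 2, ‖x‖ ^ 2, x)) := by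
      funext z
      exact hf.poissonIntegral_eq hm hν ht z
    rw [h1, InnerProductSpace.laplacian_smul _ ((contDiff_infty.1 (hg.contDiff_space ht) 2).contDiffAt)]
    rfl
  have k₁ : Integrable (fun p => (4 * t ^ 2 : ℂ) * (Real.exp (phase p w) •
      phaseMul (1, 0, 0) (phaseMul (1, 0, 0) g) p)) (timeSpace d) := (hAA.2 w hmem).const_mul _
  have k₂ : Integrable (fun p => (4 * (1 + ν) : ℂ) * (Real.exp (phase p w) •
      phaseMul (1, 0, 0) g p)) (timeSpace d) := (hA.2 w hmem).const_mul _
  have k₃ : Integrable (fun p => ((‖x‖ ^ 2 + m : ℝ) : ℂ) * (Real.exp (phase p w) • g p))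
      (timeSpace d) := (hg.2 w hmem).const_mul _
  have k := integral_add_add_sub k₁ k₂ hlap.2 k₃
  have hform : ∀ p, Real.exp (phase p w) • ((logDerivKernel m ν w p : ℂ) * g p) =
      (4 * t ^ 2 : ℂ) * (Real.exp (phase p w) • phaseMul (1, 0, 0) (phaseMul (1, 0, 0) g) p) +
      (4 * (1 + ν) : ℂ) * (Real.exp (phase p w) • phaseMul (1, 0, 0) g p) +
      Real.exp (phase p w) •
        (((2 * d * phase p (0, 1, 0) + 4 * ‖x‖ ^ 2 * phase p (0, 1, 0) ^ 2 +
          4 * phase p (0, 1, 0) * phase p (0, 0, x) + ‖p.2‖ ^ 2 / Real.sinh (2 * p.1) ^ 2 : ℝ) : ℂ)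
          * g p) - ((‖x‖ ^ 2 + m : ℝ) : ℂ) * (Real.exp (phase p w) • g p) := fun p => by
    simp only [logDerivKernel, phaseMul, Complex.real_smul, hw]
    push_cast
    ring
  have hz := integral_logDerivKernel_eq_zero hm hν (f := f) ht x
    (k.1.congr (Filter.Eventually.of_forall fun p => (hform p).symm))
  rw [integral_congr_ae (Filter.Eventually.of_forall hform), k.2, integral_const_mul, integral_const_mul,
    integral_const_mul, ← hlap.1] at hz
  have hz' : (4 * t ^ 2 : ℂ) * Q t + 4 * (1 + ν) * M t +
      Laplacian.laplacian (fun x => expIntegral g (t ^ 2, ‖x‖ ^ 2, x)) x -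
      ((‖x‖ ^ 2 + m : ℝ) : ℂ) * N t = 0 := hz
  -- On the left the coefficient of `N` is `(4ν² - 2ν + 2ν(1-2ν))/t² = 0`, and those of `M` and `Q`
  -- are `4(1+ν)` and `4t²`. This is exactly the identity `hz'`.
  rw [iteratedDeriv_succ, iteratedDeriv_one, hu''.deriv, (hu' t ht).deriv, hermiteOp, hpl, hu t ht]
  have ht' : (t : ℂ) ≠ 0 := by exact_mod_cast ht.ne'
  have hL : Laplacian.laplacian (fun x => expIntegral g (t ^ 2, ‖x‖ ^ 2, x)) x =
      ((‖x‖ ^ 2 + m : ℝ) : ℂ) * N t - (4 * t ^ 2 : ℂ) * Q t - 4 * (1 + ν) * M t := by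
    linear_combination hz'
  rw [hL]
  generalize ((t ^ (2 * ν) / B : ℝ) : ℂ) = c
  push_cast
  field_simp
  ring

/-! ### The subordination density -/

/-- The substitution `y = 1/v` turns the integral into a Gamma integral. -/
theorem integral_subordinator {ν t : ℝ} (hν : 0 < ν) (ht : 0 < t) :
    ∫ v in Set.Ioi (0 : ℝ), subordinator ν t v = 1 := by
  have hG := Real.Gamma_pos_of_pos hν
  have h1 := integral_comp_rpow_Ioi
    (fun y : ℝ => y ^ (ν - 1) * Real.exp (-(t ^ 2 / 4 * y))) (p := -1) (by norm_num)
  rw [Real.integral_rpow_mul_exp_neg_mul_Ioi hν (by positivity)] at h1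
  have h2 : ∫ v in Set.Ioi (0 : ℝ), Real.exp (-(t ^ 2 / (4 * v))) / v ^ (1 + ν) =
      (1 / (t ^ 2 / 4)) ^ ν * Real.Gamma ν := by
    rw [← h1]
    refine setIntegral_congr_fun measurableSet_Ioi fun v hv => ?_
    have hv0 : 0 < v := hv
    have e1 : v ^ ((-1 : ℝ) - 1) * (v ^ (-1 : ℝ)) ^ (ν - 1) = (v ^ (1 + ν))⁻¹ := by
      rw [← Real.rpow_mul hv0.le, ← Real.rpow_add hv0, ← Real.rpow_neg hv0.le]
      congr 1; ring
    have e2 : -(t ^ 2 / 4 * v ^ (-1 : ℝ)) = -(t ^ 2 / (4 * v)) := by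
      rw [Real.rpow_neg_one]; field_simp
    simp only [smul_eq_mul, abs_neg, abs_one, one_mul]
    rw [← mul_assoc, e1, e2]
    ring
  unfold subordinator
  rw [integral_const_mul, h2]
  have e3 : (1 / (t ^ 2 / 4)) ^ ν = 4 ^ ν / t ^ (2 * ν) := by
    rw [one_div_div, Real.div_rpow (by norm_num) (by positivity), ← Real.rpow_natCast t 2,
      ← Real.rpow_mul ht.le]
    norm_num
  rw [e3]
  have : 0 < t ^ (2 * ν) := by positivity
  field_simp

/-- A non-integrable function would have Bochner integral `0`, not `1`. -/
theorem integrableOn_subordinator {ν t : ℝ} (hν : 0 < ν) (ht : 0 < t) :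
    IntegrableOn (subordinator ν t) (Set.Ioi 0) := by
  by_contra h
  have := integral_subordinator hν ht
  rw [integral_undef h] at this
  exact zero_ne_one this

theorem subordinator_nonneg {ν t v : ℝ} (hν : 0 < ν) (ht : 0 < t) (hv : 0 < v) :
    0 ≤ subordinator ν t v := by
  have := Real.Gamma_pos_of_pos hν
  unfold subordinator; positivity

/-- Away from `v = 0` the density is `O(t^{2ν})` relative to the density at `t = 1`, so the
contribution of `v ≥ δ` disappears as `t → 0`. -/
theorem subordinator_le {ν t v δ : ℝ} (hν : 0 < ν) (ht : 0 < t) (hδ : 0 < δ) (hv : δ ≤ v) :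
    subordinator ν t v ≤ t ^ (2 * ν) * Real.exp (1 / (4 * δ)) * subordinator ν 1 v := by
  have hG := Real.Gamma_pos_of_pos hν
  have hv0 : 0 < v := by linarith
  have h1 : Real.exp (-(t ^ 2 / (4 * v))) ≤
      Real.exp (1 / (4 * δ)) * Real.exp (-(1 ^ 2 / (4 * v))) := by
    rw [← Real.exp_add]
    apply Real.exp_le_exp.2
    have e1 : 0 ≤ t ^ 2 / (4 * v) := by positivity
    have e2 : 1 ^ 2 / (4 * v) ≤ 1 / (4 * δ) := by
      rw [one_pow]
      exact one_div_le_one_div_of_le (by linarith) (by linarith)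
    linarith
  unfold subordinator
  rw [Real.one_rpow]
  calc _ ≤ t ^ (2 * ν) / (4 ^ ν * Real.Gamma ν) *
        (Real.exp (1 / (4 * δ)) * Real.exp (-(1 ^ 2 / (4 * v))) / v ^ (1 + ν)) := by gcongr
    _ = _ := by ring

/-- The subordination densities form an approximate identity at `0`. -/
theorem tendsto_integral_subordinator_mul {ν : ℝ} (hν : 0 < ν) {H : ℝ → ℂ} {a : ℂ}
    (hint : ∀ t : ℝ, 0 < t → IntegrableOn (fun v => (subordinator ν t v : ℂ) * H v) (Set.Ioi 0))
    (hH : Filter.Tendsto H (𝓝[>] 0) (𝓝 a)) :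
    Filter.Tendsto (fun t => ∫ v in Set.Ioi (0 : ℝ), (subordinator ν t v : ℂ) * H v)
      (𝓝[>] 0) (𝓝 a) := by
  have hconst : ∀ t : ℝ, 0 < t → IntegrableOn (fun v => (subordinator ν t v : ℂ) * a) (Set.Ioi 0) :=
    fun t ht => (integrableOn_subordinator hν ht).ofReal.mul_const a
  have hsub : ∀ t : ℝ, 0 < t → IntegrableOn (fun v => (subordinator ν t v : ℂ) * (H v - a))
      (Set.Ioi 0) := fun t ht => by
    simp only [mul_sub]
    exact (hint t ht).sub (hconst t ht)
  rw [Metric.tendsto_nhds]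
  intro ε hε
  have h1 : ∀ᶠ v in 𝓝[>] (0 : ℝ), dist (H v) a < ε / 2 :=
    (Metric.tendsto_nhds.1 hH) (ε / 2) (by linarith)
  obtain ⟨δ, hδ, hδH⟩ := mem_nhdsGT_iff_exists_Ioo_subset.1 h1
  have hδ0 : 0 < δ := hδ
  -- No bound on `H` away from `0` is available. Integrability at the single time `t = 1` controls
  -- `v ≥ δ`; on `v < δ` the total mass `1` of the density gives `ε/2`.
  set I := ∫ v in Set.Ioi (0 : ℝ), ‖(subordinator ν 1 v : ℂ) * (H v - a)‖ with hI
  set c := Real.exp (1 / (4 * δ)) * I with hc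
  have h2 : Filter.Tendsto (fun t : ℝ => t ^ (2 * ν) * c) (𝓝[>] 0) (𝓝 0) := by
    have : Filter.Tendsto (fun t : ℝ => t ^ (2 * ν)) (𝓝[>] 0) (𝓝 ((0 : ℝ) ^ (2 * ν))) :=
      ((Real.continuousAt_rpow_const 0 (2 * ν) (Or.inr (by linarith))).tendsto).mono_left
        nhdsWithin_le_nhds
    rw [Real.zero_rpow (by linarith)] at this
    simpa using this.mul_const c
  filter_upwards [h2.eventually (gt_mem_nhds (half_pos hε)), self_mem_nhdsWithin] with t ht2 ht
  have ht0 : 0 < t := ht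
  have h3 : (∫ v in Set.Ioi (0 : ℝ), (subordinator ν t v : ℂ) * H v) - a =
      ∫ v in Set.Ioi (0 : ℝ), (subordinator ν t v : ℂ) * (H v - a) := by
    simp only [mul_sub]
    rw [integral_sub (hint t ht0) (hconst t ht0), integral_mul_const, integral_complex_ofReal,
      integral_subordinator hν ht0]
    simp
  rw [dist_eq_norm, h3]
  calc _ ≤ ∫ v in Set.Ioi (0 : ℝ), (ε / 2 * subordinator ν t v +
        t ^ (2 * ν) * Real.exp (1 / (4 * δ)) * ‖(subordinator ν 1 v : ℂ) * (H v - a)‖) := by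
        refine norm_integral_le_of_norm_le (((integrableOn_subordinator hν ht0).const_mul _).add
          ((hsub 1 one_pos).norm.const_mul _)) ?_
        filter_upwards [ae_restrict_mem measurableSet_Ioi] with v hv
        have hv0 : 0 < v := hv
        have hs := subordinator_nonneg hν ht0 hv0
        have hs1 := subordinator_nonneg hν one_pos hv0
        rw [norm_mul, norm_mul, Complex.norm_real, Complex.norm_real, Real.norm_of_nonneg hs,
          Real.norm_of_nonneg hs1]
        rcases lt_or_ge v δ with h | h
        · have h4 : ‖H v - a‖ < ε / 2 := by
            rw [← dist_eq_norm]
            exact hδH ⟨hv0, h⟩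
          have h5 : 0 ≤ t ^ (2 * ν) * Real.exp (1 / (4 * δ)) *
            (subordinator ν 1 v * ‖H v - a‖) := by positivity
          nlinarith
        · have h5 := mul_le_mul_of_nonneg_right (subordinator_le hν ht0 hδ0 h)
            (norm_nonneg (H v - a))
          have h6 : 0 ≤ ε / 2 * subordinator ν t v := by positivity
          linarith
    _ = ε / 2 + t ^ (2 * ν) * c := by
        rw [integral_add ((integrableOn_subordinator hν ht0).const_mul _)
          ((hsub 1 one_pos).norm.const_mul _), integral_const_mul, integral_const_mul,
          integral_subordinator hν ht0, hc]
        ring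
    _ < ε := by linarith

/-! ### Convergence of the heat semigroup at Lebesgue points -/

/-- Completing the square in `y` centres the Gaussian at `x / cosh 2v`; the remainder simplifies by
`cosh² - sinh² = 1`. -/
theorem integral_mehlerKernel (m : ℝ) {v : ℝ} (hv : 0 < v) (x : EuclideanSpace ℝ (Fin d)) :
    ∫ y, mehlerKernel m v x y = Real.exp (-(v * m)) * Real.cosh (2 * v) ^ (-(d : ℝ) / 2) *
      Real.exp (-(Real.sinh (2 * v) / (2 * Real.cosh (2 * v)) * ‖x‖ ^ 2)) := by
  set S := Real.sinh (2 * v) with hS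
  set c := Real.cosh (2 * v) with hc
  have hS0 : 0 < S := sinh_two_mul_pos hv
  have hc0 : 0 < c := Real.cosh_pos _
  have hcc : c ^ 2 = S ^ 2 + 1 := Real.cosh_sq _
  have hb : 0 < c / (2 * S) := by positivity
  have h1 : ∀ y, mehlerKernel m v x y = heatFactor d m v * Real.exp (-(S / (2 * c) * ‖x‖ ^ 2)) *
      Real.exp (-(c / (2 * S)) * ‖y - (1 / c) • x‖ ^ 2) := fun y => by
    rw [mehlerKernel_eq m hv, mul_assoc, ← Real.exp_add]
    congr 2
    rw [norm_sub_sq_real, inner_smul_right, norm_smul, real_inner_comm, coth, ← hS, ← hc,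
      Real.norm_of_nonneg (by positivity), mul_pow]
    have : S / (2 * c) = c / (2 * S) - 1 / (2 * S * c) := by
      field_simp; linarith
    rw [this]
    field_simp
    ring
  simp only [h1]
  rw [integral_const_mul, integral_sub_right_eq_self
    (fun y : EuclideanSpace ℝ (Fin d) => Real.exp (-(c / (2 * S)) * ‖y‖ ^ 2)),
    GaussianFourier.integral_rexp_neg_mul_sq_norm hb, finrank_euclideanSpace_fin, heatFactor]
  have h2 : (2 * Real.pi * S) ^ (-(d : ℝ) / 2) * (Real.pi / (c / (2 * S))) ^ ((d : ℝ) / 2) =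
      c ^ (-(d : ℝ) / 2) := by
    rw [show Real.pi / (c / (2 * S)) = 2 * Real.pi * S / c by field_simp,
      Real.div_rpow (by positivity) hc0.le, neg_div, Real.rpow_neg (by positivity),
      Real.rpow_neg hc0.le]
    have : (2 * Real.pi * S) ^ ((d : ℝ) / 2) ≠ 0 := by positivity
    field_simp
  rw [← h2]
  ring

/-- Constants thus belong to `L¹(φ)`, and so does `f - f(x)` for fixed `x`. -/
theorem integrable_weight (m : ℝ) {ν : ℝ} (hν : 0 < ν) :
    Integrable (weight m ν : EuclideanSpace ℝ (Fin d) → ℝ) := by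
  have h1 : Integrable fun y : EuclideanSpace ℝ (Fin d) => Real.exp (-(1 / 2) * ‖y‖ ^ 2) := by
    by_contra h
    have := GaussianFourier.integral_rexp_neg_mul_sq_norm (V := EuclideanSpace ℝ (Fin d))
      (b := 1 / 2) (by norm_num)
    rw [integral_undef h] at this
    have h2 : 0 < (Real.pi / (1 / 2)) ^
        ((Module.finrank ℝ (EuclideanSpace ℝ (Fin d)) : ℝ) / 2) := by
      have := Real.pi_pos; positivity
    exact h2.ne this
  refine h1.mono' (continuous_weight m ν).aestronglyMeasurable
    (Filter.Eventually.of_forall fun y => ?_)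
  rw [Real.norm_of_nonneg (weight_pos m ν y).le]
  refine (weight_le_exp m hν y).trans (le_of_eq ?_)
  ring_nf

theorem tendsto_integral_mehlerKernel (m : ℝ) (x : EuclideanSpace ℝ (Fin d)) :
    Filter.Tendsto (fun v => ∫ y, mehlerKernel m v x y) (𝓝[>] 0) (𝓝 1) := by
  have h1 : Continuous fun v : ℝ => Real.exp (-(v * m)) * Real.cosh (2 * v) ^ (-(d : ℝ) / 2) *
      Real.exp (-(Real.sinh (2 * v) / (2 * Real.cosh (2 * v)) * ‖x‖ ^ 2)) := by
    have h2 : ∀ v : ℝ, Real.cosh (2 * v) ≠ 0 := fun v => (Real.cosh_pos _).ne'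
    have h3 : Continuous fun v : ℝ => Real.cosh (2 * v) := by fun_prop
    have h4 : Continuous fun v : ℝ => Real.cosh (2 * v) ^ (-(d : ℝ) / 2) :=
      h3.rpow_const fun v => Or.inl (h2 v)
    have h5 : Continuous fun v : ℝ => Real.sinh (2 * v) / (2 * Real.cosh (2 * v)) :=
      Continuous.div (by fun_prop) (by fun_prop) fun v => mul_ne_zero two_ne_zero (h2 v)
    fun_prop
  have h6 := (h1.tendsto 0).mono_left (nhdsWithin_le_nhds (s := Set.Ioi 0))
  simp only [mul_zero, Real.cosh_zero, Real.one_rpow, Real.sinh_zero, zero_div, zero_mul, neg_zero,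
    Real.exp_zero, mul_one] at h6
  refine h6.congr' ?_
  filter_upwards [self_mem_nhdsWithin] with v hv
  exact (integral_mehlerKernel m hv x).symm

/-- Gaussian bound of the heat kernel for small times, relative to the weight. -/
theorem exists_mehlerKernel_le_gaussian (m : ℝ) {ν : ℝ} (hν : 0 < ν)
    (x : EuclideanSpace ℝ (Fin d)) :
    ∃ C > 0, ∀ v > 0, v ≤ 1 / 48 → ∀ y, mehlerKernel m v x y ≤
      C * (v ^ (-(d : ℝ) / 2) * Real.exp (-(‖x - y‖ ^ 2 / (16 * v)))) * weight m ν y := by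
  obtain ⟨c, hc, hcw⟩ := exists_exp_le_weight d m hν (ε := 1 / 2) (by norm_num)
  refine ⟨Real.exp |m| * Real.exp (4 * ‖x‖ ^ 2) / c, by positivity, fun v hv hv1 y => ?_⟩
  have e1 := heatFactor_le_rpow d m hv
  have e2 : Real.exp (|m| * v) ≤ Real.exp |m| :=
    Real.exp_le_exp.2 (mul_le_of_le_one_right (abs_nonneg m) (by linarith))
  set ρ := ‖x - y‖ with hρ
  have hy : ‖y‖ ≤ ‖x‖ + ρ := by
    have := norm_sub_norm_le y x
    rw [norm_sub_rev] at this
    linarith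
  have hx0 := norm_nonneg x
  have hy0 := norm_nonneg y
  have hρ0 : 0 ≤ ρ := norm_nonneg _
  have hy2 : ‖y‖ ^ 2 ≤ 2 * ‖x‖ ^ 2 + 2 * ρ ^ 2 := by nlinarith [sq_nonneg (‖x‖ - ρ)]
  have hip : |inner ℝ x y| ≤ 2 * ‖x‖ ^ 2 + ρ ^ 2 := by
    have := abs_real_inner_le_norm x y
    nlinarith [sq_nonneg (‖x‖ - ρ)]
  have hT0 : 0 ≤ Real.tanh v := by
    rw [Real.tanh_eq_sinh_div_cosh]
    exact div_nonneg (Real.sinh_pos_iff.2 hv).le (Real.cosh_pos _).le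
  have hT1 : Real.tanh v ≤ 1 := (Real.tanh_lt_one v).le
  have hTpos : 0 < Real.tanh (2 * v) := by
    rw [Real.tanh_eq_sinh_div_cosh]
    exact div_pos (sinh_two_mul_pos hv) (Real.cosh_pos _)
  have hTle : Real.tanh (2 * v) ≤ 4 * v := by
    rw [Real.tanh_eq_sinh_div_cosh]
    refine (div_le_self (sinh_two_mul_pos hv).le (Real.one_le_cosh _)).trans ?_
    have := sinh_le_two_mul (x := 2 * v) (by linarith) (by linarith)
    linarith
  have hg : ρ ^ 2 / (8 * v) ≤ ρ ^ 2 / (2 * Real.tanh (2 * v)) :=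
    div_le_div_of_nonneg_left (sq_nonneg _) (by linarith) (by linarith)
  -- The source of `1/48`: one `ρ²` comes from the inner product and `2ρ²` from `|y|² ≤ 2|x|² +
  -- 2ρ²`, the latter because the weight is bounded below by a multiple of `e^{-|y|²}`.
  have hg2 : 3 * ρ ^ 2 ≤ ρ ^ 2 / (16 * v) := by
    rw [le_div_iff₀ (by linarith)]; nlinarith [sq_nonneg ρ]
  have hg3 : ρ ^ 2 / (8 * v) = ρ ^ 2 / (16 * v) + ρ ^ 2 / (16 * v) := by field_simp; ring
  have hin : -(Real.tanh v * inner ℝ x y) ≤ 2 * ‖x‖ ^ 2 + ρ ^ 2 := by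
    have := neg_abs_le (inner ℝ x y : ℝ)
    nlinarith [abs_nonneg (inner ℝ x y : ℝ)]
  have hw := hcw y
  have hF := heatFactor_nonneg d m hv.le
  unfold mehlerKernel
  rw [← heatFactor]
  calc _ ≤ Real.exp |m| * v ^ (-(d : ℝ) / 2) * Real.exp (4 * ‖x‖ ^ 2 + -(ρ ^ 2 / (16 * v)) +
        (-(‖y‖ ^ 2 / 2) - 1 / 2 * ‖y‖ ^ 2)) := by
        gcongr
        · exact e1.trans (by gcongr)
        · linarith
    _ = Real.exp |m| * v ^ (-(d : ℝ) / 2) * (Real.exp (4 * ‖x‖ ^ 2) *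
        Real.exp (-(ρ ^ 2 / (16 * v))) * Real.exp (-(‖y‖ ^ 2 / 2) - 1 / 2 * ‖y‖ ^ 2)) := by
        rw [Real.exp_add, Real.exp_add]
    _ ≤ Real.exp |m| * v ^ (-(d : ℝ) / 2) * (Real.exp (4 * ‖x‖ ^ 2) *
        Real.exp (-(ρ ^ 2 / (16 * v))) * (weight m ν y / c)) := by
        gcongr
        rw [le_div_iff₀ hc, mul_comm]
        exact hw
    _ = _ := by ring

/-- Gaussian averages are controlled by averages over balls. -/
theorem exists_lintegral_gaussian_le (d : ℕ) : ∃ S₁ S₂ : ℝ, 0 ≤ S₁ ∧ 0 ≤ S₂ ∧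
    ∀ (x : EuclideanSpace ℝ (Fin d)) (h : EuclideanSpace ℝ (Fin d) → ℝ≥0∞), AEMeasurable h →
    ∀ A B : ℝ, 0 ≤ A → 0 ≤ B →
    (∀ τ > 0, ∫⁻ y in Metric.closedBall x τ, h y ≤
      ENNReal.ofReal (A * τ ^ d + B * τ ^ (d + 1))) →
    ∀ v > 0, ∫⁻ y, ENNReal.ofReal (v ^ (-(d : ℝ) / 2) * Real.exp (-(‖x - y‖ ^ 2 / (16 * v)))) * h y
      ≤ ENNReal.ofReal (A * S₁ + B * S₂ * √v) := by
  have hsum : ∀ n : ℕ, Summable fun k : ℕ =>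
      Real.exp 5 * (((k + 1 : ℕ) : ℝ) ^ n * Real.exp (-1 * ((k + 1 : ℕ) : ℝ))) := fun n =>
    ((summable_nat_add_iff 1).2 (Real.summable_pow_mul_exp_neg_nat_mul n one_pos)).mul_left _
  refine ⟨∑' k : ℕ, Real.exp 5 * (((k + 1 : ℕ) : ℝ) ^ d * Real.exp (-1 * ((k + 1 : ℕ) : ℝ))),
    ∑' k : ℕ, Real.exp 5 * (((k + 1 : ℕ) : ℝ) ^ (d + 1) * Real.exp (-1 * ((k + 1 : ℕ) : ℝ))),
    tsum_nonneg fun k => by positivity, tsum_nonneg fun k => by positivity,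
    fun x h hh A B hA hB hball v hv => ?_⟩
  set s := √v with hs
  have hs0 : 0 < s := Real.sqrt_pos.2 hv
  have hs2 : s ^ 2 = v := Real.sq_sqrt hv.le
  have hvd : v ^ (-(d : ℝ) / 2) = (s ^ d)⁻¹ := by
    rw [← hs2, ← Real.rpow_natCast s 2, ← Real.rpow_mul hs0.le, ← Real.rpow_natCast s d,
      ← Real.rpow_neg hs0.le]
    congr 1; push_cast; ring
  -- On the shell `k ≤ u < k+1`, `u = |x-y|/√v`, the inequality `(u-8)² ≥ 0` gives `-u²/16 ≤ 4 - u ≤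
  -- 5 - (k+1)`, whence `e^5` and the summable factor `e^{-(k+1)}`.
  set a : ℕ → ℝ := fun k => (s ^ d)⁻¹ * (Real.exp 5 * Real.exp (-1 * ((k + 1 : ℕ) : ℝ))) with ha
  have ha0 : ∀ k, 0 ≤ a k := fun k => by positivity
  have hpt : ∀ y, ENNReal.ofReal (v ^ (-(d : ℝ) / 2) * Real.exp (-(‖x - y‖ ^ 2 / (16 * v)))) * h y ≤
      ∑' k : ℕ, (Metric.closedBall x (((k + 1 : ℕ) : ℝ) * s)).indicator
        (fun y => ENNReal.ofReal (a k) * h y) y := by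
    intro y
    set u := ‖x - y‖ / s with hu
    have hu0 : 0 ≤ u := by positivity
    set k := ⌊u⌋₊ with hk
    have hku : u < ((k + 1 : ℕ) : ℝ) := by push_cast; exact Nat.lt_floor_add_one u
    have hku' : (k : ℝ) ≤ u := Nat.floor_le hu0
    refine le_trans ?_ (ENNReal.le_tsum k)
    have hmem : y ∈ Metric.closedBall x (((k + 1 : ℕ) : ℝ) * s) := by
      rw [Metric.mem_closedBall, dist_comm, dist_eq_norm]
      rw [hu, div_lt_iff₀ hs0] at hku
      exact hku.le
    rw [Set.indicator_of_mem hmem, hvd]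
    gcongr
    simp only [ha]
    gcongr
    rw [← Real.exp_add]
    apply Real.exp_le_exp.2
    have : ‖x - y‖ ^ 2 / (16 * v) = u ^ 2 / 16 := by
      rw [hu, ← hs2]; field_simp
    rw [this]
    push_cast
    nlinarith [sq_nonneg (u - 8)]
  calc _ ≤ ∫⁻ y, ∑' k : ℕ, (Metric.closedBall x (((k + 1 : ℕ) : ℝ) * s)).indicator
        (fun y => ENNReal.ofReal (a k) * h y) y := lintegral_mono hpt
    _ = ∑' k : ℕ, ENNReal.ofReal (a k) *
        ∫⁻ y in Metric.closedBall x (((k + 1 : ℕ) : ℝ) * s), h y := by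
        rw [lintegral_tsum fun k => (hh.const_mul _).indicator Metric.isClosed_closedBall.measurableSet]
        refine tsum_congr fun k => ?_
        rw [lintegral_indicator Metric.isClosed_closedBall.measurableSet,
          lintegral_const_mul' _ _ ENNReal.ofReal_ne_top]
    _ ≤ ∑' k : ℕ, ENNReal.ofReal
        (A * (Real.exp 5 * (((k + 1 : ℕ) : ℝ) ^ d * Real.exp (-1 * ((k + 1 : ℕ) : ℝ)))) +
        B * s * (Real.exp 5 * (((k + 1 : ℕ) : ℝ) ^ (d + 1) *
          Real.exp (-1 * ((k + 1 : ℕ) : ℝ))))) := by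
        refine ENNReal.tsum_le_tsum fun k => ?_
        calc _ ≤ ENNReal.ofReal (a k) * ENNReal.ofReal (A * (((k + 1 : ℕ) : ℝ) * s) ^ d +
              B * (((k + 1 : ℕ) : ℝ) * s) ^ (d + 1)) := by
              gcongr
              exact hball _ (by positivity)
          _ = _ := by
              rw [← ENNReal.ofReal_mul (ha0 k)]
              congr 1
              simp only [ha, mul_pow, pow_succ]
              field_simp
    _ = _ := by
        rw [← ENNReal.ofReal_tsum_of_nonneg (fun k => by positivity)
          (((hsum d).mul_left A).add ((hsum (d + 1)).mul_left (B * s))),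
          ((hsum d).mul_left A).tsum_add ((hsum (d + 1)).mul_left (B * s)),
          tsum_mul_left (a := A), tsum_mul_left (a := B * s)]
        congr 1; ring

theorem MemL1Weight.locallyIntegrable {m ν : ℝ} {f : EuclideanSpace ℝ (Fin d) → ℂ}
    (hf : MemL1Weight m ν f) : LocallyIntegrable f := by
  have h1 : Continuous fun y : EuclideanSpace ℝ (Fin d) => (weight m ν y)⁻¹ :=
    (continuous_weight m ν).inv₀ fun y => (weight_pos m ν y).ne'
  have h2 : LocallyIntegrable (fun y => weight m ν y • f y) := Integrable.locallyIntegrable hf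
  refine (h2.continuous_smul h1).congr (Filter.Eventually.of_forall fun y => ?_)
  simp [(weight_pos m ν y).ne']

/-- At a Lebesgue point the heat semigroup converges to the initial datum. -/
theorem MemL1Weight.ae_tendsto_heatIntegral {m ν : ℝ} (hν : 0 < ν)
    {f : EuclideanSpace ℝ (Fin d) → ℂ} (hf : MemL1Weight m ν f) :
    ∀ᵐ x, Filter.Tendsto (fun v => heatIntegral m v f x) (𝓝[>] 0) (𝓝 (f x)) := by
  obtain ⟨S₁, S₂, hS₁, hS₂, hS⟩ := exists_lintegral_gaussian_le d
  filter_upwards [IsUnifLocDoublingMeasure.ae_tendsto_average_norm_sub volume hf.locallyIntegrable 1]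
    with x hx
  have hx' := hx (l := 𝓝[>] (0 : ℝ)) (fun _ => x) (fun τ => τ) Filter.tendsto_id (by
    filter_upwards [self_mem_nhdsWithin] with τ hτ
    exact Metric.mem_closedBall_self (by simpa using (le_of_lt hτ)))
  obtain ⟨C, hC, hK⟩ := exists_mehlerKernel_le_gaussian m hν x
  set h : EuclideanSpace ℝ (Fin d) → ℝ≥0∞ :=
    fun y => ENNReal.ofReal (weight m ν y) * ‖f y - f x‖ₑ with hh
  have hfm := hf.aestronglyMeasurable
  have hhm : AEMeasurable h :=
    (continuous_weight m ν).measurable.ennreal_ofReal.aemeasurable.mul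
      (hfm.sub aestronglyMeasurable_const).enorm
  have hhfin : ∫⁻ y, h y < ⊤ := by
    have h1 : Integrable fun y => weight m ν y • (f y - f x) := by
      simp only [smul_sub]
      exact Integrable.sub hf ((integrable_weight m hν).smul_const (f x))
    have h2 := h1.2
    rw [HasFiniteIntegral] at h2
    refine lt_of_le_of_lt (lintegral_mono fun y => ?_) h2
    rw [enorm_smul, Real.enorm_of_nonneg (weight_pos m ν y).le]
  set Mx := (∫⁻ y, h y).toReal with hMx
  set β := (volume (Metric.ball (0 : EuclideanSpace ℝ (Fin d)) 1)).toReal with hβ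
  have hβ0 : 0 ≤ β := ENNReal.toReal_nonneg
  -- growth of the integrals over balls
  have hgrowth : ∀ ε > 0, ∃ B ≥ 0, ∀ τ > 0, ∫⁻ y in Metric.closedBall x τ, h y ≤
      ENNReal.ofReal (ε * β * τ ^ d + B * τ ^ (d + 1)) := by
    intro ε hε
    obtain ⟨δ, hδ, hδx⟩ := mem_nhdsGT_iff_exists_Ioo_subset.1
      (hx'.eventually (gt_mem_nhds hε))
    have hδ0 : 0 < δ := hδ
    refine ⟨Mx / δ ^ (d + 1), by positivity, fun τ hτ => ?_⟩
    have hMx0 : 0 ≤ Mx := ENNReal.toReal_nonneg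
    -- Small radii use the Lebesgue point and `φ ≤ 1`. For large radii the total mass `Mx` is
    -- enough, since `(τ/δ)^{d+1} ≥ 1`.
    rcases lt_or_ge τ δ with hlt | hge
    · have h1 : ⨍ y in Metric.closedBall x τ, ‖f y - f x‖ < ε := hδx ⟨hτ, hlt⟩
      have hvol : volume.real (Metric.closedBall x τ) = τ ^ d * β := by
        rw [measureReal_def, Measure.addHaar_closedBall _ _ hτ.le, ENNReal.toReal_mul,
          ENNReal.toReal_ofReal (by positivity), finrank_euclideanSpace_fin]
      have hint : IntegrableOn (fun y => ‖f y - f x‖) (Metric.closedBall x τ) := by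
        have := hf.locallyIntegrable.integrableOn_isCompact (isCompact_closedBall x τ)
        exact (Integrable.sub this (integrableOn_const
          (isCompact_closedBall x τ).measure_lt_top.ne)).norm
      have hpos : 0 < volume.real (Metric.closedBall x τ) := by
        rw [measureReal_def]
        exact ENNReal.toReal_pos (Metric.measure_closedBall_pos volume x hτ).ne'
          (isCompact_closedBall x τ).measure_lt_top.ne
      have h2 : ∫ y in Metric.closedBall x τ, ‖f y - f x‖ ≤ ε * β * τ ^ d := by
        rw [setAverage_eq, smul_eq_mul, inv_mul_lt_iff₀ hpos, hvol] at h1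
        linarith
      calc _ ≤ ∫⁻ y in Metric.closedBall x τ, ‖f y - f x‖ₑ := by
            refine lintegral_mono fun y => ?_
            refine mul_le_of_le_one_left zero_le ?_
            exact ENNReal.ofReal_le_one.2 (weight_le_one m hν y)
        _ = ENNReal.ofReal (∫ y in Metric.closedBall x τ, ‖f y - f x‖) := by
            rw [ofReal_integral_eq_lintegral_ofReal hint
              (Filter.Eventually.of_forall fun y => norm_nonneg _)]
            simp only [ofReal_norm]
        _ ≤ _ := by
            apply ENNReal.ofReal_le_ofReal
            have : 0 ≤ Mx / δ ^ (d + 1) * τ ^ (d + 1) := by positivity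
            linarith
    · calc _ ≤ ∫⁻ y, h y := setLIntegral_le_lintegral _ _
        _ = ENNReal.ofReal Mx := (ENNReal.ofReal_toReal hhfin.ne).symm
        _ ≤ _ := by
            apply ENNReal.ofReal_le_ofReal
            have h1 : 0 ≤ ε * β * τ ^ d := by positivity
            have h2 : Mx ≤ Mx / δ ^ (d + 1) * τ ^ (d + 1) := by
              rw [div_mul_eq_mul_div, le_div_iff₀ (by positivity)]
              gcongr
            linarith
  -- the deviation tends to zero
  have hdev : Filter.Tendsto (fun v => ∫ y, (mehlerKernel m v x y : ℂ) * (f y - f x))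
      (𝓝[>] 0) (𝓝 0) := by
    rw [Metric.tendsto_nhds]
    intro ε hε
    -- The choice makes the part that does not vanish with `v` at most `ε/2`; the `+ 1` guards
    -- against `β S₁ = 0`.
    obtain ⟨B, hB, hBall⟩ := hgrowth (ε / (2 * (C * (β * S₁ + 1)))) (by positivity)
    set A := ε / (2 * (C * (β * S₁ + 1))) * β with hA
    have hA0 : 0 ≤ A := by positivity
    have hlim : Filter.Tendsto (fun v : ℝ => C * (A * S₁ + B * S₂ * √v)) (𝓝[>] 0)
        (𝓝 (C * (A * S₁ + B * S₂ * √0))) :=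
      (Continuous.tendsto (by fun_prop) 0).mono_left nhdsWithin_le_nhds
    have hlt : C * (A * S₁ + B * S₂ * √0) < ε := by
      rw [Real.sqrt_zero, mul_zero, add_zero]
      have h1 : C * (A * S₁) = ε / 2 * (β * S₁ / (β * S₁ + 1)) := by
        rw [hA]; field_simp
      have h2 : β * S₁ / (β * S₁ + 1) ≤ 1 := by
        rw [div_le_one (by positivity)]; linarith
      rw [h1]; nlinarith
    filter_upwards [hlim.eventually (gt_mem_nhds hlt), Ioc_mem_nhdsGT
      (show (0 : ℝ) < 1 / 48 by norm_num)] with v hv1 hv2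
    rw [dist_zero_right]
    have hv0 : 0 < v := hv2.1
    have hb := hS x h hhm A B hA0 hB hBall v hv0
    refine lt_of_le_of_lt ?_ hv1
    have h3 : ENNReal.ofReal ‖∫ y, (mehlerKernel m v x y : ℂ) * (f y - f x)‖ ≤
        ENNReal.ofReal (C * (A * S₁ + B * S₂ * √v)) := by
      calc _ ≤ ∫⁻ y, ‖(mehlerKernel m v x y : ℂ) * (f y - f x)‖ₑ := by
            rw [ofReal_norm]; exact enorm_integral_le_lintegral_enorm _
        _ ≤ ∫⁻ y, ENNReal.ofReal C * (ENNReal.ofReal (v ^ (-(d : ℝ) / 2) *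
            Real.exp (-(‖x - y‖ ^ 2 / (16 * v)))) * h y) := by
            refine lintegral_mono fun y => ?_
            have hk0 := mehlerKernel_nonneg m hv0 x y
            have hw0 := weight_pos m ν y
            rw [enorm_mul, ← ofReal_norm (mehlerKernel m v x y : ℂ), Complex.norm_real,
              Real.norm_of_nonneg hk0]
            simp only [hh]
            rw [← mul_assoc, ← mul_assoc, ← ENNReal.ofReal_mul hC.le,
              ← ENNReal.ofReal_mul (by positivity)]
            gcongr
            exact hK v hv0 hv2.2 y
        _ ≤ ENNReal.ofReal C * ENNReal.ofReal (A * S₁ + B * S₂ * √v) := by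
            rw [lintegral_const_mul' _ _ ENNReal.ofReal_ne_top]
            gcongr
        _ = _ := by rw [← ENNReal.ofReal_mul hC.le]
    exact (ENNReal.ofReal_le_ofReal_iff (by positivity)).1 h3
  -- The heat kernel need not have mass one, so the constant `f x` is recovered only in the limit.
  have hone := ((Complex.continuous_ofReal.tendsto 1).comp
    (tendsto_integral_mehlerKernel m x)).mul_const (f x)
  have hsum := hdev.add hone
  rw [Complex.ofReal_one, one_mul, zero_add] at hsum
  refine hsum.congr' ?_
  filter_upwards [self_mem_nhdsWithin] with v hv
  have hv0 : 0 < v := hv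
  have hKint : Integrable fun y => (mehlerKernel m v x y : ℂ) * f x := by
    have h1 : Integrable fun y => mehlerKernel m v x y := by
      by_contra hn
      have h2 := integral_mehlerKernel m hv0 x
      rw [integral_undef hn] at h2
      have h3 : 0 < Real.exp (-(v * m)) * Real.cosh (2 * v) ^ (-(d : ℝ) / 2) *
          Real.exp (-(Real.sinh (2 * v) / (2 * Real.cosh (2 * v)) * ‖x‖ ^ 2)) := by
        have := Real.cosh_pos (2 * v); positivity
      exact h3.ne h2
    exact h1.ofReal.mul_const _
  simp only [mul_sub, Function.comp_apply]
  rw [integral_sub (hf.integrable_mehlerKernel_mul hν hv0 x) hKint, integral_mul_const,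
    integral_complex_ofReal, sub_add_cancel, heatIntegral]

theorem MemL1Weight.ae_tendsto_poissonIntegral {m ν : ℝ} (hm : -(d : ℝ) ≤ m) (hν : 0 < ν)
    {f : EuclideanSpace ℝ (Fin d) → ℂ} (hf : MemL1Weight m ν f) :
    ∀ᵐ x, Filter.Tendsto (fun t => poissonIntegral m ν t f x) (𝓝[>] 0) (𝓝 (f x)) := by
  filter_upwards [hf.ae_tendsto_heatIntegral hν] with x hx
  exact tendsto_integral_subordinator_mul hν
    (fun t ht => hf.integrableOn_subordinator_mul_heatIntegral hm hν ht x) hx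

end PoissonHermite

end

theorem theorem1 (d : ℕ) (m ν : ℝ) (hm : -(d : ℝ) ≤ m) (hν : 0 < ν) :
    (∀ f : EuclideanSpace ℝ (Fin d) → ℂ, PoissonHermite.MemL1Weight m ν f →
      -- absolute convergence: of `e^{-vL} f(x)`, of the iterated and of the double integral
      (∀ v : ℝ, 0 < v → ∀ x : EuclideanSpace ℝ (Fin d),
        MeasureTheory.Integrable (fun y => (PoissonHermite.mehlerKernel m v x y : ℂ) * f y)) ∧
      (∀ t : ℝ, 0 < t → ∀ x : EuclideanSpace ℝ (Fin d),
        MeasureTheory.IntegrableOn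
          (fun v : ℝ => (PoissonHermite.subordinator ν t v : ℂ) *
            PoissonHermite.heatIntegral m v f x) (Set.Ioi 0) ∧
        MeasureTheory.Integrable
          (fun p : ℝ × EuclideanSpace ℝ (Fin d) => (PoissonHermite.subordinator ν t p.1 : ℂ) *
            ((PoissonHermite.mehlerKernel m p.1 x p.2 : ℂ) * f p.2))
          ((MeasureTheory.volume.restrict (Set.Ioi (0 : ℝ))).prod MeasureTheory.volume)) ∧
      -- (i) smoothness
      ContDiffOn ℝ ∞
        (fun p : ℝ × EuclideanSpace ℝ (Fin d) => PoissonHermite.poissonIntegral m ν p.1 f p.2)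
        (Set.Ioi 0 ×ˢ Set.univ) ∧
      -- (ii) the partial differential equation
      (∀ t : ℝ, 0 < t → ∀ x : EuclideanSpace ℝ (Fin d),
        iteratedDeriv 2 (fun s => PoissonHermite.poissonIntegral m ν s f x) t +
            (((1 - 2 * ν) / t : ℝ) : ℂ) *
              deriv (fun s => PoissonHermite.poissonIntegral m ν s f x) t =
          PoissonHermite.hermiteOp m (PoissonHermite.poissonIntegral m ν t f) x) ∧
      -- (iii) almost everywhere convergence to the initial datum
      (∀ᵐ x : EuclideanSpace ℝ (Fin d),
        Filter.Tendsto (fun t => PoissonHermite.poissonIntegral m ν t f x) (𝓝[>] 0)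
          (𝓝 (f x)))) ∧
    -- converse
    (∀ f : EuclideanSpace ℝ (Fin d) → ℝ, AEMeasurable f → (∀ y, 0 ≤ f y) →
      (∃ t : ℝ, 0 < t ∧ ∃ x : EuclideanSpace ℝ (Fin d),
        PoissonHermite.poissonLIntegral m ν t (fun y => ENNReal.ofReal (f y)) x < ⊤) →
      PoissonHermite.MemL1Weight m ν f) := by
  refine ⟨fun f hf => ⟨fun v hv x => hf.integrable_mehlerKernel_mul hν hv x, fun t ht x =>
    ⟨hf.integrableOn_subordinator_mul_heatIntegral hm hν ht x,
      (hf.integrable_subordinator_mul hm hν ht x).1⟩, hf.contDiffOn_poissonIntegral hm hν,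
    fun t ht x => hf.poissonIntegral_pde hm hν ht x, hf.ae_tendsto_poissonIntegral hm hν⟩, ?_⟩
  rintro f hf hf0 ⟨t, ht, x, hx⟩
  exact PoissonHermite.memL1Weight_of_poissonLIntegral_lt_top hm hν hf hf0 ht hx
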